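/- Let $S=[-1/2,1/2]^2$ and let $O\subset\mathbb{R}^2$ be a compact convex set with nonempty interior and smooth ($C^1$) boundary. Call $O$ \emph{small} if it is contained in a closed ball of radius less than $\sqrt2/4$ centered at $\mathbf 0$. Consider the unit-speed billiard flow in $S\setminus\operatorname{int}O$, with optical reflections from the sides of $S$ and from $O$; at a vertex of $S$ a trajectory comes back along the line on which it arrived. The phase space is the set of pairs (position, unit velocity) with pre- and post-collision velocities identified. Unfold the billiard to $\mathbb{R}^2$ by consecutive reflections in the lines $x=n+1/2$ and $y=n+1/2$, $n\in\mathbb{Z}$; this gives a copy $O_{\mathbf k}$ of $O$ in the unit square centered at each $\mathbf k\in\mathbb{Z}^2$. Say that $O_{\mathbf j}$ is \emph{between} $O_{\mathbf i}$ and $O_{\mathbf k}$ if $\mathbf j\ne\mathbf i,\mathbf k$ and $O_{\mathbf j}$ intersects the convex hull of $O_{\mathbf i}\cup O_{\mathbf k}$. A finite or infinite sequence $(\mathbf k_n)_{n\ge0}$ in $\mathbb{Z}^2$ is \emph{admissible} if $\mathbf k_0=\mathbf 0$ and for all $n$ (for which the terms exist): $\mathbf k_{n+1}\neq\mathbf k_n$;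 no obstacle is between $O_{\mathbf k_n}$ and $O_{\mathbf k_{n+1}}$; and $O_{\mathbf k_{n+1}}$ is not between $O_{\mathbf k_n}$ and $O_{\mathbf k_{n+2}}$. A trajectory piece that begins and ends on the boundary of $O$, or an infinite trajectory $T:[0,\infty)\to S$, has \emph{admissible type} if the sequence of copies of $O$ from which a suitable unfolding of it consecutively reflects is admissible; tangencies are not counted as reflections, whereas a starting point, or for a piece also an endpoint, on the boundary of $O$ is counted. Fix $\mathbf z\in\operatorname{int}O$ and measure the displacement along a curve by the increment of $\phi(\mathbf x)=\arg(\mathbf x-\mathbf z)/(2\pi)$. The \emph{admissible rotation set} $AR$ is the set of all limits of $d_n/t_n$, where $d_n$ and $t_n$ are the displacement and the length of a trajectory piece of admissible type and $t_n\to\infty$. The \emph{rotation number} of an infinite trajectory is the limit, as $t\to\infty$, of its displacement over $[0,t]$ divided by $t$, if that limit exists. \textbf{Theorem.} Let $O$ be small. (1) $AR$ is convex; it is a nonempty closed interval $[-a,a]$ with some $a\ge0$. (2) The rotation numbers of periodic orbits of admissible type belong to $AR$ and are dense in $AR$. (3) For every $u$ in the interior of $AR$ there is a nonempty compact, forward invariant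 subset $Y$ of the phase space such that every trajectory starting in $Y$ has admissible type and rotation number $u$. (4) For every $\varepsilon>0$ there is $\delta>0$ such that $AR\supseteq[-\sqrt2/4+\varepsilon,\ \sqrt2/4-\varepsilon]$ for every convex obstacle $O$ as above that is contained in a disk centered at the origin of diameter less than $\delta$ (and for every $\mathbf z\in\operatorname{int}O$). -/

import Mathlib

open Set Filter Topology

namespace SquareBilliard

/-- The Euclidean plane. -/
abbrev Plane : Type := EuclideanSpace ℝ (Fin 2)

/-- The table `[-1/2, 1/2]²`. -/
def square : Set Plane := {x | ∀ i, |x i| ≤ 1 / 2}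

/-! ### The obstacle -/

/-- `O` has a smooth (`C¹`) boundary: near each boundary point, `O` is the sublevel set
`{g ≤ 0}` of a `C¹` function `g` with non-vanishing derivative. -/
def HasSmoothBoundary (O : Set Plane) : Prop :=
  ∀ p ∈ frontier O, ∃ g : Plane → ℝ, ContDiffAt ℝ 1 g p ∧ fderiv ℝ g p ≠ 0 ∧
    ∀ᶠ y in 𝓝 p, (y ∈ O ↔ g y ≤ 0)

/-- A convex obstacle with a smooth boundary: a convex body in the plane. -/
structure IsObstacle (O : Set Plane) : Prop where
  isCompact : IsCompact O
  convex : Convex ℝ O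
  nonempty_interior : (interior O).Nonempty
  smooth : HasSmoothBoundary O

/-- `O` is small: it lies in a closed ball of radius less than `√2 / 4` centered at the center of
the square. -/
def IsSmall (O : Set Plane) : Prop :=
  ∃ r : ℝ, r < √2 / 4 ∧ O ⊆ Metric.closedBall 0 r

/-- `n` is a unit outer normal vector of the convex set `O` at `x`; it is unique at every boundary
point of an obstacle. -/
def IsOuterNormal (O : Set Plane) (x n : Plane) : Prop :=
  ‖n‖ = 1 ∧ ∀ y ∈ O, inner ℝ n (y - x) ≤ 0

/-- `v` is the mirror image of `w` in the tangent line of `O` at `x`. -/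
def ObstacleReflection (O : Set Plane) (x w v : Plane) : Prop :=
  ∃ n, IsOuterNormal O x n ∧ v = w - (2 * inner ℝ w n) • n

/-! ### The phase space -/

/-- Pairs (position, unit velocity), the position being in the square and not in the interior of
the obstacle. -/
abbrev State (O : Set Plane) : Type :=
  {p : Plane × Plane // p.1 ∈ square ∧ p.1 ∉ interior O ∧ ‖p.2‖ = 1}

/-- The position of a state. -/
abbrev pos {O : Set Plane} (p : State O) : Plane := p.1.1

/-- The velocity of a state. -/
abbrev vel {O : Set Plane} (p : State O) : Plane := p.1.2

/-- Gluing of pre-collision and post-collision velocities, at the boundary of the obstacle and at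
the sides of the square (`x i = ± 1/2`). At a vertex both sides apply, so that `v` and `-v` get
identified there. -/
def Glued (O : Set Plane) (p q : State O) : Prop :=
  pos p = pos q ∧
    ((pos p ∈ frontier O ∧ ObstacleReflection O (pos p) (vel p) (vel q)) ∨
      ∃ i, |pos p i| = 1 / 2 ∧ ∀ j, vel q j = if j = i then -vel p j else vel p j)

/-- The phase space of the billiard, with the quotient topology: states modulo the equivalence
relation generated by the gluing. -/
abbrev PhaseSpace (O : Set Plane) : Type := Quot (Glued O)

/-! ### Trajectories in the square -/

/-- The collision law at the position `x`: `w` is the incoming and `v` the outgoing velocity. On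
the boundary of the obstacle this is the optical reflection. Elsewhere, the `i`-th component of the
velocity changes its sign when `x` is on a side `x i = ± 1/2`; so at a vertex the
trajectory comes back along the line on which it arrived, and at a point which is not on a side
the velocity does not change. -/
def CollisionLaw (O : Set Plane) (x w v : Plane) : Prop :=
  (x ∈ frontier O → ObstacleReflection O x w v) ∧
  (x ∉ frontier O → ∀ i, v i = if |x i| = 1 / 2 then -w i else w i)

/-- `γ` is a billiard trajectory on the time interval `I`, with unit speed. At each time
`t ∈ I`, `vel (γ t)` is the outgoing velocity, and it is obtained from the incoming velocity `w` by
the collision law. The values of `γ` outside `I` are irrelevant. -/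
def IsTrajectory (O : Set Plane) (I : Set ℝ) (γ : ℝ → State O) : Prop :=
  ∀ t ∈ I,
    (∀ᶠ s in 𝓝[I ∩ Ici t] t, pos (γ s) = pos (γ t) + (s - t) • vel (γ t)) ∧
    ∃ w, CollisionLaw O (pos (γ t)) w (vel (γ t)) ∧
      ∀ᶠ s in 𝓝[I ∩ Iic t] t, pos (γ s) = pos (γ t) + (s - t) • w

/-- The state `p` is at the boundary of the obstacle with a velocity that is not tangent to it. -/
def IsTransversal (O : Set Plane) (p : State O) : Prop :=
  pos p ∈ frontier O ∧ ∃ n, IsOuterNormal O (pos p) n ∧ inner ℝ n (vel p) ≠ 0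

/-! ### The unfolding -/

/-- The isometry of the plane that takes the unit square centered at `k ∈ ℤ²` onto the square
`[-1/2, 1/2]²`: translation by `-k`, followed by the reflection `x i ↦ -x i` for every `i` with
`k i` odd. -/
noncomputable def toTable (k : Fin 2 → ℤ) (x : Plane) : Plane :=
  WithLp.toLp 2 fun i => (-1 : ℝ) ^ (k i) * (x i - k i)

/-- The copy `O_k` of the obstacle in the unit square centered at `k`. -/
def obstacleCopy (O : Set Plane) (k : Fin 2 → ℤ) : Set Plane := toTable k ⁻¹' O

/-- The folding map from the plane onto the square. -/
noncomputable def fold (x : Plane) : Plane := toTable (fun i => round (x i)) x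

/-- `T` is an unfolding of the trajectory `γ` on `I`: a continuous curve in the plane that
folds to `γ` and goes straight whenever `γ` is not at the obstacle (so it passes straight through
the sides and the vertices of the copies of the square). -/
def IsUnfolding (O : Set Plane) (I : Set ℝ) (γ : ℝ → State O) (T : ℝ → Plane) : Prop :=
  ContinuousOn T I ∧ (∀ t ∈ I, fold (T t) = pos (γ t)) ∧
    ∀ t ∈ I, pos (γ t) ∉ O → ∃ u : Plane, ∀ᶠ s in 𝓝[I] t, T s = T t + (s - t) • u

/-! ### Admissible types -/

/-- `O_j` is between `O_i` and `O_k`. -/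
def Between (O : Set Plane) (i j k : Fin 2 → ℤ) : Prop :=
  j ≠ i ∧ j ≠ k ∧
    (obstacleCopy O j ∩ convexHull ℝ (obstacleCopy O i ∪ obstacleCopy O k)).Nonempty

/-- The finite sequence `k 0, …, k s` is admissible. -/
def AdmissibleUpTo (O : Set Plane) (s : ℕ) (k : ℕ → Fin 2 → ℤ) : Prop :=
  k 0 = 0 ∧
  (∀ n, n + 1 ≤ s → k (n + 1) ≠ k n) ∧
  (∀ n, n + 1 ≤ s → ∀ j, ¬ Between O (k n) j (k (n + 1))) ∧
  (∀ n, n + 2 ≤ s → ¬ Between O (k n) (k (n + 1)) (k (n + 2)))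

/-- The infinite sequence `k 0, k 1, …` is admissible. -/
def Admissible (O : Set Plane) (k : ℕ → Fin 2 → ℤ) : Prop :=
  k 0 = 0 ∧
  (∀ n, k (n + 1) ≠ k n) ∧
  (∀ n, ∀ j, ¬ Between O (k n) j (k (n + 1))) ∧
  (∀ n, ¬ Between O (k n) (k (n + 1)) (k (n + 2)))

/-- `γ` is, on the time interval `[0, L]`, a trajectory piece of admissible type: it starts and ends
at the boundary of the obstacle, and some unfolding of it starts at `O_{k 0}`, reflects
consecutively from `O_{k 1}, …, O_{k (s - 1)}` (at the times `τ 1, …, τ (s - 1)`; tangencies do not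
count as reflections) and ends at `O_{k s}`, where `k 0, …, k s` is admissible. -/
def IsAdmissiblePiece (O : Set Plane) (L : ℝ) (γ : ℝ → State O) : Prop :=
  0 < L ∧ IsTrajectory O (Icc 0 L) γ ∧
  ∃ (T : ℝ → Plane) (s : ℕ) (k : ℕ → Fin 2 → ℤ) (τ : ℕ → ℝ),
    IsUnfolding O (Icc 0 L) γ T ∧ AdmissibleUpTo O s k ∧
    τ 0 = 0 ∧ τ s = L ∧ StrictMonoOn τ (Iic s) ∧
    (∀ n ≤ s, T (τ n) ∈ frontier (obstacleCopy O (k n))) ∧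
    ∀ t ∈ Ioo 0 L, IsTransversal O (γ t) ↔ ∃ n, 0 < n ∧ n < s ∧ t = τ n

/-- The infinite trajectory `γ` (on `[0, ∞)`) has admissible type: the consecutive obstacles
from which an unfolding of it reflects form an admissible sequence. If `γ` starts at the boundary of
the obstacle, then the type begins with the obstacle at which it starts. -/
def HasAdmissibleType (O : Set Plane) (γ : ℝ → State O) : Prop :=
  ∃ (T : ℝ → Plane) (k : ℕ → Fin 2 → ℤ) (τ : ℕ → ℝ),
    IsUnfolding O (Ici 0) γ T ∧ Admissible O k ∧ 0 ≤ τ 0 ∧ StrictMono τ ∧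
    (∀ n, T (τ n) ∈ frontier (obstacleCopy O (k n))) ∧
    ∀ t, 0 ≤ t →
      ((IsTransversal O (γ t) ∨ (t = 0 ∧ pos (γ t) ∈ frontier O)) ↔ ∃ n, t = τ n)

/-! ### Displacement and rotation -/

/-- `φ` is, on `I`, a continuous branch of `arg (x - z) / (2π)` along the positions of `γ`. -/
def IsAngle {O : Set Plane} (z : Plane) (I : Set ℝ) (γ : ℝ → State O) (φ : ℝ → ℝ) : Prop :=
  ContinuousOn φ I ∧ ∀ t ∈ I,
    pos (γ t) - z =
      ‖pos (γ t) - z‖ • !₂[Real.cos (2 * Real.pi * φ t), Real.sin (2 * Real.pi * φ t)]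

/-- The admissible rotation set, the rotation being measured around `z`: all limits of
(increment of the angle) / (length) along trajectory pieces of admissible type whose lengths go to
infinity. -/
def admissibleRotationSet (O : Set Plane) (z : Plane) : Set ℝ :=
  {r | ∃ (L : ℕ → ℝ) (γ : ℕ → ℝ → State O) (φ : ℕ → ℝ → ℝ),
    (∀ n, IsAdmissiblePiece O (L n) (γ n) ∧ IsAngle z (Icc 0 (L n)) (γ n) (φ n)) ∧
    Tendsto L atTop atTop ∧
    Tendsto (fun n => (φ n (L n) - φ n 0) / L n) atTop (𝓝 r)}

/-- The trajectory `γ` on `[0, ∞)` has the rotation number `u`, measured around `z`. -/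
def HasRotationNumber {O : Set Plane} (z : Plane) (γ : ℝ → State O) (u : ℝ) : Prop :=
  ∃ φ : ℝ → ℝ, IsAngle z (Ici 0) γ φ ∧
    Tendsto (fun t => (φ t - φ 0) / t) atTop (𝓝 u)

/-- The set of rotation numbers of periodic orbits of admissible type. -/
def periodicRotationNumbers (O : Set Plane) (z : Plane) : Set ℝ :=
  {u | ∃ γ : ℝ → State O, IsTrajectory O (Ici 0) γ ∧
    (∃ p : ℝ, 0 < p ∧ ∀ t, 0 ≤ t → γ (t + p) = γ t) ∧
    HasAdmissibleType O γ ∧ HasRotationNumber z γ u}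

/-- The trajectory `γ` on `[0, ∞)` starts at the point `y` of the phase space. -/
def IsTrajectoryFrom {O : Set Plane} (y : PhaseSpace O) (γ : ℝ → State O) : Prop :=
  IsTrajectory O (Ici 0) γ ∧ Quot.mk _ (γ 0) = y

/-- `Y` is forward invariant: from each of its points a trajectory starts, and every trajectory that
starts in `Y` stays in `Y`. -/
def IsForwardInvariantSet {O : Set Plane} (Y : Set (PhaseSpace O)) : Prop :=
  ∀ y ∈ Y, (∃ γ, IsTrajectoryFrom y γ) ∧
    ∀ γ, IsTrajectoryFrom y γ → ∀ t : ℝ, 0 ≤ t → Quot.mk _ (γ t) ∈ Y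

end SquareBilliard

open SquareBilliard

/-! ### Continuous branches of the argument -/

namespace SquareBilliard

/-! Coding. In the frame of the obstacle it has just left, a path sees the next obstacle at a
nonzero lattice vector, its step. By symmetry of the unfolding (`between_relCell`), admissibility of
a sequence of cells is a condition on single steps (`IsStep`) and on pairs of consecutive steps
(`IsTurn`), so admissible sequences are the paths of a transition system. Smallness makes the unit
steps available as connectors: `isTurn_of_inner` allows every turn at which the directions to the
previous and to the next cell form no obtuse angle. Hence any admissible word extends, by at most
three unit steps, to a block, and blocks can be concatenated freely.

Existence. For a given periodic word, minimize the length of closed polygons with one vertex on each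
prescribed obstacle. The first-order condition at the minimum is the variational inequality
`IsBounce`, and the turn condition upgrades it to an honest optical reflection
(`IsBounce.exists_normal`). Thus each periodic word is realized by a periodic trajectory
(`exists_periodic_chain`, `isTrajectory_pathState`). Conversely, admissible trajectory pieces yield
such chains (`IsAdmissiblePiece.exists_chain`); uniqueness of the normal of the `C¹` boundary enters
there.

Rigidity. Two chains with the same finite word have almost the same length and displacement, with
errors independent of the number of steps (`IsPath.abs_sub_le`). For lengths this is convexity of
the norm: a chain is, up to its two ends, a global minimizer. For displacements, the folded position
on the hull of two consecutive obstacles is the product of a zero-free function and the positions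
relative to the two copies of `z`. The zero-free factor has a branch of the argument on the whole
convex hull. The other two factors are measured by branches cut along rays that both segments at a
bounce avoid, so their contributions telescope along the path.

Consequences. Lengths and displacements of periodic orbits are additive under concatenation of
blocks, up to constants. So the rotation set is the closure of the rotation numbers of blocks
(`admissibleRotationSet_eq`). Mixing blocks in given proportions gives convexity, time reversal
gives symmetry, and a bound of displacement by length gives compactness: hence an interval `[-a, a]`
in which the periodic rotation numbers are dense.

For `u` in the interior, take a block `A` that turns much more, and a block `B` that turns much
less, than `u` times its length, and append them greedily so that the excess stays bounded
(`exists_isBalanced`). All words whose finite subwords occur in the resulting infinite word are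
equally balanced. Since only finitely many steps occur, their billiard paths form a compact set, and
uniqueness of trajectories makes the image in the phase space forward invariant
(`exists_forwardInvariant`).

For a tiny obstacle, the constant word `(N, N + 1)` with `N` even is admissible. Its path runs
nearly parallel to a diagonal, between two lines through lattice points, and makes about `N / 2`
turns over a length of about `√2 N`, whence the bound `√2 / 4`. -/

/-- `θ` is, on `S`, a continuous branch of the argument of `f`, measured in turns. -/
def IsLift {α : Type*} [TopologicalSpace α] (f : α → ℂ) (θ : α → ℝ) (S : Set α) : Prop :=
  ContinuousOn θ S ∧ ∀ x ∈ S, f x = ‖f x‖ * Complex.exp (2 * Real.pi * θ x * Complex.I)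

lemma turns_sub_int {w : ℂ} (hw : w ≠ 0) {a b : ℝ}
    (ha : w = ‖w‖ * Complex.exp (2 * Real.pi * a * Complex.I))
    (hb : w = ‖w‖ * Complex.exp (2 * Real.pi * b * Complex.I)) : ∃ n : ℤ, a - b = n := by
  have h0 : (‖w‖ : ℂ) ≠ 0 := by simpa using hw
  have h : Complex.exp (2 * Real.pi * a * Complex.I) = Complex.exp (2 * Real.pi * b * Complex.I) :=
    mul_left_cancel₀ h0 (ha.symm.trans hb)
  obtain ⟨n, hn⟩ := Complex.exp_eq_exp_iff_exists_int.1 h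
  refine ⟨n, ?_⟩
  have h2 : (2 * Real.pi * Complex.I : ℂ) ≠ 0 := Complex.two_pi_I_ne_zero
  have h3 : (2 * Real.pi * Complex.I : ℂ) * a = (2 * Real.pi * Complex.I) * (b + n) := by
    linear_combination hn
  have h4 := mul_left_cancel₀ h2 h3
  have h5 : a = b + n := by exact_mod_cast h4
  linarith

lemma turns_arg (w : ℂ) :
    w = ‖w‖ * Complex.exp (2 * Real.pi * (w.arg / (2 * Real.pi) : ℝ) * Complex.I) := by
  have hpi : (Real.pi : ℂ) ≠ 0 := by exact_mod_cast Real.pi_ne_zero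
  have : (2 * Real.pi * (w.arg / (2 * Real.pi) : ℝ) * Complex.I : ℂ) = w.arg * Complex.I := by
    push_cast; field_simp
  rw [this, Complex.norm_mul_exp_arg_mul_I]

lemma turns_mul {v w : ℂ} {a b : ℝ}
    (ha : v = ‖v‖ * Complex.exp (2 * Real.pi * a * Complex.I))
    (hb : w = ‖w‖ * Complex.exp (2 * Real.pi * b * Complex.I)) :
    v * w = ‖v * w‖ * Complex.exp (2 * Real.pi * (a + b : ℝ) * Complex.I) := by
  conv_lhs => rw [ha, hb]
  have : (2 * Real.pi * (a + b : ℝ) * Complex.I : ℂ)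
      = 2 * Real.pi * a * Complex.I + 2 * Real.pi * b * Complex.I := by push_cast; ring
  rw [this, Complex.exp_add, norm_mul]
  push_cast; ring

section
variable {α β : Type*} [TopologicalSpace α] [TopologicalSpace β] {f g : α → ℂ} {θ η : α → ℝ}
  {S T : Set α}

lemma IsLift.mono (h : IsLift f θ S) (hT : T ⊆ S) : IsLift f θ T :=
  ⟨h.1.mono hT, fun x hx => h.2 x (hT hx)⟩

lemma IsLift.congr (h : IsLift f θ S) (hfg : ∀ x ∈ S, g x = f x) : IsLift g θ S :=
  ⟨h.1, fun x hx => by rw [hfg x hx]; exact h.2 x hx⟩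

lemma IsLift.comp (h : IsLift f θ S) {u : β → α} {U : Set β} (hu : ContinuousOn u U)
    (hm : MapsTo u U S) : IsLift (fun x => f (u x)) (fun x => θ (u x)) U :=
  ⟨h.1.comp hu hm, fun _ hx => h.2 _ (hm hx)⟩

lemma IsLift.mul (h : IsLift f θ S) (h' : IsLift g η S) :
    IsLift (fun x => f x * g x) (fun x => θ x + η x) S :=
  ⟨h.1.add h'.1, fun x hx => turns_mul (h.2 x hx) (h'.2 x hx)⟩

lemma IsLift.const_mul (h : IsLift f θ S) (w : ℂ) :
    IsLift (fun x => w * f x) (fun x => w.arg / (2 * Real.pi) + θ x) S :=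
  ⟨continuousOn_const.add h.1, fun x hx => turns_mul (turns_arg w) (h.2 x hx)⟩

lemma isLift_arg : IsLift (fun w : ℂ => w) (fun w => w.arg / (2 * Real.pi)) Complex.slitPlane :=
  ⟨Complex.continuousOn_arg.div_const _, fun w _ => turns_arg w⟩

/-- Two branches of the argument on a connected set differ by an integer. -/
lemma IsLift.exists_int (hS : IsPreconnected S) (h : IsLift f θ S) (h' : IsLift f η S)
    (hf : ∀ x ∈ S, f x ≠ 0) : ∃ n : ℤ, ∀ x ∈ S, θ x - η x = n := by
  rcases S.eq_empty_or_nonempty with rfl | ⟨a, ha⟩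
  · exact ⟨0, by simp⟩
  obtain ⟨n, hn⟩ := turns_sub_int (hf a ha) (h.2 a ha) (h'.2 a ha)
  refine ⟨n, fun x hx => ?_⟩
  have key := hS.constant_of_mapsTo (T := range ((↑) : ℤ → ℝ)) (f := fun x => θ x - η x)
    Int.isClosedEmbedding_coe_real.isEmbedding.isDiscrete_range
    (h.1.sub h'.1) (fun y hy => by
      obtain ⟨m, hm⟩ := turns_sub_int (hf y hy) (h.2 y hy) (h'.2 y hy)
      exact ⟨m, hm.symm⟩) hx ha
  exact key.trans hn

lemma IsLift.sub_eq (hS : IsPreconnected S) (h : IsLift f θ S) (h' : IsLift f η S)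
    (hf : ∀ x ∈ S, f x ≠ 0) {x y : α} (hx : x ∈ S) (hy : y ∈ S) :
    θ y - θ x = η y - η x := by
  obtain ⟨n, hn⟩ := h.exists_int hS h' hf
  have := hn x hx; have := hn y hy
  linarith

end

/-- On a convex set, a continuous non-vanishing function has a continuous branch of the argument. -/
lemma exists_isLift {E : Type*} [NormedAddCommGroup E] [NormedSpace ℝ E] {S : Set E}
    (hS : Convex ℝ S) {f : E → ℂ} (hf : ContinuousOn f S) (h0 : ∀ x ∈ S, f x ≠ 0) :
    ∃ θ : E → ℝ, IsLift f θ S := by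
  rcases S.eq_empty_or_nonempty with rfl | hne
  · exact ⟨fun _ => 0, continuousOn_empty _, by simp⟩
  obtain ⟨a, ha⟩ := hne
  have : ContractibleSpace S := hS.contractibleSpace ⟨a, ha⟩
  have : LocallyPathConnectedSpace S := hS.locallyPathConnectedSpace
  -- A convex set is contractible and locally path connected, so `f` lifts through the covering
  -- `exp`. The lift is a continuous logarithm, and its imaginary part divided by `2π` is the
  -- branch.
  obtain ⟨F, ⟨-, hF⟩, -⟩ := Complex.isCoveringMapOn_exp.existsUnique_continuousMap_lifts
    (⟨fun x : S => f x, hf.domRestrict⟩ : C(S, ℂ)) (a₀ := ⟨a, ha⟩) (e₀ := Complex.log (f a))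
    (Complex.exp_log (h0 a ha)) (fun x => h0 x x.2)
  have hF' : ∀ x : S, Complex.exp (F x) = f x := fun x => congrFun hF x
  classical
  refine ⟨fun x => if h : x ∈ S then (F ⟨x, h⟩).im / (2 * Real.pi) else 0, ?_, ?_⟩
  · rw [continuousOn_iff_continuous_domRestrict]
    have : S.domRestrict (fun x => if h : x ∈ S then (F ⟨x, h⟩).im / (2 * Real.pi) else 0)
        = fun x : S => (F x).im / (2 * Real.pi) := by
      ext x; simp [Set.domRestrict]
    rw [this]
    fun_prop
  · intro x hx
    have hpi : (Real.pi : ℂ) ≠ 0 := by exact_mod_cast Real.pi_ne_zero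
    simp only [hx, dif_pos]
    have h1 := hF' ⟨x, hx⟩
    simp only at h1
    have h3 : (2 * Real.pi * ((F ⟨x, hx⟩).im / (2 * Real.pi) : ℝ) * Complex.I : ℂ)
        = (F ⟨x, hx⟩).im * Complex.I := by push_cast; field_simp
    rw [h3, ← h1, Complex.norm_exp, Complex.ofReal_exp, ← Complex.exp_add, Complex.re_add_im]

/-- The angle of a curve with Lipschitz constant `1` that stays at distance `ρ` from the origin
changes by less than `1/4` in time less than `ρ`. -/
lemma IsLift.abs_sub_le_quarter {f : ℝ → ℂ} {θ : ℝ → ℝ} {a b ρ : ℝ} (h : IsLift f θ (Icc a b))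
    (hab : a ≤ b) (hρ : ∀ t ∈ Icc a b, ρ ≤ ‖f t‖) (hρ0 : 0 < ρ)
    (hl : ∀ s ∈ Icc a b, ∀ t ∈ Icc a b, ‖f t - f s‖ ≤ |t - s|) (hb : b - a < ρ) :
    |θ b - θ a| ≤ 1 / 4 := by
  have hfa : f a ≠ 0 := by
    have := hρ a ⟨le_rfl, hab⟩
    intro h0; rw [h0, norm_zero] at this; linarith
  -- The quotient stays in the open unit disc around `1`, so its principal argument is continuous
  -- and at most a quarter turn.
  have hre : ∀ t ∈ Icc a b, 0 < (f t / f a).re := by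
    intro t ht
    have h1 : ‖f t / f a - 1‖ < 1 := by
      rw [div_sub_one hfa, norm_div, div_lt_one (norm_pos_iff.2 hfa)]
      have h2 := hl a ⟨le_rfl, hab⟩ t ht
      have h3 := hρ a ⟨le_rfl, hab⟩
      rw [abs_of_nonneg (by linarith [ht.1])] at h2
      linarith [ht.2]
    have h2 := (abs_lt.1 ((Complex.abs_re_le_norm _).trans_lt h1)).1
    simp at h2; simpa using h2
  have hcont : ContinuousOn f (Icc a b) := by
    apply LipschitzOnWith.continuousOn (K := 1)
    rw [lipschitzOnWith_iff_dist_le_mul]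
    intro x hx y hy
    simpa [dist_eq_norm, Real.norm_eq_abs] using hl y hy x hx
  have hq : IsLift (fun t => f t / f a) (fun t => (f t / f a).arg / (2 * Real.pi)) (Icc a b) :=
    isLift_arg.comp (hcont.div_const _) (fun t ht => Or.inl (hre t ht))
  have h2 := hq.const_mul (f a)
  have h3 : IsLift f (fun t => (f a).arg / (2 * Real.pi) + (f t / f a).arg / (2 * Real.pi))
      (Icc a b) := h2.congr fun t _ => by field_simp
  have h0 : ∀ t ∈ Icc a b, f t ≠ 0 := fun t ht h0 => by
    have := hρ t ht
    rw [h0, norm_zero] at this; linarith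
  have h4 := h.sub_eq isPreconnected_Icc h3 h0 (left_mem_Icc.2 hab) (right_mem_Icc.2 hab)
  rw [h4]
  simp only [div_self hfa, Complex.arg_one, zero_div, add_zero]
  have h5 := Complex.abs_arg_lt_pi_div_two_iff.2 (Or.inl (hre b (right_mem_Icc.2 hab)))
  rw [add_sub_cancel_left, abs_div, abs_of_pos Real.two_pi_pos, div_le_iff₀ Real.two_pi_pos]
  linarith

/-- Cut the interval into pieces of length at most `ρ / 2`. Each contributes at most a quarter turn
by `IsLift.abs_sub_le_quarter`, and the rounding of the number of pieces is absorbed by the summand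
`1`. -/
lemma IsLift.abs_sub_le {f : ℝ → ℂ} {θ : ℝ → ℝ} {a b ρ : ℝ} (h : IsLift f θ (Icc a b))
    (hab : a ≤ b) (hρ : ∀ t ∈ Icc a b, ρ ≤ ‖f t‖) (hρ0 : 0 < ρ)
    (hl : ∀ s ∈ Icc a b, ∀ t ∈ Icc a b, ‖f t - f s‖ ≤ |t - s|) :
    |θ b - θ a| ≤ (b - a) / ρ + 1 := by
  have main : ∀ n : ℕ, ∀ b, a ≤ b → IsLift f θ (Icc a b) → (∀ t ∈ Icc a b, ρ ≤ ‖f t‖) →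
      (∀ s ∈ Icc a b, ∀ t ∈ Icc a b, ‖f t - f s‖ ≤ |t - s|) → b - a ≤ n * (ρ / 2) →
      |θ b - θ a| ≤ n / 4 := by
    intro n
    induction n with
    | zero =>
      intro b hab _ _ _ hn
      have : b = a := le_antisymm (by simpa using hn) hab
      simp [this]
    | succ n ih =>
      intro b hab h hρ hl hn
      push_cast at hn ⊢
      set c := max a (b - ρ / 2) with hc
      have hca : a ≤ c := le_max_left _ _
      have hcb : c ≤ b := max_le hab (by linarith)
      have hsub : Icc a c ⊆ Icc a b := Icc_subset_Icc le_rfl hcb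
      have hsub' : Icc c b ⊆ Icc a b := Icc_subset_Icc hca le_rfl
      have h1 := ih c hca (h.mono hsub) (fun t ht => hρ t (hsub ht))
        (fun s hs t ht => hl s (hsub hs) t (hsub ht)) (by
          rw [sub_le_iff_le_add]
          refine max_le ?_ (by linarith)
          have : 0 ≤ (n : ℝ) * (ρ / 2) := by positivity
          linarith)
      have h2 := (h.mono hsub').abs_sub_le_quarter hcb (fun t ht => hρ t (hsub' ht)) hρ0
        (fun s hs t ht => hl s (hsub' hs) t (hsub' ht)) (by linarith [le_max_right a (b - ρ / 2)])
      calc |θ b - θ a| = |(θ b - θ c) + (θ c - θ a)| := by ring_nf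
        _ ≤ 1 / 4 + n / 4 := (abs_add_le _ _).trans (add_le_add h2 h1)
        _ = _ := by ring
  have h1 := main ⌈(b - a) / (ρ / 2)⌉₊ b hab h hρ hl (by
    have := Nat.le_ceil ((b - a) / (ρ / 2))
    rwa [div_le_iff₀ (by positivity)] at this)
  have h2 := (Nat.ceil_lt_add_one (a := (b - a) / (ρ / 2))
    (div_nonneg (by linarith) (by positivity))).le
  have h3 : (b - a) / (ρ / 2) = 2 * ((b - a) / ρ) := by field_simp
  have h4 : 0 ≤ (b - a) / ρ := div_nonneg (by linarith) hρ0.le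
  rw [h3] at h2 h1
  linarith

end SquareBilliard

namespace SquareBilliard

/-! ### Cells and frames -/

/-- The center of a cell, as a point of the plane. -/
noncomputable def center (k : Fin 2 → ℤ) : Plane := WithLp.toLp 2 fun i => (k i : ℝ)

@[simp] lemma center_apply (k : Fin 2 → ℤ) (i : Fin 2) : center k i = k i := rfl

@[simp] lemma center_zero : center 0 = 0 := by ext i; simp

lemma neg_one_zpow_mul_self (n : ℤ) : (-1 : ℝ) ^ n * (-1 : ℝ) ^ n = 1 := by
  rw [← mul_zpow]; simp

lemma norm_sq_plane (v : Plane) : ‖v‖ ^ 2 = v 0 ^ 2 + v 1 ^ 2 := by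
  rw [EuclideanSpace.norm_sq_eq, Fin.sum_univ_two]; simp [sq_abs]

lemma inner_plane (v w : Plane) : inner ℝ v w = v 0 * w 0 + v 1 * w 1 := by
  rw [PiLp.inner_apply, Fin.sum_univ_two]; simp [mul_comm]

/-- The linear part of `toTable k`. -/
noncomputable def flip (k : Fin 2 → ℤ) : Plane ≃ₗᵢ[ℝ] Plane where
  toFun v := WithLp.toLp 2 fun i => (-1 : ℝ) ^ (k i) * v i
  invFun v := WithLp.toLp 2 fun i => (-1 : ℝ) ^ (k i) * v i
  map_add' v w := by ext i; simp [mul_add]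
  map_smul' c v := by ext i; simp; ring
  left_inv v := by ext i; simp [← mul_assoc, neg_one_zpow_mul_self]
  right_inv v := by ext i; simp [← mul_assoc, neg_one_zpow_mul_self]
  norm_map' v := by
    rw [← sq_eq_sq₀ (norm_nonneg _) (norm_nonneg _), norm_sq_plane, norm_sq_plane]
    change ((-1 : ℝ) ^ (k 0) * v 0) ^ 2 + ((-1 : ℝ) ^ (k 1) * v 1) ^ 2 = _
    linear_combination v 0 ^ 2 * neg_one_zpow_mul_self (k 0) +
      v 1 ^ 2 * neg_one_zpow_mul_self (k 1)

@[simp] lemma flip_apply (k : Fin 2 → ℤ) (v : Plane) (i : Fin 2) :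
    flip k v i = (-1 : ℝ) ^ (k i) * v i := rfl

@[simp] lemma flip_flip (k : Fin 2 → ℤ) (v : Plane) : flip k (flip k v) = v :=
  (flip k).left_inv v

lemma inner_flip_left (k : Fin 2 → ℤ) (v w : Plane) :
    inner ℝ (flip k v) w = inner ℝ v (flip k w) := by
  rw [← (flip k).inner_map_map v, flip_flip]

lemma cast_sign (n : ℤ) : (((n.negOnePow : ℤˣ) : ℤ) : ℝ) = (-1 : ℝ) ^ n :=
  Int.cast_negOnePow ℝ n

lemma sign_mul_self (n : ℤ) : ((n.negOnePow : ℤˣ) : ℤ) * ((n.negOnePow : ℤˣ) : ℤ) = 1 := by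
  rw [← Units.val_mul, Int.units_mul_self]; rfl

/-- The linear part of `toTable k`, on the lattice. -/
def intFlip (k j : Fin 2 → ℤ) : Fin 2 → ℤ := fun i => ((k i).negOnePow : ℤ) * j i

lemma center_intFlip (k j : Fin 2 → ℤ) : center (intFlip k j) = flip k (center j) := by
  ext i; rw [center_apply, intFlip, flip_apply, Int.cast_mul, cast_sign]; rfl

lemma intFlip_intFlip (k j : Fin 2 → ℤ) : intFlip k (intFlip k j) = j := by
  ext i; rw [intFlip, intFlip, ← mul_assoc, sign_mul_self, one_mul]

/-- The cell with the position `e` in the frame of the cell `k`. -/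
def nextCell (k e : Fin 2 → ℤ) : Fin 2 → ℤ := k + intFlip k e

/-- The position of the cell `l` in the frame of the cell `k`. -/
def relCell (k l : Fin 2 → ℤ) : Fin 2 → ℤ := intFlip k (l - k)

@[simp] lemma nextCell_relCell (k l : Fin 2 → ℤ) : nextCell k (relCell k l) = l := by
  simp [nextCell, relCell, intFlip_intFlip]

@[simp] lemma relCell_nextCell (k e : Fin 2 → ℤ) : relCell k (nextCell k e) = e := by
  simp [nextCell, relCell, intFlip_intFlip]

@[simp] lemma relCell_self (k : Fin 2 → ℤ) : relCell k k = 0 := by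
  ext i; simp [relCell, intFlip]

@[simp] lemma relCell_zero_left (e : Fin 2 → ℤ) : relCell 0 e = e := by
  ext i; simp [relCell, intFlip]

lemma relCell_injective (k : Fin 2 → ℤ) : Function.Injective (relCell k) := fun i j h => by
  rw [← nextCell_relCell k i, h, nextCell_relCell]

lemma negOnePow_mul_cast (u : ℤˣ) (n : ℤ) : ((u : ℤ) * n).negOnePow = n.negOnePow := by
  rcases Int.units_eq_one_or u with h | h <;> simp [h, Int.negOnePow_neg]

/-- Passing to the frame of `k` is compatible with passing to the frame of another cell. -/
lemma relCell_relCell (k i j : Fin 2 → ℤ) :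
    relCell (relCell k i) (relCell k j) = relCell i j := by
  ext s
  simp only [relCell, intFlip, Pi.sub_apply, negOnePow_mul_cast, Int.negOnePow_sub, Units.val_mul]
  linear_combination ((i s).negOnePow : ℤ) * (j s - i s) * sign_mul_self (k s)

lemma toTable_eq (k : Fin 2 → ℤ) (x : Plane) : toTable k x = flip k (x - center k) := by
  ext i; simp [toTable, mul_sub]

/-- `toTable k` as an isometry. -/
noncomputable def tab (k : Fin 2 → ℤ) : Plane ≃ᵃⁱ[ℝ] Plane :=
  (AffineIsometryEquiv.vaddConst ℝ (center k)).symm.trans (flip k).toAffineIsometryEquiv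

lemma tab_eq (k : Fin 2 → ℤ) (x : Plane) : tab k x = flip k (x - center k) := rfl

lemma toTable_eq_tab (k : Fin 2 → ℤ) : toTable k = tab k := by
  ext1 x; rw [toTable_eq, tab_eq]

lemma tab_symm_eq (k : Fin 2 → ℤ) (x : Plane) : (tab k).symm x = flip k x + center k := by
  rw [AffineIsometryEquiv.symm_apply_eq]
  simp [tab_eq]

@[simp] lemma tab_zero (x : Plane) : tab 0 x = x := by
  ext i; simp [tab_eq]

lemma tab_sub (k : Fin 2 → ℤ) (x y : Plane) : tab k x - tab k y = flip k (x - y) := by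
  simp [tab_eq, ← map_sub]

lemma tab_symm_sub (k : Fin 2 → ℤ) (x y : Plane) :
    (tab k).symm x - (tab k).symm y = flip k (x - y) := by
  simp [tab_symm_eq, ← map_sub]

lemma tab_add_smul (k : Fin 2 → ℤ) (x v : Plane) (t : ℝ) :
    tab k (x + t • v) = tab k x + t • flip k v := by
  simp [tab_eq, add_sub_right_comm]

/-- Changing the signs of the coordinates of `e` does not change their parities, so the reflections
compose without a correction. This is what allows a path to be recorded by relative steps. -/
lemma tab_nextCell (k e : Fin 2 → ℤ) (x : Plane) : tab (nextCell k e) x = tab e (tab k x) := by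
  ext i
  simp only [tab_eq, flip_apply, nextCell, intFlip, PiLp.sub_apply, center_apply, Pi.add_apply]
  rw [zpow_add₀ (by norm_num)]
  have h1 : (-1 : ℝ) ^ (((k i).negOnePow : ℤ) * e i) = (-1 : ℝ) ^ (e i) := by
    rw [← cast_sign, negOnePow_mul_cast, cast_sign]
  rw [h1, Int.cast_add, Int.cast_mul, cast_sign]
  linear_combination (-(-1 : ℝ) ^ (e i) * e i) * neg_one_zpow_mul_self (k i)

lemma tab_relCell (k l : Fin 2 → ℤ) (x : Plane) : tab (relCell k l) (tab k x) = tab l x := by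
  rw [← tab_nextCell, nextCell_relCell]

lemma tab_symm_nextCell (k e : Fin 2 → ℤ) (x : Plane) :
    (tab (nextCell k e)).symm x = (tab k).symm ((tab e).symm x) := by
  rw [AffineIsometryEquiv.symm_apply_eq, tab_nextCell]; simp

/-- In the frame of the cell `a`, the map of the cell `0` is the inverse of the map of `a`. -/
lemma tab_relCell_zero (a : Fin 2 → ℤ) (x : Plane) : tab (relCell a 0) x = (tab a).symm x := by
  have := tab_relCell a 0 ((tab a).symm x)
  simpa using this

lemma tab_symm_relCell_zero (a : Fin 2 → ℤ) (x : Plane) :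
    (tab (relCell a 0)).symm x = tab a x := by
  rw [AffineIsometryEquiv.symm_apply_eq, tab_relCell_zero]; simp

/-! ### The folding map -/

/-- The folding map of the line onto `[-1/2, 1/2]`. -/
noncomputable def foldLine (t : ℝ) : ℝ := (-1 : ℝ) ^ (round t) * (t - round t)

lemma fold_apply (x : Plane) (i : Fin 2) : fold x i = foldLine (x i) := rfl

/-- At a half-integer both adjacent cells give the same value, so the tie-breaking of `round` is
immaterial. -/
lemma foldLine_eq {t : ℝ} {m : ℤ} (h : |t - m| ≤ 1 / 2) :
    foldLine t = (-1 : ℝ) ^ m * (t - m) := by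
  have h1 := abs_sub_round t
  have h1' := abs_le.1 h1
  have h' := abs_le.1 h
  unfold foldLine
  set n := round t
  rcases lt_trichotomy m n with hlt | heq | hgt
  · have h2 : (m : ℝ) + 1 ≤ n := by exact_mod_cast hlt
    have h3 : n = m + 1 := by
      have : (n : ℝ) < m + 2 := by linarith
      have : n < m + 2 := by exact_mod_cast this
      omega
    have h4 : t = m + 1 / 2 := by rw [h3] at h1'; push_cast at h1'; linarith
    rw [h3, zpow_add₀ (by norm_num), h4]; push_cast; ring
  · rw [heq]
  · have h2 : (n : ℝ) + 1 ≤ m := by exact_mod_cast hgt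
    have h3 : m = n + 1 := by
      have : (m : ℝ) < n + 2 := by linarith
      have : m < n + 2 := by exact_mod_cast this
      omega
    have h4 : t = n + 1 / 2 := by rw [h3] at h'; push_cast at h'; linarith
    rw [h3, zpow_add₀ (by norm_num), h4]; push_cast; ring

lemma abs_neg_one_zpow_mul (m : ℤ) (t : ℝ) : |(-1 : ℝ) ^ m * t| = |t| := by
  rw [abs_mul, abs_zpow]; simp

lemma abs_foldLine (t : ℝ) : |foldLine t| = |t - round t| := abs_neg_one_zpow_mul _ _

lemma abs_foldLine_le (t : ℝ) : |foldLine t| ≤ 1 / 2 := by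
  rw [abs_foldLine]; exact abs_sub_round t

lemma foldLine_flip (m : ℤ) (t : ℝ) : foldLine ((-1 : ℝ) ^ m * (t - m)) = foldLine t := by
  have h := abs_sub_round t
  rw [foldLine_eq h]
  rcases Int.even_or_odd m with hm | hm
  · rw [hm.neg_one_zpow, one_mul, foldLine_eq (m := round t - m)
      (by push_cast; rwa [sub_sub_sub_cancel_right])]
    rw [zpow_sub₀ (by norm_num), hm.neg_one_zpow]; push_cast; ring
  · rw [hm.neg_one_zpow, foldLine_eq (m := -(round t - m))
      (by
        have e : -1 * (t - m) - ((-(round t - m) : ℤ) : ℝ) = -(t - round t) := by push_cast; ring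
        rw [e, abs_neg]; exact h)]
    rw [zpow_neg, zpow_sub₀ (by norm_num), hm.neg_one_zpow]; push_cast
    rcases Int.even_or_odd (round t) with hn | hn <;> rw [hn.neg_one_zpow] <;> ring

/-- All values lie in `[-1/2, 1/2]`, so only points at distance less than `1` need attention; these
lie in the same cell or in adjacent ones. -/
lemma abs_foldLine_sub_le (s t : ℝ) : |foldLine s - foldLine t| ≤ |s - t| := by
  wlog hst : s ≤ t generalizing s t
  · rw [abs_sub_comm, abs_sub_comm s]; exact this t s (le_of_not_ge hst)
  rcases le_or_gt 1 |s - t| with h | h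
  · have h1 := abs_foldLine_le s
    have h2 := abs_foldLine_le t
    exact (abs_sub _ _).trans (by linarith)
  · have h1 := abs_le.1 (abs_sub_round s)
    have h2 := abs_le.1 (abs_sub_round t)
    rw [abs_sub_comm s t, abs_of_nonneg (sub_nonneg.2 hst)] at h ⊢
    have h3 : round t < round s + 2 := by
      have : (round t : ℝ) < round s + 2 := by linarith
      exact_mod_cast this
    have h4 : round s < round t + 1 := by
      by_contra hc
      have : (round t : ℝ) + 1 ≤ round s := by exact_mod_cast not_lt.1 hc
      have h5 : s = t := by linarith
      rw [h5] at hc; omega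
    rcases (by omega : round t = round s ∨ round t = round s + 1) with h5 | h5
    · unfold foldLine
      rw [h5, ← mul_sub, abs_neg_one_zpow_mul]
      rw [abs_le]; constructor <;> linarith
    · unfold foldLine
      rw [h5, zpow_add₀ (by norm_num)]
      rw [h5] at h2
      push_cast at h2 ⊢
      have : (-1 : ℝ) ^ round s * (s - round s) - (-1) ^ round s * (-1) ^ (1 : ℤ) * (t - (round s + 1))
          = (-1 : ℝ) ^ round s * (s + t - 2 * round s - 1) := by ring
      rw [this, abs_neg_one_zpow_mul, abs_le]
      constructor <;> linarith

lemma norm_le_norm_of_abs_le {v w : Plane} (h : ∀ i, |v i| ≤ |w i|) : ‖v‖ ≤ ‖w‖ := by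
  rw [← sq_le_sq₀ (norm_nonneg _) (norm_nonneg _), norm_sq_plane, norm_sq_plane]
  exact add_le_add (sq_le_sq.2 (h 0)) (sq_le_sq.2 (h 1))

lemma norm_fold_sub_le (x y : Plane) : ‖fold x - fold y‖ ≤ ‖x - y‖ :=
  norm_le_norm_of_abs_le fun _ => abs_foldLine_sub_le _ _

lemma continuous_fold : Continuous fold := by
  have : LipschitzWith 1 fold := LipschitzWith.of_dist_le_mul fun x y => by
    simpa [dist_eq_norm] using norm_fold_sub_le x y
  exact this.continuous

lemma fold_tab (k : Fin 2 → ℤ) (x : Plane) : fold (tab k x) = fold x := by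
  ext i
  rw [fold_apply, fold_apply, ← foldLine_flip (k i) (x i)]; rfl

lemma fold_tab_symm (k : Fin 2 → ℤ) (x : Plane) : fold ((tab k).symm x) = fold x := by
  rw [← fold_tab k]; simp

lemma fold_eq_tab {x : Plane} {k : Fin 2 → ℤ} (h : ∀ i, |x i - k i| ≤ 1 / 2) :
    fold x = tab k x := by
  ext i
  rw [fold_apply, foldLine_eq (h i)]; rfl

lemma fold_mem_square (x : Plane) : fold x ∈ square := fun _ => abs_foldLine_le _

/-- The cell into which one enters from `t` in the direction `u`. -/
noncomputable def cellAhead (t u : ℝ) : ℤ := if u < 0 then ⌈t - 1 / 2⌉ else ⌊t + 1 / 2⌋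

/-- Off the half-integers the ceiling and the floor both give the nearest integer. At a half-integer
they select the lower and the upper cell, which is where motion in the direction `u` leads. -/
lemma cellAhead_spec (t u : ℝ) :
    ∀ᶠ h in 𝓝[≥] (0 : ℝ), |t + h * u - cellAhead t u| ≤ 1 / 2 := by
  unfold cellAhead
  split_ifs with hu
  · have h1 := Int.le_ceil (t - 1 / 2)
    have h2 := Int.ceil_lt_add_one (t - 1 / 2)
    have h3 : ∀ᶠ h in 𝓝 (0 : ℝ), (⌈t - 1 / 2⌉ : ℝ) - 1 / 2 < t + h * u := by
      apply ContinuousAt.eventually_lt (by fun_prop) (by fun_prop)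
      simp; linarith
    filter_upwards [mem_nhdsWithin_of_mem_nhds h3, self_mem_nhdsWithin] with h h4 h5
    have : h * u ≤ 0 := mul_nonpos_of_nonneg_of_nonpos h5 hu.le
    rw [abs_le]; constructor <;> linarith
  · have h1 := Int.floor_le (t + 1 / 2)
    have h2 := Int.lt_floor_add_one (t + 1 / 2)
    have h3 : ∀ᶠ h in 𝓝 (0 : ℝ), t + h * u < (⌊t + 1 / 2⌋ : ℝ) + 1 / 2 := by
      apply ContinuousAt.eventually_lt (by fun_prop) (by fun_prop)
      simp; linarith
    filter_upwards [mem_nhdsWithin_of_mem_nhds h3, self_mem_nhdsWithin] with h h4 h5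
    have : 0 ≤ h * u := mul_nonneg h5 (not_lt.1 hu)
    rw [abs_le]; constructor <;> linarith

/-- The cell into which one enters from `x` in the direction `u`. -/
noncomputable def cellsAhead (x u : Plane) : Fin 2 → ℤ := fun i => cellAhead (x i) (u i)

lemma cellsAhead_spec (x u : Plane) :
    ∀ᶠ h in 𝓝[≥] (0 : ℝ), ∀ i, |(x + h • u) i - cellsAhead x u i| ≤ 1 / 2 := by
  rw [eventually_all]
  intro i
  simpa using! cellAhead_spec (x i) (u i)

lemma cellsAhead_spec_self (x u : Plane) (i : Fin 2) :
    |x i - cellsAhead x u i| ≤ 1 / 2 := by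
  simpa using (cellsAhead_spec x u).self_of_nhdsWithin (by simp) i

/-- The velocity of the folded line that leaves `x` with the velocity `u`. -/
noncomputable def foldVel (x u : Plane) : Plane := flip (cellsAhead x u) u

@[simp] lemma norm_foldVel (x u : Plane) : ‖foldVel x u‖ = ‖u‖ := (flip _).norm_map u

lemma fold_add_smul (x u : Plane) :
    ∀ᶠ h in 𝓝[≥] (0 : ℝ), fold (x + h • u) = fold x + h • foldVel x u := by
  filter_upwards [cellsAhead_spec x u] with h hh
  rw [fold_eq_tab hh, fold_eq_tab (cellsAhead_spec_self x u), tab_add_smul]; rfl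

lemma cellAhead_of_abs_lt {t u : ℝ} {m : ℤ} (h : |t - m| < 1 / 2) : cellAhead t u = m := by
  have h' := abs_lt.1 h
  unfold cellAhead
  split_ifs with hu
  · rw [Int.ceil_eq_iff]; constructor <;> linarith
  · rw [Int.floor_eq_iff]; constructor <;> linarith

lemma foldVel_of_abs_lt {x u : Plane} {k : Fin 2 → ℤ} (h : ∀ i, |x i - k i| < 1 / 2) :
    foldVel x u = flip k u := by
  have : cellsAhead x u = k := funext fun i => cellAhead_of_abs_lt (h i)
  rw [foldVel, this]

/-- The folded velocity obeys the law of reflection at the sides. -/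
lemma foldVel_neg (x u : Plane) (i : Fin 2) :
    foldVel x u i = if |fold x i| = 1 / 2 then foldVel x (-u) i else -foldVel x (-u) i := by
  have key : ∀ t v : ℝ, (-1 : ℝ) ^ cellAhead t v * v = if |foldLine t| = 1 / 2 then
      (-1 : ℝ) ^ cellAhead t (-v) * (-v) else -((-1 : ℝ) ^ cellAhead t (-v) * (-v)) := by
    intro t v
    split_ifs with h
    · rw [abs_foldLine] at h
      obtain ⟨n, rfl⟩ : ∃ n : ℤ, t = n + 1 / 2 := by
        rcases abs_choice (t - round t) with h1 | h1 <;> rw [h1] at h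
        · exact ⟨round t, by linarith⟩
        · exact ⟨round t - 1, by push_cast; linarith⟩
      have c1 : ⌈(n : ℝ) + 1 / 2 - 1 / 2⌉ = n := by simp
      have c2 : ⌊(n : ℝ) + 1 / 2 + 1 / 2⌋ = n + 1 := by
        rw [add_assoc]; norm_num
      unfold cellAhead
      rw [c1, c2]
      rcases lt_trichotomy v 0 with hv | rfl | hv
      · rw [if_pos hv, if_neg (by linarith), zpow_add₀ (by norm_num)]; ring
      · simp
      · rw [if_neg (by linarith), if_pos (by linarith), zpow_add₀ (by norm_num)]; ring
    · rw [abs_foldLine] at h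
      have h1 : |t - round t| < 1 / 2 := lt_of_le_of_ne (abs_sub_round t) h
      rw [cellAhead_of_abs_lt h1, cellAhead_of_abs_lt h1]; ring
  exact key (x i) (u i)

/-- The folded velocity can be read off from the folded half-line, which does not change under the
symmetries `tab k`. -/
lemma foldVel_tab (k : Fin 2 → ℤ) (x u : Plane) : foldVel (tab k x) (flip k u) = foldVel x u := by
  have h1 := fold_add_smul x u
  have h2 := fold_add_smul (tab k x) (flip k u)
  have h3 : ∀ᶠ h in 𝓝[>] (0 : ℝ), h • foldVel (tab k x) (flip k u) = h • foldVel x u := by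
    have hle : 𝓝[>] (0 : ℝ) ≤ 𝓝[≥] 0 := nhdsWithin_mono _ Ioi_subset_Ici_self
    filter_upwards [h1.filter_mono hle, h2.filter_mono hle] with h h1 h2
    rw [← tab_add_smul, fold_tab, fold_tab, h1] at h2
    exact (add_left_cancel h2).symm
  obtain ⟨h, h4, h5⟩ := (h3.and self_mem_nhdsWithin).exists
  exact smul_right_injective _ (ne_of_gt h5) h4

end SquareBilliard

namespace SquareBilliard

/-! ### Copies of the obstacle -/

lemma abs_apply_le_norm (v : Plane) (i : Fin 2) : |v i| ≤ ‖v‖ := by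
  simpa using PiLp.norm_apply_le v i

lemma sqrt_two_div_four_lt : √2 / 4 < 1 / 2 := by
  have : √2 < 2 := by rw [Real.sqrt_lt' (by norm_num)]; norm_num
  linarith

/-- The constant of smallness enters here: an obstacle between two others has its center at squared
distance less than `1/2` from the segment joining their centers. -/
lemma two_mul_sqrt_two_div_four_sq : (2 * (√2 / 4)) ^ 2 = 1 / 2 := by
  have := Real.sq_sqrt (show (0 : ℝ) ≤ 2 by norm_num)
  linear_combination (1 / 4) * this

lemma IsSmall.norm_lt {O : Set Plane} (hs : IsSmall O) {x : Plane} (hx : x ∈ O) :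
    ‖x‖ < √2 / 4 := by
  obtain ⟨r, hr, h⟩ := hs
  exact (mem_closedBall_zero_iff.1 (h hx)).trans_lt hr

section
variable {O : Set Plane}

lemma mem_copy {k : Fin 2 → ℤ} {x : Plane} : x ∈ obstacleCopy O k ↔ tab k x ∈ O := by
  rw [obstacleCopy, toTable_eq_tab]; rfl

lemma copy_eq (k : Fin 2 → ℤ) : obstacleCopy O k = tab k ⁻¹' O := by
  ext x; exact mem_copy

@[simp] lemma copy_zero : obstacleCopy O 0 = O := by ext x; simp [mem_copy]

lemma tab_symm_mem_copy {k : Fin 2 → ℤ} {y : Plane} : (tab k).symm y ∈ obstacleCopy O k ↔ y ∈ O := by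
  simp [mem_copy]

lemma copy_relCell (k l : Fin 2 → ℤ) :
    obstacleCopy O l = tab k ⁻¹' obstacleCopy O (relCell k l) := by
  ext x; rw [mem_preimage, mem_copy, mem_copy, tab_relCell]

lemma frontier_copy (k : Fin 2 → ℤ) : frontier (obstacleCopy O k) = tab k ⁻¹' frontier O := by
  rw [copy_eq]; exact ((tab k).toHomeomorph.preimage_frontier O).symm

lemma mem_frontier_copy {k : Fin 2 → ℤ} {x : Plane} :
    x ∈ frontier (obstacleCopy O k) ↔ tab k x ∈ frontier O := by rw [frontier_copy]; rfl

lemma isCompact_copy (hO : IsObstacle O) (k : Fin 2 → ℤ) : IsCompact (obstacleCopy O k) := by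
  rw [copy_eq]; exact (tab k).toHomeomorph.isCompact_preimage.2 hO.isCompact

lemma convex_copy (hO : IsObstacle O) (k : Fin 2 → ℤ) : Convex ℝ (obstacleCopy O k) := by
  rw [copy_eq]; exact hO.convex.affine_preimage (tab k).toAffineEquiv.toAffineMap

lemma norm_sub_center (k : Fin 2 → ℤ) (x : Plane) : ‖x - center k‖ = ‖tab k x‖ := by
  rw [tab_eq]; exact ((flip k).norm_map _).symm

lemma abs_sub_lt_of_mem_copy (hs : IsSmall O) {k : Fin 2 → ℤ} {x : Plane}
    (hx : x ∈ obstacleCopy O k) (i : Fin 2) : |x i - k i| < 1 / 2 := by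
  have h1 := abs_apply_le_norm (x - center k) i
  rw [norm_sub_center] at h1
  exact (h1.trans_lt (hs.norm_lt (mem_copy.1 hx))).trans sqrt_two_div_four_lt

lemma fold_of_mem_copy (hs : IsSmall O) {k : Fin 2 → ℤ} {x : Plane}
    (hx : x ∈ obstacleCopy O k) : fold x = tab k x :=
  fold_eq_tab fun i => (abs_sub_lt_of_mem_copy hs hx i).le

lemma fold_mem_iff (hs : IsSmall O) {x : Plane} :
    fold x ∈ O ↔ ∃ k, x ∈ obstacleCopy O k := by
  constructor
  · intro h
    refine ⟨fun i => round (x i), mem_copy.2 ?_⟩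
    rwa [← fold_eq_tab fun i => abs_sub_round (x i)]
  · rintro ⟨k, hk⟩
    rw [fold_of_mem_copy hs hk]; exact mem_copy.1 hk

lemma copy_unique (hs : IsSmall O) {k l : Fin 2 → ℤ} {x : Plane}
    (hk : x ∈ obstacleCopy O k) (hl : x ∈ obstacleCopy O l) : k = l := by
  ext i
  have h1 := abs_lt.1 (abs_sub_lt_of_mem_copy hs hk i)
  have h2 := abs_lt.1 (abs_sub_lt_of_mem_copy hs hl i)
  have h3 : (k i : ℝ) < l i + 1 := by linarith
  have h4 : (l i : ℝ) < k i + 1 := by linarith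
  have h5 : k i < l i + 1 := by exact_mod_cast h3
  have h6 : l i < k i + 1 := by exact_mod_cast h4
  omega

lemma eventually_abs_sub_lt {k : Fin 2 → ℤ} {x : Plane} (h : ∀ i, |x i - k i| < 1 / 2) :
    ∀ᶠ y : Plane in 𝓝 x, ∀ i, |y i - k i| < 1 / 2 := by
  rw [eventually_all]
  intro i
  exact ContinuousAt.eventually_lt (by fun_prop) (by fun_prop) (h i)

/-! ### Obstacles between obstacles -/

/-- The affine isometry `tab k` carries copies to copies and convex hulls to convex hulls, so
admissibility can be tested in any frame. -/
lemma between_relCell (k i j l : Fin 2 → ℤ) :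
    Between O (relCell k i) (relCell k j) (relCell k l) ↔ Between O i j l := by
  have hinj := relCell_injective k
  have h1 : convexHull ℝ (obstacleCopy O i ∪ obstacleCopy O l) =
      tab k ⁻¹' convexHull ℝ (obstacleCopy O (relCell k i) ∪ obstacleCopy O (relCell k l)) := by
    rw [copy_relCell k i, copy_relCell k l, ← preimage_union]
    have h2 := ((tab k).symm.toAffineEquiv.toAffineMap).image_convexHull
      (obstacleCopy O (relCell k i) ∪ obstacleCopy O (relCell k l))
    have h3 : ∀ A : Set Plane, (tab k).symm.toAffineEquiv.toAffineMap '' A = tab k ⁻¹' A :=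
      fun A => (tab k).toHomeomorph.symm.toEquiv.image_eq_preimage_symm A
    rw [h3, h3] at h2
    exact h2.symm
  unfold Between
  rw [hinj.ne_iff, hinj.ne_iff, h1, copy_relCell k j, ← preimage_inter,
    (tab k).surjective.nonempty_preimage]

/-- The convex hull of two obstacles lies close to the segment between their centers. -/
lemma convexHull_copy_near {ρ : ℝ} (hρ : ∀ x ∈ O, ‖x‖ < ρ) {i l : Fin 2 → ℤ} {x : Plane}
    (hx : x ∈ convexHull ℝ (obstacleCopy O i ∪ obstacleCopy O l)) :
    ∃ t ∈ Icc (0 : ℝ) 1, ‖x - (center i + t • (center l - center i))‖ < ρ := by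
  have h1 : obstacleCopy O i ∪ obstacleCopy O l ⊆
      Metric.thickening ρ (segment ℝ (center i) (center l)) := by
    rintro y (hy | hy)
    · rw [Metric.mem_thickening_iff]
      refine ⟨_, left_mem_segment ℝ _ _, ?_⟩
      rw [dist_eq_norm, norm_sub_center]; exact hρ _ (mem_copy.1 hy)
    · rw [Metric.mem_thickening_iff]
      refine ⟨_, right_mem_segment ℝ _ _, ?_⟩
      rw [dist_eq_norm, norm_sub_center]; exact hρ _ (mem_copy.1 hy)
  have h2 := convexHull_min h1 ((convex_segment (𝕜 := ℝ) _ _).thickening ρ) hx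
  rw [Metric.mem_thickening_iff] at h2
  obtain ⟨y, hy, hd⟩ := h2
  rw [segment_eq_image'] at hy
  obtain ⟨t, ht, rfl⟩ := hy
  exact ⟨t, ht, by rwa [← dist_eq_norm]⟩

/-- A common point of `O_j` and the hull is within `ρ` of the center of `j` and within `ρ` of the
segment of centers. -/
lemma Between.near {ρ : ℝ} (hρ : ∀ x ∈ O, ‖x‖ < ρ) {i j l : Fin 2 → ℤ} (h : Between O i j l) :
    ∃ t ∈ Icc (0 : ℝ) 1, ‖center j - (center i + t • (center l - center i))‖ < 2 * ρ := by
  obtain ⟨-, -, x, hx, hx'⟩ := h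
  obtain ⟨t, ht, h1⟩ := convexHull_copy_near hρ hx'
  refine ⟨t, ht, ?_⟩
  have h2 : ‖x - center j‖ < ρ := by rw [norm_sub_center]; exact hρ _ (mem_copy.1 hx)
  rw [norm_sub_rev] at h2
  calc _ = ‖(center j - x) + (x - (center i + t • (center l - center i)))‖ := by congr 1; abel
    _ ≤ _ := norm_add_le _ _
    _ < _ := by linarith

/-! ### Words -/

/-- From the cell `0`, the obstacle in the cell `a` can come next in an admissible sequence. -/
def IsStep (O : Set Plane) (a : Fin 2 → ℤ) : Prop := a ≠ 0 ∧ ∀ j, ¬ Between O 0 j a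

/-- The step `a` can be followed by the step `f` in an admissible sequence, `f` being seen in the
frame of the cell into which `a` leads. -/
def IsTurn (O : Set Plane) (a f : Fin 2 → ℤ) : Prop := ¬ Between O (relCell a 0) 0 f

lemma isStep_relCell {k l : Fin 2 → ℤ} :
    IsStep O (relCell k l) ↔ l ≠ k ∧ ∀ j, ¬ Between O k j l := by
  unfold IsStep
  have h0 : ∀ j, Between O 0 (relCell k j) (relCell k l) ↔ Between O k j l := fun j => by
    rw [← between_relCell k k j l, relCell_self]
  refine and_congr ?_ ⟨fun h j hj => h _ ((h0 j).2 hj), fun h j hj => ?_⟩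
  · rw [← relCell_self k, (relCell_injective k).ne_iff]
  · rw [← relCell_nextCell k j, h0] at hj
    exact h _ hj

lemma relCell_relCell_zero (k l : Fin 2 → ℤ) : relCell (relCell k l) 0 = relCell l k := by
  have := relCell_relCell k l k
  rwa [relCell_self] at this

lemma isTurn_relCell {k l m : Fin 2 → ℤ} :
    IsTurn O (relCell k l) (relCell l m) ↔ ¬ Between O k l m := by
  unfold IsTurn
  rw [relCell_relCell_zero, ← between_relCell l k l m, relCell_self]

/-- All steps and all pairs of consecutive steps of the infinite word `e` are allowed. -/
def IsWord (O : Set Plane) (e : ℕ → Fin 2 → ℤ) : Prop :=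
  (∀ n, IsStep O (e n)) ∧ ∀ n, IsTurn O (e n) (e (n + 1))

/-- The sequence of cells with the steps `e`. -/
def cells (e : ℕ → Fin 2 → ℤ) : ℕ → Fin 2 → ℤ
  | 0 => 0
  | n + 1 => nextCell (cells e n) (e n)

@[simp] lemma relCell_cells_succ (e : ℕ → Fin 2 → ℤ) (n : ℕ) :
    relCell (cells e n) (cells e (n + 1)) = e n := relCell_nextCell _ _

lemma nextCell_nextCell (k a b : Fin 2 → ℤ) :
    nextCell (nextCell k a) b = nextCell k (nextCell a b) := by
  apply relCell_injective k
  rw [relCell_nextCell]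
  apply relCell_injective a
  rw [relCell_nextCell]
  conv_lhs => enter [1]; rw [← relCell_nextCell k a]
  rw [relCell_relCell, relCell_nextCell]

lemma cells_shift (e : ℕ → Fin 2 → ℤ) (m n : ℕ) :
    cells e (m + n) = nextCell (cells e m) (cells (fun i => e (m + i)) n) := by
  induction n with
  | zero => ext i; simp [cells, nextCell, intFlip]
  | succ n ih => rw [← add_assoc, cells, ih, nextCell_nextCell]; rfl

lemma IsWord.shift {e : ℕ → Fin 2 → ℤ} (h : IsWord O e) (m : ℕ) :
    IsWord O fun i => e (m + i) := ⟨fun _ => h.1 _, fun _ => h.2 _⟩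

lemma IsWord.admissible {e : ℕ → Fin 2 → ℤ} (h : IsWord O e) : Admissible O (cells e) := by
  have h1 : ∀ n, cells e (n + 1) ≠ cells e n ∧ ∀ j, ¬ Between O (cells e n) j (cells e (n + 1)) :=
    fun n => isStep_relCell.1 (by rw [relCell_cells_succ]; exact h.1 n)
  refine ⟨rfl, fun n => (h1 n).1, fun n => (h1 n).2, fun n => ?_⟩
  rw [← isTurn_relCell, relCell_cells_succ, relCell_cells_succ]
  exact h.2 n

lemma Admissible.upTo {k : ℕ → Fin 2 → ℤ} (h : Admissible O k) (s : ℕ) :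
    AdmissibleUpTo O s k :=
  ⟨h.1, fun n _ => h.2.1 n, fun n _ => h.2.2.1 n, fun n _ => h.2.2.2 n⟩

lemma AdmissibleUpTo.isStep {k : ℕ → Fin 2 → ℤ} {s n : ℕ} (h : AdmissibleUpTo O s k)
    (hn : n < s) : IsStep O (relCell (k n) (k (n + 1))) :=
  isStep_relCell.2 ⟨h.2.1 n hn, h.2.2.1 n hn⟩

lemma AdmissibleUpTo.isTurn {k : ℕ → Fin 2 → ℤ} {s n : ℕ} (h : AdmissibleUpTo O s k)
    (hn : n + 1 < s) : IsTurn O (relCell (k n) (k (n + 1))) (relCell (k (n + 1)) (k (n + 2))) :=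
  isTurn_relCell.2 (h.2.2.2 n hn)

lemma one_le_norm_center {a : Fin 2 → ℤ} (ha : a ≠ 0) : 1 ≤ ‖center a‖ := by
  obtain ⟨i, hi⟩ := Function.ne_iff.1 ha
  refine le_trans ?_ (abs_apply_le_norm (center a) i)
  rw [center_apply, ← Int.cast_abs]
  exact_mod_cast Int.one_le_abs hi

/-- If the vectors to the two neighboring centers form no obtuse angle and have length at least `1`,
the point with parameter `t` of the segment joining them has squared norm at least `(1 - t)² + t² ≥
1/2`. Smallness would force a value below `1/2` if the obstacle were between its neighbors. -/
lemma isTurn_of_inner (hs : IsSmall O) {a f : Fin 2 → ℤ} (ha : a ≠ 0) (hf : f ≠ 0)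
    (h : 0 ≤ inner ℝ (center (relCell a 0)) (center f)) : IsTurn O a f := by
  intro hb
  obtain ⟨t, ht, h1⟩ := hb.near fun x hx => hs.norm_lt hx
  set p := center (relCell a 0)
  set q := center f
  have hp : 1 ≤ ‖p‖ := one_le_norm_center fun h0 => ha
    (relCell_injective a (h0.trans (relCell_self a).symm)).symm
  have hq : 1 ≤ ‖q‖ := one_le_norm_center hf
  have h2 : ‖center 0 - (p + t • (q - p))‖ ^ 2 =
      (1 - t) ^ 2 * ‖p‖ ^ 2 + 2 * (t * (1 - t)) * inner ℝ p q + t ^ 2 * ‖q‖ ^ 2 := by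
    simp only [norm_sq_plane, inner_plane, center_zero]; simp; ring
  have h3 := two_mul_sqrt_two_div_four_sq
  have h4 : ‖center 0 - (p + t • (q - p))‖ ^ 2 < 1 / 2 := by
    rw [← h3]; exact pow_lt_pow_left₀ h1 (norm_nonneg _) two_ne_zero
  have h5 : 0 ≤ 2 * (t * (1 - t)) * inner ℝ p q :=
    mul_nonneg (mul_nonneg zero_le_two (mul_nonneg ht.1 (by linarith [ht.2]))) h
  have h6 : (1 - t) ^ 2 * 1 ≤ (1 - t) ^ 2 * ‖p‖ ^ 2 := by
    gcongr; exact one_le_pow₀ hp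
  have h7 : t ^ 2 * 1 ≤ t ^ 2 * ‖q‖ ^ 2 := by
    gcongr; exact one_le_pow₀ hq
  nlinarith [sq_nonneg (2 * t - 1)]

/-- The steps to the right, up, left. -/
def stepRight : Fin 2 → ℤ := ![1, 0]
/-- The step up. -/
def stepUp : Fin 2 → ℤ := ![0, 1]

/-- Crossing a side reflects the frame, so after a unit step the cell just left lies, in the new
frame, in the direction of the step itself. -/
lemma relCell_stepRight : relCell stepRight 0 = stepRight := by
  ext i; fin_cases i <;> simp [relCell, intFlip, stepRight]

lemma relCell_stepUp : relCell stepUp 0 = stepUp := by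
  ext i; fin_cases i <;> simp [relCell, intFlip, stepUp]

lemma relCell_neg_stepRight : relCell (-stepRight) 0 = -stepRight := by
  ext i; fin_cases i <;> simp [relCell, intFlip, stepRight]

/-- The center of a copy in between would be a lattice point at squared distance less than `1/2`
from a unit lattice segment, hence one of its endpoints. -/
lemma isStep_of_mul_eq_zero (hs : IsSmall O) {a : Fin 2 → ℤ} (ha : |a 0| + |a 1| = 1) :
    IsStep O a := by
  refine ⟨fun h => by simp [h] at ha, fun j hb => ?_⟩
  have hj0 := hb.1
  have hja := hb.2.1
  obtain ⟨t, ht, h1⟩ := hb.near fun x hx => hs.norm_lt hx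
  have h4 : ‖center j - (center 0 + t • (center a - center 0))‖ ^ 2 < 1 / 2 := by
    rw [← two_mul_sqrt_two_div_four_sq]
    exact pow_lt_pow_left₀ h1 (norm_nonneg _) two_ne_zero
  rw [norm_sq_plane] at h4
  simp only [center_zero, zero_add, sub_zero, PiLp.sub_apply, PiLp.smul_apply, center_apply,
    smul_eq_mul] at h4
  have key : ∀ m : ℤ, (m : ℝ) ^ 2 < 1 / 2 → m = 0 := fun m hm => by
    have : (m : ℝ) ^ 2 < 1 := by linarith
    have : m ^ 2 < 1 := by exact_mod_cast this
    nlinarith [sq_nonneg m, Int.one_le_abs (z := m), sq_abs m, abs_nonneg m, pow_eq_zero_iff (M₀ := ℤ) (a := m) two_ne_zero]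
  have key2 : ∀ m c : ℤ, |c| = 1 → ((m : ℝ) - t * c) ^ 2 < 1 / 2 → m = 0 ∨ m = c := by
    intro m c hc hm
    rcases eq_or_eq_neg_of_abs_eq hc with rfl | rfl
    · by_contra! hcon
      rcases lt_or_ge m 0 with h | h
      · have : (m : ℝ) ≤ -1 := by exact_mod_cast (by omega : m ≤ -1)
        push_cast at hm
        nlinarith [ht.1]
      · have : (2 : ℝ) ≤ m := by exact_mod_cast (by omega : 2 ≤ m)
        push_cast at hm
        nlinarith [ht.2]
    · by_contra! hcon
      rcases lt_or_ge 0 m with h | h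
      · have : (1 : ℝ) ≤ m := by exact_mod_cast (by omega : 1 ≤ m)
        push_cast at hm
        nlinarith [ht.1]
      · have : (m : ℝ) ≤ -2 := by exact_mod_cast (by omega : m ≤ -2)
        push_cast at hm
        nlinarith [ht.2]
  have hcase : (|a 0| = 1 ∧ a 1 = 0) ∨ (a 0 = 0 ∧ |a 1| = 1) := by
    have := abs_nonneg (a 0); have := abs_nonneg (a 1)
    rcases (by omega : |a 0| = 0 ∨ |a 1| = 0) with h | h
    · right; exact ⟨abs_eq_zero.1 h, by omega⟩
    · left; exact ⟨by omega, abs_eq_zero.1 h⟩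
  rcases hcase with ⟨ha0, ha1⟩ | ⟨ha0, ha1⟩
  · rw [ha1] at h4
    have h5 : j 1 = 0 := key _ (by simp at h4; nlinarith [sq_nonneg ((j 0 : ℝ) - t * a 0)])
    rcases key2 (j 0) (a 0) ha0 (by nlinarith [sq_nonneg ((j 1 : ℝ) - t * (0 : ℤ))]) with h6 | h6
    · exact hj0 (by ext i; fin_cases i <;> simp [h5, h6])
    · exact hja (by ext i; fin_cases i <;> simp [h5, h6, ha1])
  · rw [ha0] at h4
    have h5 : j 0 = 0 := key _ (by simp at h4; nlinarith [sq_nonneg ((j 1 : ℝ) - t * a 1)])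
    rcases key2 (j 1) (a 1) ha1 (by nlinarith [sq_nonneg ((j 0 : ℝ) - t * (0 : ℤ))]) with h6 | h6
    · exact hj0 (by ext i; fin_cases i <;> simp [h5, h6])
    · exact hja (by ext i; fin_cases i <;> simp [h5, h6, ha0])

lemma isStep_stepRight (hs : IsSmall O) : IsStep O stepRight :=
  isStep_of_mul_eq_zero hs (by simp [stepRight])

lemma isStep_neg_stepRight (hs : IsSmall O) : IsStep O (-stepRight) :=
  isStep_of_mul_eq_zero hs (by simp [stepRight])

lemma isStep_stepUp (hs : IsSmall O) : IsStep O stepUp :=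
  isStep_of_mul_eq_zero hs (by simp [stepUp])

/-- A horizontal unit step that can precede the step `f`. -/
def stepBefore (f : Fin 2 → ℤ) : Fin 2 → ℤ := if 0 ≤ f 0 then stepRight else -stepRight

/-- A horizontal unit step that can follow the step `a`. -/
def stepAfter (a : Fin 2 → ℤ) : Fin 2 → ℤ := stepBefore (relCell a 0)

lemma stepBefore_cases (f : Fin 2 → ℤ) : stepBefore f = stepRight ∨ stepBefore f = -stepRight := by
  unfold stepBefore; split_ifs <;> simp

lemma isTurn_stepBefore (hs : IsSmall O) {f : Fin 2 → ℤ} (hf : f ≠ 0) :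
    IsTurn O (stepBefore f) f := by
  unfold stepBefore
  split_ifs with h
  · refine isTurn_of_inner hs (isStep_stepRight hs).1 hf ?_
    rw [relCell_stepRight, inner_plane]; simpa [stepRight] using h
  · refine isTurn_of_inner hs (isStep_neg_stepRight hs).1 hf ?_
    rw [relCell_neg_stepRight, inner_plane]; simpa [stepRight] using (not_le.1 h).le

lemma isTurn_stepAfter (hs : IsSmall O) {a : Fin 2 → ℤ} (ha : a ≠ 0) :
    IsTurn O a (stepAfter a) := by
  unfold stepAfter stepBefore
  split_ifs with h
  · refine isTurn_of_inner hs ha (isStep_stepRight hs).1 ?_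
    rw [inner_plane]; simpa [stepRight] using h
  · refine isTurn_of_inner hs ha (isStep_neg_stepRight hs).1 ?_
    rw [inner_plane]; simpa [stepRight] using (not_le.1 h).le

lemma isStep_stepBefore (hs : IsSmall O) (f : Fin 2 → ℤ) : IsStep O (stepBefore f) := by
  rcases stepBefore_cases f with h | h <;> rw [h]
  exacts [isStep_stepRight hs, isStep_neg_stepRight hs]

/-- Perpendicular unit steps have inner product zero, so `isTurn_of_inner` applies; such turns serve
as joints between arbitrary admissible words. -/
lemma isTurn_stepUp_stepBefore (hs : IsSmall O) (f : Fin 2 → ℤ) :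
    IsTurn O stepUp (stepBefore f) := by
  refine isTurn_of_inner hs (isStep_stepUp hs).1 (isStep_stepBefore hs f).1 ?_
  rw [relCell_stepUp, inner_plane]
  rcases stepBefore_cases f with h | h <;> rw [h] <;> simp [stepRight, stepUp]

lemma isTurn_stepBefore_stepUp (hs : IsSmall O) (f : Fin 2 → ℤ) :
    IsTurn O (stepBefore f) stepUp := by
  refine isTurn_of_inner hs (isStep_stepBefore hs f).1 (isStep_stepUp hs).1 ?_
  rcases stepBefore_cases f with h | h <;> rw [h, inner_plane]
  · rw [relCell_stepRight]; simp [stepRight, stepUp]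
  · rw [relCell_neg_stepRight]; simp [stepRight, stepUp]

end

end SquareBilliard

namespace SquareBilliard

/-! ### Chains of bounces -/

/-- The unit vector in the direction of `v`. -/
noncomputable def dir (v : Plane) : Plane := ‖v‖⁻¹ • v

lemma norm_dir {v : Plane} (hv : v ≠ 0) : ‖dir v‖ = 1 := by
  rw [dir, norm_smul, norm_inv, norm_norm, inv_mul_cancel₀ (norm_ne_zero_iff.2 hv)]

lemma norm_dir_le (v : Plane) : ‖dir v‖ ≤ 1 := by
  rcases eq_or_ne v 0 with rfl | hv
  · simp [dir]
  · exact (norm_dir hv).le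

lemma norm_smul_dir (v : Plane) : ‖v‖ • dir v = v := by
  rcases eq_or_ne v 0 with rfl | hv
  · simp
  · rw [dir, smul_smul, mul_inv_cancel₀ (norm_ne_zero_iff.2 hv), one_smul]

lemma inner_dir_self (v : Plane) : inner ℝ (dir v) v = ‖v‖ := by
  rcases eq_or_ne v 0 with rfl | hv
  · simp
  · rw [dir, real_inner_smul_left, real_inner_self_eq_norm_sq, sq,
      inv_mul_cancel_left₀ (norm_ne_zero_iff.2 hv)]

/-- For `v ≠ 0` the vector `dir v` is the gradient of the norm at `v`, and this is the
supporting-line inequality of a convex homogeneous function. -/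
lemma inner_dir_le (v w : Plane) : inner ℝ (dir v) w ≤ ‖w‖ := by
  refine (real_inner_le_norm _ _).trans ?_
  exact mul_le_of_le_one_left (norm_nonneg _) (norm_dir_le v)

lemma neg_norm_le_inner_dir (v w : Plane) : -‖w‖ ≤ inner ℝ (dir v) w := by
  have := inner_dir_le v (-w)
  rw [inner_neg_right, norm_neg] at this
  linarith

lemma dir_flip (k : Fin 2 → ℤ) (v : Plane) : dir (flip k v) = flip k (dir v) := by
  rw [dir, dir, LinearIsometryEquiv.norm_map, map_smul]

lemma dir_neg (v : Plane) : dir (-v) = -dir v := by simp [dir]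

lemma continuousAt_dir {v : Plane} (hv : v ≠ 0) : ContinuousAt dir v := by
  unfold dir
  exact (continuousAt_id.norm.inv₀ (norm_ne_zero_iff.2 hv)).smul continuousAt_id

/-- The vector from the point `x` of the obstacle to the point `y` of the copy in the cell `a`. -/
noncomputable def hop (a : Fin 2 → ℤ) (x y : Plane) : Plane := (tab a).symm y - x

lemma flip_hop (a : Fin 2 → ℤ) (x y : Plane) : flip a (hop a x y) = y - tab a x := by
  rw [hop, tab_symm_eq, tab_eq]; simp [map_sub, map_add]; abel

/-- A hop traversed backwards is a hop in the frame of the cell where it ended; time reversal rests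
on this. -/
lemma flip_neg_hop (a : Fin 2 → ℤ) (x y : Plane) : -flip a (hop a x y) = hop (relCell a 0) y x := by
  rw [flip_hop, hop, tab_symm_relCell_zero, neg_sub]

lemma add_hop (a : Fin 2 → ℤ) (x y : Plane) : x + hop a x y = (tab a).symm y := by
  simp [hop]

/-- The law of reflection at `y`, for a path that comes from `x` by the step `a` and goes on to `w`
by the step `f`, in variational form. -/
def IsBounce (O : Set Plane) (a : Fin 2 → ℤ) (x y : Plane) (f : Fin 2 → ℤ) (w : Plane) : Prop :=
  ∀ q ∈ O, inner ℝ (dir (hop f y w) - dir (flip a (hop a x y))) (q - y) ≤ 0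

/-- `y 0, …, y s` are the (folded) points at which a billiard path with the steps
`e 0, …, e (s - 1)` meets the obstacle. -/
def IsChain (O : Set Plane) (e : ℕ → Fin 2 → ℤ) (y : ℕ → Plane) (s : ℕ) : Prop :=
  (∀ n ≤ s, y n ∈ O) ∧
    ∀ n, n + 1 < s → IsBounce O (e n) (y n) (y (n + 1)) (e (n + 1)) (y (n + 2))

/-- The length of the path with the steps `e 0, …, e (s - 1)`. -/
noncomputable def pathLength (e : ℕ → Fin 2 → ℤ) (y : ℕ → Plane) (s : ℕ) : ℝ :=
  ∑ n ∈ Finset.range s, ‖hop (e n) (y n) (y (n + 1))‖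

section
variable {O : Set Plane}

/-- The centers are at distance at least `1`, the end points within `√2 / 4` of them, and `1 - √2 /
2 ≥ 1 / 4`. -/
lemma norm_hop_ge (hs : IsSmall O) {a : Fin 2 → ℤ} {x y : Plane} (ha : a ≠ 0) (hx : x ∈ O)
    (hy : y ∈ O) : 1 / 4 ≤ ‖hop a x y‖ := by
  have h1 := one_le_norm_center ha
  have h2 : center a = hop a x y + (x - flip a y) := by
    rw [hop, tab_symm_eq]; abel
  have h3 : ‖x - flip a y‖ ≤ ‖x‖ + ‖y‖ := by
    refine (norm_sub_le _ _).trans ?_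
    rw [LinearIsometryEquiv.norm_map]
  have h4 := norm_add_le (hop a x y) (x - flip a y)
  rw [← h2] at h4
  have h5 := hs.norm_lt hx
  have h6 := hs.norm_lt hy
  have h7 : √2 < 3 / 2 := by rw [Real.sqrt_lt' (by norm_num)]; norm_num
  linarith

lemma norm_hop_le (hs : IsSmall O) {a : Fin 2 → ℤ} {x y : Plane} (hx : x ∈ O)
    (hy : y ∈ O) : ‖hop a x y‖ ≤ ‖center a‖ + 1 := by
  have h2 : hop a x y = center a - (x - flip a y) := by
    rw [hop, tab_symm_eq]; abel
  have h3 : ‖x - flip a y‖ ≤ ‖x‖ + ‖y‖ := by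
    refine (norm_sub_le _ _).trans ?_
    rw [LinearIsometryEquiv.norm_map]
  rw [h2]
  refine (norm_sub_le _ _).trans ?_
  have h5 := hs.norm_lt hx
  have h6 := hs.norm_lt hy
  have := sqrt_two_div_four_lt
  linarith

lemma hop_ne_zero (hs : IsSmall O) {a : Fin 2 → ℤ} {x y : Plane} (ha : a ≠ 0) (hx : x ∈ O)
    (hy : y ∈ O) : hop a x y ≠ 0 := by
  have := norm_hop_ge hs ha hx hy
  intro h; rw [h, norm_zero] at this; linarith

lemma norm_sub_le_one (hs : IsSmall O) {x y : Plane} (hx : x ∈ O) (hy : y ∈ O) : ‖x - y‖ ≤ 1 := by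
  have h5 := hs.norm_lt hx
  have h6 := hs.norm_lt hy
  have := sqrt_two_div_four_lt
  linarith [norm_sub_le x y]

/-- A billiard path is, up to a constant, the shortest path that visits the same obstacles. -/
lemma IsChain.pathLength_le (hs : IsSmall O) {e : ℕ → Fin 2 → ℤ} {y y' : ℕ → Plane} {s : ℕ}
    (h : IsChain O e y s) (h' : ∀ n ≤ s, y' n ∈ O) :
    pathLength e y s ≤ pathLength e y' s + 2 := by
  set A : ℕ → ℝ := fun n => inner ℝ (dir (hop (e n) (y n) (y (n + 1)))) (y' n - y n)
  set B : ℕ → ℝ := fun n => inner ℝ (dir (flip (e n) (hop (e n) (y n) (y (n + 1)))))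
    (y' (n + 1) - y (n + 1))
  -- Convexity of the norm: the tangent at the hop of `y` bounds the hop of `y'` from below, with
  -- one boundary term at each end.
  have step : ∀ n, ‖hop (e n) (y n) (y (n + 1))‖ + (B n - A n)
      ≤ ‖hop (e n) (y' n) (y' (n + 1))‖ := by
    intro n
    have h1 := inner_dir_le (hop (e n) (y n) (y (n + 1))) (hop (e n) (y' n) (y' (n + 1)))
    have h2 : hop (e n) (y' n) (y' (n + 1)) = hop (e n) (y n) (y (n + 1)) +
        (flip (e n) (y' (n + 1) - y (n + 1)) - (y' n - y n)) := by
      rw [hop, hop, tab_symm_eq, tab_symm_eq, map_sub]; abel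
    conv_lhs at h1 => rw [h2]
    rw [inner_add_right, inner_dir_self, inner_sub_right, ← inner_flip_left, ← dir_flip] at h1
    exact h1
  rcases s with - | s
  · simp [pathLength]
  have key : ∀ m ≤ s, pathLength e y (m + 1) + (B m - A 0) ≤ pathLength e y' (m + 1) := by
    intro m
    induction m with
    | zero => intro _; simpa [pathLength] using step 0
    | succ m ih =>
      intro hm
      have h1 := ih (by omega)
      have h2 := step (m + 1)
      -- At an interior vertex the two boundary terms combine to the quantity that `IsBounce` makes
      -- nonpositive. Only the terms at the two ends of the path survive, each bounded by the
      -- diameter of `O`.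
      have h3 : A (m + 1) - B m ≤ 0 := by
        have := h.2 m (by omega) (y' (m + 1)) (h' _ (by omega))
        rwa [inner_sub_left] at this
      simp only [pathLength] at h1 ⊢
      rw [Finset.sum_range_succ, Finset.sum_range_succ _ (m + 1)]
      linarith
  have h1 := key s le_rfl
  have h2 : A 0 ≤ 1 := (inner_dir_le _ _).trans
    (norm_sub_le_one hs (h' 0 (by omega)) (h.1 0 (by omega)))
  have h3 : -1 ≤ B s := le_trans (neg_le_neg (norm_sub_le_one hs (h' _ le_rfl) (h.1 _ le_rfl)))
    (neg_norm_le_inner_dir _ _)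
  linarith

lemma isOuterNormal_mem_frontier {x n : Plane} (hx : x ∈ O) (hn : IsOuterNormal O x n) :
    x ∈ frontier O := by
  refine ⟨subset_closure hx, fun hi => ?_⟩
  have h1 : ∀ᶠ t : ℝ in 𝓝[>] 0, x + t • n ∈ O := by
    have : Tendsto (fun t : ℝ => x + t • n) (𝓝[>] 0) (𝓝 x) := by
      have : Tendsto (fun t : ℝ => x + t • n) (𝓝 0) (𝓝 (x + (0 : ℝ) • n)) :=
        Continuous.tendsto (by fun_prop) 0
      simp only [zero_smul, add_zero] at this
      exact this.mono_left nhdsWithin_le_nhds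
    exact this (mem_interior_iff_mem_nhds.1 hi)
  obtain ⟨t, ht, ht0⟩ := (h1.and self_mem_nhdsWithin).exists
  have h2 := hn.2 _ ht
  rw [add_sub_cancel_left, real_inner_smul_right, real_inner_self_eq_norm_sq, hn.1] at h2
  have : (0 : ℝ) < t := ht0
  linarith

lemma isCompact_convexHull_union {A B : Set Plane} (hA : IsCompact A) (hA' : Convex ℝ A)
    (hA0 : A.Nonempty) (hB : IsCompact B) (hB' : Convex ℝ B) (hB0 : B.Nonempty) :
    IsCompact (convexHull ℝ (A ∪ B)) := by
  have h1 : convexHull ℝ (A ∪ B) =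
      (fun p : Plane × Plane × ℝ => p.1 + p.2.2 • (p.2.1 - p.1)) '' (A ×ˢ B ×ˢ Icc (0 : ℝ) 1) := by
    rw [hA'.convexHull_union hB' hA0 hB0]
    ext x
    simp only [mem_convexJoin, segment_eq_image', mem_image, mem_prod, Prod.exists]
    constructor
    · rintro ⟨a, ha, b, hb, t, ht, rfl⟩
      exact ⟨a, b, t, ⟨ha, hb, ht⟩, rfl⟩
    · rintro ⟨a, b, t, ⟨ha, hb, ht⟩, rfl⟩
      exact ⟨a, ha, b, hb, t, ht, rfl⟩
  rw [h1]
  exact (hA.prod (hB.prod isCompact_Icc)).image (by fun_prop)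

lemma copy_nonempty (hO : IsObstacle O) (k : Fin 2 → ℤ) : (obstacleCopy O k).Nonempty := by
  obtain ⟨o, ho⟩ := hO.nonempty_interior
  exact ⟨_, tab_symm_mem_copy.2 (interior_subset ho)⟩

/-- A linear functional separates the obstacle from the obstacles before and after a turn. -/
lemma IsTurn.exists_separating (hO : IsObstacle O) {a f : Fin 2 → ℤ}
    (ha : a ≠ 0) (hf : f ≠ 0) (h : IsTurn O a f) :
    ∃ ν : Plane, ∀ q ∈ O, ∀ p ∈ obstacleCopy O (relCell a 0) ∪ obstacleCopy O f,
      inner ℝ ν q < inner ℝ ν p := by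
  have hdisj : Disjoint O (convexHull ℝ (obstacleCopy O (relCell a 0) ∪ obstacleCopy O f)) := by
    rw [disjoint_iff_inter_eq_empty, ← not_nonempty_iff_eq_empty]
    intro hne
    refine h ⟨fun h0 => ha ?_, fun h0 => hf h0.symm, by rwa [copy_zero]⟩
    exact (relCell_injective a (h0.symm.trans (relCell_self a).symm)).symm
  obtain ⟨g, u, v, h1, huv, h2⟩ := geometric_hahn_banach_compact_closed hO.convex hO.isCompact
    (convex_convexHull ℝ _)
    (isCompact_convexHull_union (isCompact_copy hO _) (convex_copy hO _) (copy_nonempty hO _)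
      (isCompact_copy hO _) (convex_copy hO _) (copy_nonempty hO _)).isClosed hdisj
  refine ⟨(InnerProductSpace.toDual ℝ Plane).symm g, fun q hq p hp => ?_⟩
  rw [InnerProductSpace.toDual_symm_apply, InnerProductSpace.toDual_symm_apply]
  exact (h1 q hq).trans (huv.trans (h2 p (subset_convexHull ℝ _ hp)))

/-- At a bounce the path really changes its direction. -/
lemma IsBounce.exists_normal (hO : IsObstacle O) (hs : IsSmall O) {a f : Fin 2 → ℤ}
    {x y w : Plane} (ha : a ≠ 0) (hf : f ≠ 0) (ht : IsTurn O a f) (hx : x ∈ O) (hy : y ∈ O)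
    (hw : w ∈ O) (h : IsBounce O a x y f w) :
    ∃ n, IsOuterNormal O y n ∧
      (∃ c : ℝ, 0 < c ∧ c • n = dir (hop f y w) - dir (flip a (hop a x y))) ∧
      dir (hop f y w) = dir (flip a (hop a x y)) -
        (2 * inner ℝ (dir (flip a (hop a x y))) n) • n ∧
      0 < inner ℝ n (dir (hop f y w)) ∧ inner ℝ n (dir (flip a (hop a x y))) < 0 := by
  obtain ⟨ν, hν⟩ := ht.exists_separating hO ha hf
  have hout : hop f y w ≠ 0 := hop_ne_zero hs hf hy hw
  have hin : flip a (hop a x y) ≠ 0 := by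
    simpa using hop_ne_zero hs ha hx hy
  set u := dir (hop f y w) with hu
  set v := dir (flip a (hop a x y)) with hv
  have hu1 : ‖u‖ = 1 := norm_dir hout
  have hv1 : ‖v‖ = 1 := norm_dir hin
  -- The separating functional decreases along the incoming and increases along the outgoing
  -- segment, so the two directions differ.
  have hν1 : 0 < inner ℝ ν u := by
    have := hν y hy _ (Or.inr (tab_symm_mem_copy.2 hw))
    rw [hu, dir, real_inner_smul_right, hop, inner_sub_right]
    exact mul_pos (inv_pos.2 (norm_pos_iff.2 hout)) (by linarith)
  have hν2 : inner ℝ ν v < 0 := by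
    have := hν y hy _ (Or.inl (tab_symm_mem_copy.2 hx))
    rw [tab_symm_relCell_zero] at this
    rw [hv, dir, real_inner_smul_right, flip_hop, inner_sub_right]
    exact mul_neg_of_pos_of_neg (inv_pos.2 (by rw [← flip_hop]; exact norm_pos_iff.2 hin))
      (by linarith)
  have hN : u - v ≠ 0 := fun h0 => by
    rw [sub_eq_zero.1 h0] at hν1; linarith
  have hN1 : 0 < ‖u - v‖ := norm_pos_iff.2 hN
  have hN2 : ‖u - v‖ ^ 2 = 2 - 2 * inner ℝ v u := by
    rw [@norm_sub_sq_real, hu1, hv1, real_inner_comm]; ring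
  have huu : inner ℝ u u = (1 : ℝ) := by rw [real_inner_self_eq_norm_sq, hu1]; norm_num
  have hvv : inner ℝ v v = (1 : ℝ) := by rw [real_inner_self_eq_norm_sq, hv1]; norm_num
  -- For unit vectors `u ≠ v`, the reflection in the line orthogonal to `u - v` carries `v` to `u`.
  -- The variational inequality says exactly that `u - v` is an outer normal.
  refine ⟨dir (u - v), ⟨norm_dir hN, fun q hq => ?_⟩, ⟨‖u - v‖, hN1, norm_smul_dir _⟩, ?_, ?_, ?_⟩
  · rw [dir, real_inner_smul_left]
    exact mul_nonpos_of_nonneg_of_nonpos (by positivity) (h q hq)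
  · rw [dir, real_inner_smul_right, inner_sub_right, hvv, smul_smul]
    have : 2 * (‖u - v‖⁻¹ * (inner ℝ v u - 1)) * ‖u - v‖⁻¹ = -1 := by
      field_simp; rw [hN2]; ring
    rw [this]; simp
  · rw [dir, real_inner_smul_left, inner_sub_left, huu]
    exact mul_pos (inv_pos.2 hN1) (by nlinarith [pow_pos hN1 2])
  · rw [dir, real_inner_smul_left, inner_sub_left, hvv, real_inner_comm]
    exact mul_neg_of_pos_of_neg (inv_pos.2 hN1) (by nlinarith [pow_pos hN1 2])

/-! ### Existence of chains -/

/-- A second-order upper bound for the norm, equivalent to `2 ‖b‖ ‖b + t v‖ ≤ ‖b‖² + ‖b + t v‖²`. -/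
lemma norm_add_le_of_ne_zero {b : Plane} (hb : b ≠ 0) (v : Plane) (t : ℝ) :
    ‖b + t • v‖ ≤ ‖b‖ + t * inner ℝ (dir b) v + t ^ 2 * (‖v‖ ^ 2 / (2 * ‖b‖)) := by
  have hb1 : 0 < ‖b‖ := norm_pos_iff.2 hb
  have h1 : ‖b + t • v‖ ^ 2 = ‖b‖ ^ 2 + 2 * t * inner ℝ b v + t ^ 2 * ‖v‖ ^ 2 := by
    rw [@norm_add_sq_real, real_inner_smul_right, norm_smul, mul_pow, Real.norm_eq_abs, sq_abs]
    ring
  have h2 : inner ℝ (dir b) v = inner ℝ b v / ‖b‖ := by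
    rw [dir, real_inner_smul_left]; ring
  have h3 : ‖b‖ + t * inner ℝ (dir b) v + t ^ 2 * (‖v‖ ^ 2 / (2 * ‖b‖))
      = (‖b‖ ^ 2 + ‖b + t • v‖ ^ 2) / (2 * ‖b‖) := by
    rw [h1, h2]; field_simp; ring
  rw [h3, le_div_iff₀ (by positivity)]
  nlinarith [sq_nonneg (‖b‖ - ‖b + t • v‖)]

/-- The first-order condition at a minimum: divide by `t` and let `t` tend to zero from the right,
so that the quadratic remainders disappear. -/
lemma inner_dir_sub_dir_nonpos {a b v : Plane} (ha : a ≠ 0) (hb : b ≠ 0)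
    (h : ∀ t ∈ Icc (0 : ℝ) 1, ‖a‖ + ‖b‖ ≤ ‖a - t • v‖ + ‖b + t • v‖) :
    inner ℝ (dir a - dir b) v ≤ 0 := by
  rw [inner_sub_left]
  set C := ‖v‖ ^ 2 / (2 * ‖a‖) + ‖v‖ ^ 2 / (2 * ‖b‖)
  have h1 : ∀ t ∈ Ioc (0 : ℝ) 1, inner ℝ (dir a) v - inner ℝ (dir b) v ≤ t * C := by
    intro t ht
    have h2 := h t ⟨ht.1.le, ht.2⟩
    have h3 := norm_add_le_of_ne_zero hb v t
    have h4 := norm_add_le_of_ne_zero ha v (-t)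
    rw [neg_smul, ← sub_eq_add_neg, neg_sq] at h4
    have h5 : t * (inner ℝ (dir a) v - inner ℝ (dir b) v) ≤ t * (t * C) := by
      simp only [C]; linarith
    exact le_of_mul_le_mul_left h5 ht.1
  have h2 : Tendsto (fun t : ℝ => t * C) (𝓝[>] 0) (𝓝 (0 * C)) :=
    (Continuous.tendsto (by fun_prop) 0).mono_left nhdsWithin_le_nhds
  rw [zero_mul] at h2
  refine ge_of_tendsto h2 ?_
  filter_upwards [Ioc_mem_nhdsGT zero_lt_one] with t ht using h1 t ht

lemma continuous_hop (a : Fin 2 → ℤ) : Continuous fun p : Plane × Plane => hop a p.1 p.2 := by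
  unfold hop
  exact ((tab a).symm.continuous.comp continuous_snd).sub continuous_fst

/-- Every periodic word is the word of a periodic chain. -/
lemma exists_periodic_chain (hO : IsObstacle O) (hs : IsSmall O) {e : ℕ → Fin 2 → ℤ}
    (he : ∀ n, e n ≠ 0) {p : ℕ} (hp : 2 ≤ p) (hper : Function.Periodic e p) :
    ∃ y : ℕ → Plane, Function.Periodic y p ∧ ∀ s, IsChain O e y s := by
  have hp0 : 0 < p := by omega
  set L : (ℕ → Plane) → ℝ := fun Y =>
    ∑ n ∈ Finset.range p, ‖hop (e n) (Y n) (Y ((n + 1) % p))‖ with hL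
  have hcont : Continuous L := by
    refine continuous_finsetSum _ fun n _ => Continuous.norm ?_
    exact (continuous_hop (e n)).comp (f := fun Y : ℕ → Plane => (Y n, Y ((n + 1) % p)))
      ((continuous_apply n).prodMk (continuous_apply _))
  have hcomp : IsCompact {Y : ℕ → Plane | ∀ n, Y n ∈ O} := by
    have := isCompact_univ_pi (X := fun _ : ℕ => Plane) (s := fun _ => O) fun _ => hO.isCompact
    convert this using 1
    ext Y; simp
  obtain ⟨o, ho⟩ := hO.nonempty_interior
  -- The shortest closed polygon with its vertices in the prescribed copies. Only the coordinates
  -- below `p` enter the length; the others are arbitrary points of `O`.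
  obtain ⟨Y, hY, hmin⟩ := hcomp.exists_isMinOn ⟨fun _ => o, fun _ => interior_subset ho⟩
    hcont.continuousOn
  refine ⟨fun n => Y (n % p), fun n => by simp, fun s => ⟨fun n _ => hY _, fun n _ q hq => ?_⟩⟩
  set m := (n + 1) % p with hm
  have hmp : m < p := Nat.mod_lt _ hp0
  have hm'p : n % p < p := Nat.mod_lt _ hp0
  have hm1 : (n % p + 1) % p = m := by rw [hm, Nat.mod_add_mod]
  have hm2 : (m + 1) % p = (n + 2) % p := by rw [hm, Nat.mod_add_mod]
  -- Here a period of at least two is used: otherwise a vertex would be its own neighbor and moving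
  -- it would change both ends of one hop.
  have hmm : n % p ≠ m := fun h => by
    have h1 : n ≡ n + 1 [MOD p] := h
    have h2 : 0 ≡ 1 [MOD p] := Nat.ModEq.add_left_cancel' n h1
    rw [Nat.ModEq, Nat.zero_mod, Nat.mod_eq_of_lt (by omega)] at h2
    omega
  have hmm2 : (m + 1) % p ≠ m := fun h => by
    have h1 : m + 0 ≡ m + 1 [MOD p] := by
      rw [Nat.ModEq, h, add_zero, Nat.mod_eq_of_lt hmp]
    have h2 : 0 ≡ 1 [MOD p] := Nat.ModEq.add_left_cancel' m h1
    rw [Nat.ModEq, Nat.zero_mod, Nat.mod_eq_of_lt (by omega)] at h2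
    omega
  have hinj : ∀ i < p, (i + 1) % p = m → i = n % p := fun i hi h => by
    have h1 : i + 1 ≡ n + 1 [MOD p] := h
    have h2 : i ≡ n [MOD p] := Nat.ModEq.add_right_cancel' 1 h1
    rw [Nat.ModEq, Nat.mod_eq_of_lt hi] at h2
    exact h2
  have hem : e m = e (n + 1) := hper.map_mod_nat (n + 1)
  have hen : e (n % p) = e n := hper.map_mod_nat n
  have e1 : n + 1 + 1 = n + 2 := rfl
  change inner ℝ (dir (hop (e (n + 1)) (Y m) (Y ((n + 2) % p))) -
    dir (flip (e n) (hop (e n) (Y (n % p)) (Y m)))) (q - Y m) ≤ 0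
  refine inner_dir_sub_dir_nonpos (hop_ne_zero hs (he _) (hY _) (hY _)) ?_ fun t ht => ?_
  · simpa using hop_ne_zero hs (he n) (hY (n % p)) (hY m)
  -- Move a single vertex towards `q`; by convexity it stays in `O`, and only the two adjacent hops
  -- change their length.
  set z := Y m + t • (q - Y m) with hz
  have hzO : z ∈ O := hO.convex.add_smul_sub_mem (hY m) hq ht
  have h1 : L Y ≤ L (Function.update Y m z) := hmin fun i => by
    rcases eq_or_ne i m with rfl | hi
    · simpa using hzO
    · rw [Function.update_of_ne hi]; exact hY i
  have hsplit : ∀ Y', L Y' = ‖hop (e m) (Y' m) (Y' ((m + 1) % p))‖ +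
      (‖hop (e (n % p)) (Y' (n % p)) (Y' m)‖ +
        ∑ i ∈ ((Finset.range p).erase m).erase (n % p), ‖hop (e i) (Y' i) (Y' ((i + 1) % p))‖) := by
    intro Y'
    have h2 := Finset.add_sum_erase ((Finset.range p).erase m)
      (fun i => ‖hop (e i) (Y' i) (Y' ((i + 1) % p))‖) (a := n % p) (by simp [hmm, hm'p])
    simp only [hm1] at h2
    rw [h2, Finset.add_sum_erase (Finset.range p)
      (fun i => ‖hop (e i) (Y' i) (Y' ((i + 1) % p))‖) (by simpa using hmp)]
  rw [hsplit, hsplit] at h1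
  have hrest : ∑ i ∈ ((Finset.range p).erase m).erase (n % p),
      ‖hop (e i) (Function.update Y m z i) (Function.update Y m z ((i + 1) % p))‖
      = ∑ i ∈ ((Finset.range p).erase m).erase (n % p), ‖hop (e i) (Y i) (Y ((i + 1) % p))‖ := by
    refine Finset.sum_congr rfl fun i hi => ?_
    simp only [Finset.mem_erase, Finset.mem_range] at hi
    rw [Function.update_of_ne hi.2.1, Function.update_of_ne fun h => hi.1 (hinj i hi.2.2 h)]
  rw [hrest, Function.update_self, Function.update_of_ne hmm, Function.update_of_ne hmm2, hem, hen,
    hm2] at h1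
  have h2 : hop (e (n + 1)) z (Y ((n + 2) % p)) =
      hop (e (n + 1)) (Y m) (Y ((n + 2) % p)) - t • (q - Y m) := by
    rw [hop, hop, hz]; abel
  have h3 : ‖hop (e n) (Y (n % p)) z‖ = ‖flip (e n) (hop (e n) (Y (n % p)) (Y m)) + t • (q - Y m)‖ := by
    rw [← (flip (e n)).norm_map, flip_hop, flip_hop, hz]; congr 1; abel
  rw [← h2, ← h3, LinearIsometryEquiv.norm_map]
  linarith

end

end SquareBilliard

namespace SquareBilliard

/-! ### Displacement along segments -/

/-- The plane as the complex plane. -/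
def toC (p : Plane) : ℂ := ⟨p 0, p 1⟩

@[simp] lemma toC_re (p : Plane) : (toC p).re = p 0 := rfl
@[simp] lemma toC_im (p : Plane) : (toC p).im = p 1 := rfl

lemma toC_sub (p q : Plane) : toC (p - q) = toC p - toC q := by
  apply Complex.ext <;> simp

lemma toC_smul (t : ℝ) (p : Plane) : toC (t • p) = t * toC p := by
  apply Complex.ext <;> simp

lemma norm_toC (p : Plane) : ‖toC p‖ = ‖p‖ := by
  rw [← sq_eq_sq₀ (norm_nonneg _) (norm_nonneg _), norm_sq_plane, Complex.sq_norm,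
    Complex.normSq_apply]
  simp; ring

lemma toC_eq_zero {p : Plane} : toC p = 0 ↔ p = 0 := by
  rw [← norm_eq_zero, norm_toC, norm_eq_zero]

@[fun_prop]
lemma continuous_toC : Continuous toC := by
  have : LipschitzWith 1 toC := LipschitzWith.of_dist_le_mul fun x y => by
    rw [dist_eq_norm, dist_eq_norm, ← toC_sub, norm_toC]; simp
  exact this.continuous

lemma conj_toC_mul_toC_re (p q : Plane) :
    ((starRingEnd ℂ) (toC p) * toC q).re = inner ℝ p q := by
  rw [inner_plane]; simp

lemma isAngle_iff {O : Set Plane} {z : Plane} {I : Set ℝ} {γ : ℝ → State O} {φ : ℝ → ℝ} :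
    IsAngle z I γ φ ↔ IsLift (fun t => toC (pos (γ t) - z)) φ I := by
  unfold IsAngle IsLift
  refine and_congr_right fun _ => forall₂_congr fun t _ => ?_
  have h1 : (2 * Real.pi * φ t * Complex.I : ℂ) = ((2 * Real.pi * φ t : ℝ) : ℂ) * Complex.I := by
    push_cast; ring
  rw [h1, norm_toC, Complex.ext_iff]
  have h2 : ∀ c s : ℝ, ∀ p : Plane, ∀ r : ℝ, p = r • !₂[c, s] ↔ p 0 = r * c ∧ p 1 = r * s := by
    intro c s p r
    constructor
    · intro h; rw [h]; simp
    · rintro ⟨h3, h4⟩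
      ext i; fin_cases i <;> simp [h3, h4]
  rw [h2, Complex.re_ofReal_mul, Complex.im_ofReal_mul, Complex.exp_ofReal_mul_I_re,
    Complex.exp_ofReal_mul_I_im]
  rfl

/-- The position, relative to `z`, of the point of the table onto which `x` is folded. -/
noncomputable def foldC (z x : Plane) : ℂ := toC (fold x - z)

@[fun_prop]
lemma continuous_foldC (z : Plane) : Continuous (foldC z) := by
  unfold foldC
  have := continuous_fold
  fun_prop

lemma foldC_eq_zero {z x : Plane} : foldC z x = 0 ↔ fold x = z := by
  rw [foldC, toC_eq_zero, sub_eq_zero]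

open Classical in
/-- The displacement around `z`, in turns, along the folded segment from `x` to `x + v`. -/
noncomputable def disp (z x v : Plane) : ℝ :=
  if h : ∃ θ : ℝ → ℝ, IsLift (fun t : ℝ => foldC z (x + t • v)) θ (Icc 0 1)
  then h.choose 1 - h.choose 0 else 0

/-- The folded segment from `x` to `x + v` does not meet `z`. -/
def Avoids (z x v : Plane) : Prop := ∀ t ∈ Icc (0 : ℝ) 1, fold (x + t • v) ≠ z

lemma IsLift.disp_eq {z x v : Plane} {θ : ℝ → ℝ} (ha : Avoids z x v)
    (h : IsLift (fun t : ℝ => foldC z (x + t • v)) θ (Icc 0 1)) : θ 1 - θ 0 = disp z x v := by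
  have hex : ∃ θ : ℝ → ℝ, IsLift (fun t : ℝ => foldC z (x + t • v)) θ (Icc 0 1) := ⟨θ, h⟩
  rw [disp, dif_pos hex]
  exact h.sub_eq isPreconnected_Icc hex.choose_spec (fun t ht => fun h0 => ha t ht
    (foldC_eq_zero.1 h0)) (by simp) (by simp)

lemma disp_tab (k : Fin 2 → ℤ) (z x v : Plane) : disp z (tab k x) (flip k v) = disp z x v := by
  have : (fun t : ℝ => foldC z (tab k x + t • flip k v)) = fun t : ℝ => foldC z (x + t • v) := by
    ext t
    rw [foldC, foldC, ← tab_add_smul, fold_tab]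
  rw [disp, disp, this]

/-- The angle along a folded path that moves on a segment with unit speed. -/
lemma IsLift.sub_eq_disp {z x v : Plane} {φ : ℝ → ℝ} {a b : ℝ} (hab : a < b) (ha : Avoids z x v)
    {f : ℝ → ℂ} (h : IsLift f φ (Icc a b))
    (hf : ∀ t ∈ Icc a b, f t = foldC z (x + ((t - a) / (b - a)) • v)) :
    φ b - φ a = disp z x v := by
  have h1 : IsLift (fun t : ℝ => f (a + t * (b - a))) (fun t => φ (a + t * (b - a))) (Icc 0 1) := by
    refine h.comp (u := fun t : ℝ => a + t * (b - a)) (by fun_prop) fun t ht => ?_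
    constructor
    · nlinarith [ht.1]
    · nlinarith [ht.2]
  have h2 : IsLift (fun t : ℝ => foldC z (x + t • v)) (fun t => φ (a + t * (b - a))) (Icc 0 1) := by
    refine h1.congr fun t ht => ?_
    rw [hf]
    · congr 3; field_simp [sub_ne_zero.2 hab.ne']; ring
    · constructor
      · nlinarith [ht.1]
      · nlinarith [ht.2]
  have h3 := h2.disp_eq ha
  rw [← h3]; simp

/-- Parametrize the segment by arc length. Folding does not increase distances, so
`IsLift.abs_sub_le` applies to the folded curve. -/
lemma abs_disp_le {z x v : Plane} {ρ : ℝ} (hρ : 0 < ρ)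
    (h : ∀ t ∈ Icc (0 : ℝ) 1, ρ ≤ ‖fold (x + t • v) - z‖) : |disp z x v| ≤ ‖v‖ / ρ + 1 := by
  have ha : Avoids z x v := fun t ht h0 => by
    have := h t ht; rw [h0] at this; simp at this; linarith
  rcases eq_or_ne v 0 with rfl | hv
  · have h0 : IsLift (fun t : ℝ => foldC z (x + t • (0 : Plane)))
        (fun _ => (foldC z x).arg / (2 * Real.pi)) (Icc 0 1) := by
      refine ⟨continuousOn_const, fun t _ => ?_⟩
      simp only [smul_zero, add_zero]
      exact turns_arg _
    have := h0.disp_eq ha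
    rw [← this]; simp
  have hv0 : 0 < ‖v‖ := norm_pos_iff.2 hv
  obtain ⟨θ, hθ⟩ := exists_isLift (convex_Icc (0 : ℝ) ‖v‖)
    (f := fun t : ℝ => foldC z (x + (t / ‖v‖) • v)) (by fun_prop) (fun t ht h0 => by
      refine ha (t / ‖v‖) ⟨div_nonneg ht.1 hv0.le, ?_⟩ (foldC_eq_zero.1 h0)
      rw [div_le_one hv0]; exact ht.2)
  have h1 := hθ.sub_eq_disp (z := z) (x := x) (v := v) hv0 ha fun t _ => by simp
  rw [← h1]
  refine (hθ.abs_sub_le hv0.le (fun t ht => ?_) hρ fun s _ t _ => ?_).trans (by simp)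
  · rw [foldC, norm_toC]
    exact h _ ⟨div_nonneg ht.1 hv0.le, by rw [div_le_one hv0]; exact ht.2⟩
  · rw [foldC, foldC, ← toC_sub, norm_toC, sub_sub_sub_cancel_right]
    refine (norm_fold_sub_le _ _).trans ?_
    rw [add_sub_add_left_eq_sub, ← sub_smul, norm_smul, ← sub_div, Real.norm_eq_abs, abs_div,
      abs_of_pos hv0, div_mul_cancel₀ _ hv0.ne']

/-! ### Winding of paths between two obstacles -/

/-- A function with values in a half-plane has a branch of the argument with oscillation `1/2`. -/
lemma exists_isLift_halfPlane {α : Type*} [TopologicalSpace α] {S : Set α} {f : α → ℂ} {w : ℂ}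
    (hf : ContinuousOn f S) (hw : ∀ x ∈ S, 0 < ((starRingEnd ℂ) w * f x).re) :
    ∃ θ : α → ℝ, IsLift f θ S ∧ ∀ x ∈ S, ∀ y ∈ S, |θ x - θ y| ≤ 1 / 2 := by
  rcases S.eq_empty_or_nonempty with rfl | ⟨a, ha⟩
  · exact ⟨fun _ => 0, ⟨continuousOn_empty _, by simp⟩, by simp⟩
  have hw0 : (starRingEnd ℂ) w ≠ 0 := fun h0 => by
    have := hw a ha
    rw [h0, zero_mul] at this; simp at this
  have h1 : IsLift (fun x => (starRingEnd ℂ) w * f x)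
      (fun x => ((starRingEnd ℂ) w * f x).arg / (2 * Real.pi)) S :=
    isLift_arg.comp (u := fun x => (starRingEnd ℂ) w * f x) (continuousOn_const.mul hf)
      fun x hx => Or.inl (hw x hx)
  have h2 := (h1.const_mul ((starRingEnd ℂ) w)⁻¹).congr (g := f) fun x _ => by field_simp
  refine ⟨_, h2, fun x hx y hy => ?_⟩
  have hx' := Complex.abs_arg_lt_pi_div_two_iff.2 (Or.inl (hw x hx))
  have hy' := Complex.abs_arg_lt_pi_div_two_iff.2 (Or.inl (hw y hy))
  rw [add_sub_add_left_eq_sub, ← sub_div, abs_div, abs_of_pos Real.two_pi_pos,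
    div_le_iff₀ Real.two_pi_pos]
  have := abs_sub ((starRingEnd ℂ) w * f x).arg ((starRingEnd ℂ) w * f y).arg
  linarith

/-- A segment that misses the origin is separated from it by a line, so it lies in a half-plane. -/
lemma exists_isLift_segment {p v : Plane} (h : ∀ t ∈ Icc (0 : ℝ) 1, p + t • v ≠ 0) :
    ∃ θ : ℝ → ℝ, IsLift (fun t : ℝ => toC (p + t • v)) θ (Icc 0 1) ∧ |θ 1 - θ 0| ≤ 1 / 2 := by
  have h0 : (0 : Plane) ∉ segment ℝ p (p + v) := by
    rw [segment_eq_image']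
    rintro ⟨t, ht, h1⟩
    exact h t ht (by simpa using h1)
  have hcl : IsClosed (segment ℝ p (p + v)) := by
    rw [segment_eq_image']
    exact (isCompact_Icc.image (by fun_prop)).isClosed
  obtain ⟨g, u, hu, hg⟩ := geometric_hahn_banach_point_closed (convex_segment p (p + v))
    hcl h0
  rw [map_zero] at hu
  obtain ⟨θ, hθ, hosc⟩ := exists_isLift_halfPlane (S := Icc (0 : ℝ) 1)
    (f := fun t : ℝ => toC (p + t • v)) (w := toC ((InnerProductSpace.toDual ℝ Plane).symm g))
    (by fun_prop) fun t ht => by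
      rw [conj_toC_mul_toC_re, InnerProductSpace.toDual_symm_apply]
      refine hu.trans (hg _ ?_)
      rw [segment_eq_image']
      exact ⟨t, ht, by simp⟩
  exact ⟨θ, hθ, hosc _ (by simp) _ (by simp)⟩

section
variable {O : Set Plane}

/-- A preimage of `z` under folding lies in some copy of `O`, and the hull belonging to a step meets
no copies besides its two ends. -/
lemma fold_eq_of_mem_hull (hs : IsSmall O) {a : Fin 2 → ℤ} (ha : IsStep O a)
    {z x : Plane} (hz : z ∈ O) (hx : x ∈ convexHull ℝ (O ∪ obstacleCopy O a)) (h : fold x = z) :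
    x = z ∨ x = (tab a).symm z := by
  obtain ⟨k, hk⟩ := (fold_mem_iff hs).1 (h ▸ hz : fold x ∈ O)
  have h1 : tab k x = z := by rw [← fold_of_mem_copy hs hk, h]
  by_cases h0 : k = 0
  · left; rw [h0, tab_zero] at h1; exact h1
  by_cases hka : k = a
  · right; rw [← h1, hka]; simp
  · exact absurd ⟨h0, hka, x, hk, by rwa [copy_zero]⟩ (ha.2 k)

open Classical in
/-- On the convex hull of two consecutive obstacles, the folded position divided by the positions
relative to the copies of `z` in these obstacles. -/
noncomputable def quot (z : Plane) (a : Fin 2 → ℤ) (x : Plane) : ℂ :=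
  if x = z then (toC (tab a x - z))⁻¹
  else if x = (tab a).symm z then (toC (x - z))⁻¹
  else foldC z x * ((toC (x - z))⁻¹ * (toC (tab a x - z))⁻¹)

lemma toC_tab_sub_ne_zero {a : Fin 2 → ℤ} {z x : Plane} (h : x ≠ (tab a).symm z) :
    toC (tab a x - z) ≠ 0 := by
  rw [Ne, toC_eq_zero, sub_eq_zero]
  intro h1; exact h (by rw [← h1]; simp)

lemma toC_sub_ne_zero {z x : Plane} (h : x ≠ z) : toC (x - z) ≠ 0 := by
  rwa [Ne, toC_eq_zero, sub_eq_zero]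

lemma tab_symm_ne (hs : IsSmall O) {a : Fin 2 → ℤ} (ha : a ≠ 0) {x y : Plane} (hx : x ∈ O)
    (hy : y ∈ O) : (tab a).symm y ≠ x := fun h =>
  ha (copy_unique hs (tab_symm_mem_copy.2 hy) (by rw [h, copy_zero]; exact hx))

lemma quot_of_mem (hs : IsSmall O) {a : Fin 2 → ℤ} (ha : a ≠ 0) {z x : Plane} (hz : z ∈ O)
    (hx : x ∈ O) : quot z a x = (toC (tab a x - z))⁻¹ := by
  unfold quot
  split_ifs with h1 h2
  · rfl
  · exact absurd h2.symm (tab_symm_ne hs ha hx hz)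
  · have h3 : fold x = x := by
      rw [fold_of_mem_copy hs (k := 0) (by rwa [copy_zero]), tab_zero]
    rw [foldC, h3, mul_inv_cancel_left₀ (toC_sub_ne_zero h1)]

lemma quot_of_mem_copy (hs : IsSmall O) {a : Fin 2 → ℤ} (ha : a ≠ 0) {z x : Plane} (hz : z ∈ O)
    (hx : x ∈ obstacleCopy O a) : quot z a x = (toC (x - z))⁻¹ := by
  unfold quot
  split_ifs with h1 h2
  · exact absurd (copy_unique hs hx (by rw [h1, copy_zero]; exact hz)) ha
  · rfl
  · rw [foldC, fold_of_mem_copy hs hx, mul_comm (toC (x - z))⁻¹,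
      mul_inv_cancel_left₀ (toC_tab_sub_ne_zero h2)]

lemma quot_ne_zero (hs : IsSmall O) {a : Fin 2 → ℤ} (ha : IsStep O a) {z x : Plane} (hz : z ∈ O)
    (hx : x ∈ convexHull ℝ (O ∪ obstacleCopy O a)) : quot z a x ≠ 0 := by
  unfold quot
  split_ifs with h1 h2
  · rw [h1]; exact inv_ne_zero (toC_tab_sub_ne_zero (tab_symm_ne hs ha.1 hz hz).symm)
  · exact inv_ne_zero (toC_sub_ne_zero h1)
  · refine mul_ne_zero (fun h0 => ?_) (mul_ne_zero (inv_ne_zero (toC_sub_ne_zero h1))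
      (inv_ne_zero (toC_tab_sub_ne_zero h2)))
    rcases fold_eq_of_mem_hull hs ha hz hx (foldC_eq_zero.1 h0) with h | h
    exacts [h1 h, h2 h]

lemma fold_eventuallyEq_tab (hs : IsSmall O) {k : Fin 2 → ℤ} {x : Plane}
    (hx : x ∈ obstacleCopy O k) : ∀ᶠ y in 𝓝 x, fold y = tab k y := by
  filter_upwards [eventually_abs_sub_lt (abs_sub_lt_of_mem_copy hs hx)] with y hy
  exact fold_eq_tab fun i => (hy i).le

/-- Near each of the two copies of `z` folding is the isometry of the cell, so the folded position
coincides there with one of the two factors in the denominator and the singularity is removable. -/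
lemma continuousAt_quot (hs : IsSmall O) {a : Fin 2 → ℤ} (ha : a ≠ 0) {z : Plane} (hz : z ∈ O)
    (x : Plane) : ContinuousAt (quot z a) x := by
  have hz' := tab_symm_ne hs ha hz hz
  have ca : Continuous (tab a) := (tab a).continuous
  by_cases h1 : x = z
  · have h2 : ∀ᶠ y in 𝓝 x, (toC (tab a y - z))⁻¹ = quot z a y := by
      rw [h1]
      filter_upwards [fold_eventuallyEq_tab hs (k := 0) (x := z) (by rwa [copy_zero]),
        isOpen_ne.mem_nhds hz'.symm] with y hy hy'
      unfold quot
      split_ifs with h3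
      · rfl
      · rw [foldC, hy, tab_zero, mul_inv_cancel_left₀ (toC_sub_ne_zero h3)]
    refine ContinuousAt.congr (ContinuousAt.inv₀ (by fun_prop) ?_) h2
    rw [h1]; exact toC_tab_sub_ne_zero hz'.symm
  by_cases h2 : x = (tab a).symm z
  · have h2 : ∀ᶠ y in 𝓝 x, (toC (y - z))⁻¹ = quot z a y := by
      rw [h2]
      filter_upwards [fold_eventuallyEq_tab hs (tab_symm_mem_copy (k := a).2 hz),
        isOpen_ne.mem_nhds hz'] with y hy hy'
      rw [quot, if_neg hy']
      split_ifs with h3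
      · rfl
      · rw [foldC, hy, mul_comm (toC (y - z))⁻¹, mul_inv_cancel_left₀ (toC_tab_sub_ne_zero h3)]
    exact ContinuousAt.congr (ContinuousAt.inv₀ (by fun_prop) (toC_sub_ne_zero h1)) h2
  · have h3 : ∀ᶠ y in 𝓝 x, foldC z y * ((toC (y - z))⁻¹ * (toC (tab a y - z))⁻¹) = quot z a y := by
      filter_upwards [isOpen_ne.mem_nhds h1, isOpen_ne.mem_nhds h2] with y hy hy'
      rw [quot, if_neg hy, if_neg hy']
    refine ContinuousAt.congr (ContinuousAt.mul (by fun_prop) (ContinuousAt.mul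
      (ContinuousAt.inv₀ (by fun_prop) (toC_sub_ne_zero h1))
      (ContinuousAt.inv₀ (by fun_prop) (toC_tab_sub_ne_zero h2)))) h3

lemma quot_mul (z : Plane) (a : Fin 2 → ℤ) {x : Plane} (h : x ≠ z) (h' : x ≠ (tab a).symm z) :
    quot z a x * toC (x - z) * toC (tab a x - z) = foldC z x := by
  rw [quot, if_neg h, if_neg h']
  have h1 := toC_sub_ne_zero h
  have h2 := toC_tab_sub_ne_zero h'
  field_simp

lemma IsLift.add_eq_const {α : Type*} [TopologicalSpace α] {S : Set α} {f g : α → ℂ}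
    {θ η : α → ℝ} {c : ℂ} (hS : IsPreconnected S) (hθ : IsLift f θ S) (hη : IsLift g η S)
    (hc : c ≠ 0) (hfg : ∀ x ∈ S, f x * g x = c) {x y : α} (hx : x ∈ S) (hy : y ∈ S) :
    θ x + η x = θ y + η y := by
  have h1 : IsLift (fun _ => c) (fun x => θ x + η x) S := (hθ.mul hη).congr fun x hx =>
    (hfg x hx).symm
  have h2 : IsLift (fun _ : α => c) (fun _ => c.arg / (2 * Real.pi)) S :=
    ⟨continuousOn_const, fun _ _ => turns_arg c⟩
  have := h1.sub_eq hS h2 (fun _ _ => hc) hy hx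
  simp only [sub_self] at this
  linarith

lemma hop_mem_hull {a : Fin 2 → ℤ} {x y : Plane} (hx : x ∈ O) (hy : y ∈ O) {t : ℝ}
    (ht : t ∈ Icc (0 : ℝ) 1) : x + t • hop a x y ∈ convexHull ℝ (O ∪ obstacleCopy O a) :=
  (convex_convexHull ℝ (O ∪ obstacleCopy O a)).add_smul_sub_mem
    (subset_convexHull ℝ (O ∪ obstacleCopy O a) (Or.inl hx))
    (subset_convexHull ℝ (O ∪ obstacleCopy O a) (Or.inr (tab_symm_mem_copy.2 hy))) ht

lemma Avoids.ne (hs : IsSmall O) {a : Fin 2 → ℤ} {z x y : Plane} (hz : z ∈ O)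
    (h : Avoids z x (hop a x y)) {t : ℝ} (ht : t ∈ Icc (0 : ℝ) 1) :
    x + t • hop a x y ≠ z ∧ x + t • hop a x y ≠ (tab a).symm z := by
  have h1 := h t ht
  constructor
  · intro h2; rw [h2, fold_of_mem_copy hs (k := 0) (by rwa [copy_zero]), tab_zero] at h1
    exact h1 rfl
  · intro h2; rw [h2, fold_of_mem_copy hs (tab_symm_mem_copy.2 hz)] at h1
    simp at h1

/-- Each copy extends less than `√2 / 4` from its center, and `√2 / 2 < 1 ≤ ‖center a‖`. -/
lemma inner_center_lt (hs : IsSmall O) {a : Fin 2 → ℤ} (ha : a ≠ 0) {q p : Plane} (hq : q ∈ O)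
    (hp : p ∈ obstacleCopy O a) : inner ℝ (center a) q < inner ℝ (center a) p := by
  have h1 := one_le_norm_center ha
  have h2 : p = center a + (p - center a) := by abel
  have h3 : ‖p - center a‖ < √2 / 4 := by
    rw [norm_sub_center]; exact hs.norm_lt (mem_copy.1 hp)
  have h4 := abs_le.1 (abs_real_inner_le_norm (center a) (p - center a))
  have h5 := abs_le.1 (abs_real_inner_le_norm (center a) q)
  have h6 := hs.norm_lt hq
  have h7 : √2 < 3 / 2 := by rw [Real.sqrt_lt' (by norm_num)]; norm_num
  rw [h2, inner_add_right, real_inner_self_eq_norm_sq]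
  nlinarith

/-- Up to a bounded error, the displacement between two obstacles depends on the obstacles only. -/
lemma exists_disp_near (hO : IsObstacle O) (hs : IsSmall O) {a : Fin 2 → ℤ} (ha : IsStep O a)
    {z : Plane} (hz : z ∈ O) :
    ∃ N : ℝ, ∀ x ∈ O, ∀ y ∈ O, Avoids z x (hop a x y) → |disp z x (hop a x y) - N| ≤ 2 := by
  have ca : Continuous (tab a) := (tab a).continuous
  -- A branch of the argument of the zero-free quotient on the entire hull. Along any hop, the
  -- displacement is the change of `g` plus the turning of a straight segment around `z` and around
  -- its copy.
  obtain ⟨g, hg⟩ := exists_isLift (convex_convexHull ℝ (O ∪ obstacleCopy O a)) (f := quot z a)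
    (fun x _ => (continuousAt_quot hs ha.1 hz x).continuousWithinAt)
    (fun x hx => quot_ne_zero hs ha hz hx)
  obtain ⟨η, hη, hηo⟩ := exists_isLift_halfPlane (S := O) (f := fun x => toC (tab a x - z))
    (w := toC (-flip a (center a))) (by fun_prop) fun x hx => by
      rw [conj_toC_mul_toC_re, inner_neg_left, inner_flip_left]
      have h1 := inner_center_lt hs ha.1 hx (tab_symm_mem_copy (k := a).2 hz)
      have h2 : flip a (tab a x - z) = x - (tab a).symm z := by
        rw [tab_symm_eq, map_sub, tab_eq, flip_flip]; abel
      rw [h2, inner_sub_right]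
      linarith
  obtain ⟨ζ, hζ, hζo⟩ := exists_isLift_halfPlane (S := obstacleCopy O a) (f := fun x => toC (x - z))
    (w := toC (center a)) (by fun_prop) fun x hx => by
      rw [conj_toC_mul_toC_re, inner_sub_right]
      have h1 := inner_center_lt hs ha.1 hz hx
      linarith
  refine ⟨g ((tab a).symm z) - g z, fun x hx y hy hav => ?_⟩
  set v := hop a x y with hv
  have hsub1 : O ⊆ convexHull ℝ (O ∪ obstacleCopy O a) :=
    subset_union_left.trans (subset_convexHull ℝ _)
  have hsub2 : obstacleCopy O a ⊆ convexHull ℝ (O ∪ obstacleCopy O a) :=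
    subset_union_right.trans (subset_convexHull ℝ _)
  have hy' := tab_symm_mem_copy (k := a).2 hy
  have hz' := tab_symm_mem_copy (k := a).2 hz
  -- On `O` the quotient is the inverse of the position relative to the far copy of `z`, so the two
  -- angles cancel and `g x` can be replaced by `g z` up to the oscillation of `η`. The same works
  -- at the other end.
  have e1 : g x + η x = g z + η z := by
    refine (hg.mono hsub1).add_eq_const hO.convex.isPreconnected hη one_ne_zero (fun q hq => ?_) hx hz
    rw [quot_of_mem hs ha.1 hz hq, inv_mul_cancel₀]
    exact toC_tab_sub_ne_zero (tab_symm_ne hs ha.1 hq hz).symm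
  have e2 : g ((tab a).symm y) + ζ ((tab a).symm y) = g ((tab a).symm z) + ζ ((tab a).symm z) := by
    refine (hg.mono hsub2).add_eq_const (convex_copy hO a).isPreconnected hζ one_ne_zero
      (fun q hq => ?_) hy' hz'
    rw [quot_of_mem_copy hs ha.1 hz hq, inv_mul_cancel₀]
    refine toC_sub_ne_zero fun h => ha.1 (copy_unique hs hq ?_)
    rw [h, copy_zero]; exact hz
  obtain ⟨θ₁, hθ₁, ho₁⟩ := exists_isLift_segment (p := x - z) (v := v) fun t ht h0 =>
    (hav.ne hs hz ht).1 (by rw [← sub_eq_zero, ← h0]; abel)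
  obtain ⟨θ₂, hθ₂, ho₂⟩ := exists_isLift_segment (p := tab a x - z) (v := flip a v) fun t ht h0 =>
    (hav.ne hs hz ht).2 (by
      rw [eq_comm, AffineIsometryEquiv.symm_apply_eq, tab_add_smul, eq_comm, ← sub_eq_zero, ← h0]
      abel)
  have hgσ : IsLift (fun t : ℝ => quot z a (x + t • v)) (fun t => g (x + t • v)) (Icc 0 1) :=
    hg.comp (u := fun t : ℝ => x + t • v) (by fun_prop) fun t ht => hop_mem_hull hx hy ht
  have h1 : IsLift (fun t : ℝ => foldC z (x + t • v))
      (fun t => g (x + t • v) + θ₁ t + θ₂ t) (Icc 0 1) := by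
    refine ((hgσ.mul hθ₁).mul hθ₂).congr fun t ht => ?_
    have h2 := hav.ne hs hz ht
    rw [← quot_mul z a h2.1 h2.2, tab_add_smul, add_sub_right_comm, add_sub_right_comm]
  have h2 := h1.disp_eq hav
  have e3 : x + (1 : ℝ) • v = (tab a).symm y := by rw [one_smul, hv, add_hop]
  simp only [e3, zero_smul, add_zero] at h2
  rw [← h2]
  -- Four errors of half a turn each: two from replacing the end points and two from the turning of
  -- the segment.
  have o1 := abs_le.1 (hηo x hx z hz)
  have o2 := abs_le.1 (hζo _ hy' _ hz')
  have o3 := abs_le.1 ho₁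
  have o4 := abs_le.1 ho₂
  rw [abs_le]; constructor <;> linarith

/-- `p` is not on the ray from the origin in the direction `-ν`. -/
def OffSlit (ν p : Plane) : Prop := toC p / toC ν ∈ Complex.slitPlane

/-- The branch of the argument (in turns) on the plane without the ray in the direction `-ν`. -/
noncomputable def slitArg (ν p : Plane) : ℝ := (toC p / toC ν).arg / (2 * Real.pi)

lemma abs_slitArg_le (ν p : Plane) : |slitArg ν p| ≤ 1 / 2 := by
  rw [slitArg, abs_div, abs_of_pos Real.two_pi_pos, div_le_iff₀ Real.two_pi_pos]
  linarith [Complex.abs_arg_le_pi (toC p / toC ν)]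

lemma offSlit_of_forall {ν p : Plane} (hν : ν ≠ 0) (h : ∀ s : ℝ, 0 ≤ s → p ≠ -(s • ν)) :
    OffSlit ν p := by
  unfold OffSlit
  by_contra hc
  rw [Complex.mem_slitPlane_iff_not_le_zero, not_not] at hc
  obtain ⟨h1, h2⟩ := Complex.le_def.1 hc
  have hν' : toC ν ≠ 0 := by rwa [Ne, toC_eq_zero]
  refine h (-(toC p / toC ν).re) (by simpa using h1) ?_
  have h3 : toC p / toC ν = ((toC p / toC ν).re : ℂ) := by
    apply Complex.ext
    · simp
    · simpa using h2
  rw [div_eq_iff hν', ← toC_smul] at h3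
  have h4 : toC (p - (toC p / toC ν).re • ν) = 0 := by rw [toC_sub, ← h3, sub_self]
  rw [toC_eq_zero, sub_eq_zero] at h4
  rw [neg_smul, neg_neg]; exact h4

lemma isLift_slitArg {α : Type*} [TopologicalSpace α] {S : Set α} {f : α → Plane} {ν : Plane}
    (hf : ContinuousOn f S) (h : ∀ x ∈ S, OffSlit ν (f x)) :
    IsLift (fun x => toC (f x) / toC ν) (fun x => slitArg ν (f x)) S :=
  isLift_arg.comp (u := fun x => toC (f x) / toC ν)
    ((continuous_toC.comp_continuousOn hf).div_const _) h

/-- For paths that avoid slits at two obstacles, the displacement is the change of the angles that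
are defined by the slits, up to a constant. -/
lemma exists_disp_eq (hO : IsObstacle O) (hs : IsSmall O) {a : Fin 2 → ℤ} (ha : IsStep O a)
    {z : Plane} (hz : z ∈ O) {ν μ : Plane} (hν : ν ≠ 0) (hμ : μ ≠ 0)
    (hνa : ∀ p ∈ obstacleCopy O a, OffSlit ν (p - z))
    (hμa : ∀ q ∈ O, OffSlit μ (tab a q - z)) :
    ∃ N : ℝ, ∀ x ∈ O, ∀ y ∈ O, Avoids z x (hop a x y) →
      (∀ t ∈ Icc (0 : ℝ) 1, OffSlit ν (x + t • hop a x y - z)) →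
      (∀ t ∈ Icc (0 : ℝ) 1, OffSlit μ (tab a (x + t • hop a x y) - z)) →
      disp z x (hop a x y) = slitArg μ (y - z) - slitArg ν (x - z) + N := by
  have ca : Continuous (tab a) := (tab a).continuous
  have hν0 : toC ν ≠ 0 := by rwa [Ne, toC_eq_zero]
  have hμ0 : toC μ ≠ 0 := by rwa [Ne, toC_eq_zero]
  obtain ⟨g, hg⟩ := exists_isLift (convex_convexHull ℝ (O ∪ obstacleCopy O a)) (f := quot z a)
    (fun x _ => (continuousAt_quot hs ha.1 hz x).continuousWithinAt)
    (fun x hx => quot_ne_zero hs ha hz hx)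
  have hη := isLift_slitArg (S := O) (f := fun x => tab a x - z) (ν := μ) (by fun_prop) hμa
  have hζ := isLift_slitArg (S := obstacleCopy O a) (f := fun x => x - z) (ν := ν) (by fun_prop) hνa
  have hsub1 : O ⊆ convexHull ℝ (O ∪ obstacleCopy O a) :=
    subset_union_left.trans (subset_convexHull ℝ _)
  have hsub2 : obstacleCopy O a ⊆ convexHull ℝ (O ∪ obstacleCopy O a) :=
    subset_union_right.trans (subset_convexHull ℝ _)
  have hz' := tab_symm_mem_copy (k := a).2 hz
  refine ⟨(g ((tab a).symm z) + slitArg ν ((tab a).symm z - z)) - (g z + slitArg μ (tab a z - z)),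
    fun x hx y hy hav h1 h2 => ?_⟩
  have hy' := tab_symm_mem_copy (k := a).2 hy
  have e1 : g x + slitArg μ (tab a x - z) = g z + slitArg μ (tab a z - z) := by
    refine (hg.mono hsub1).add_eq_const hO.convex.isPreconnected hη (inv_ne_zero hμ0)
      (fun q hq => ?_) hx hz
    have := toC_tab_sub_ne_zero (tab_symm_ne hs ha.1 hq hz).symm
    rw [quot_of_mem hs ha.1 hz hq]; field_simp
  have e2 : g ((tab a).symm y) + slitArg ν ((tab a).symm y - z) =
      g ((tab a).symm z) + slitArg ν ((tab a).symm z - z) := by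
    refine (hg.mono hsub2).add_eq_const (convex_copy hO a).isPreconnected hζ (inv_ne_zero hν0)
      (fun q hq => ?_) hy' hz'
    have : toC (q - z) ≠ 0 := by
      refine toC_sub_ne_zero fun h => ha.1 (copy_unique hs hq ?_)
      rw [h, copy_zero]; exact hz
    rw [quot_of_mem_copy hs ha.1 hz hq]; field_simp
  set v := hop a x y with hv
  have hgσ : IsLift (fun t : ℝ => quot z a (x + t • v)) (fun t => g (x + t • v)) (Icc 0 1) :=
    hg.comp (u := fun t : ℝ => x + t • v) (by fun_prop) fun t ht => hop_mem_hull hx hy ht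
  have hθ₁ := isLift_slitArg (f := fun t : ℝ => x + t • v - z) (by fun_prop) h1
  have hθ₂ := isLift_slitArg (f := fun t : ℝ => tab a (x + t • v) - z) (by fun_prop) h2
  have h3 := (((hgσ.mul hθ₁).mul hθ₂).const_mul (toC ν * toC μ)).congr
    (g := fun t : ℝ => foldC z (x + t • v)) fun t ht => by
      have h2 := hav.ne hs hz ht
      rw [← hv] at h2
      rw [← quot_mul z a h2.1 h2.2]
      field_simp
  have h4 := h3.disp_eq hav
  have e3 : x + (1 : ℝ) • v = (tab a).symm y := by rw [one_smul, hv, add_hop]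
  simp only [e3, zero_smul, add_zero, AffineIsometryEquiv.apply_symm_apply] at h4
  linarith

end

end SquareBilliard

/-! ### Comparison of billiard paths with the same word -/

namespace SquareBilliard

section
variable {O : Set Plane}

lemma IsOuterNormal.inner_sub_pos {x n z : Plane} (hn : IsOuterNormal O x n)
    (hz : z ∈ interior O) : 0 < inner ℝ n (x - z) := by
  have h1 : ∀ᶠ t : ℝ in 𝓝[>] 0, z + t • n ∈ O := by
    have : Tendsto (fun t : ℝ => z + t • n) (𝓝 0) (𝓝 (z + (0 : ℝ) • n)) :=
      Continuous.tendsto (by fun_prop) 0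
    simp only [zero_smul, add_zero] at this
    exact (this.mono_left nhdsWithin_le_nhds) (mem_interior_iff_mem_nhds.1 hz)
  obtain ⟨t, ht, ht0⟩ := (h1.and self_mem_nhdsWithin).exists
  have h2 := hn.2 _ ht
  have h3 : z + t • n - x = t • n - (x - z) := by abel
  rw [h3, inner_sub_right, real_inner_smul_right, real_inner_self_eq_norm_sq, hn.1] at h2
  have : (0 : ℝ) < t := ht0
  linarith

/-- The vector `v` at `x` does not point into the obstacle. -/
def IsOutgoing (O : Set Plane) (x v : Plane) : Prop :=
  ∃ n, IsOuterNormal O x n ∧ 0 < inner ℝ n v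

/-- A single vector `ν` controls both segments at the bounce. The normal is a positive multiple of
outgoing minus incoming direction; `ν` is positive on the former and negative on the latter. So the
normal forms an acute angle with `ν` and with both segments as they leave the obstacle. -/
lemma IsBounce.exists_slit (hO : IsObstacle O) (hs : IsSmall O) {a f : Fin 2 → ℤ}
    {x y w : Plane} (ha : a ≠ 0) (hf : f ≠ 0) (ht : IsTurn O a f) (hx : x ∈ O) (hy : y ∈ O)
    (hw : w ∈ O) (h : IsBounce O a x y f w) {ν : Plane}
    (hν : ∀ q ∈ O, ∀ p ∈ obstacleCopy O (relCell a 0) ∪ obstacleCopy O f,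
      inner ℝ ν q < inner ℝ ν p) :
    ∃ n, IsOuterNormal O y n ∧ 0 < inner ℝ ν n ∧ 0 < inner ℝ n (hop f y w) ∧
      0 < inner ℝ n (-flip a (hop a x y)) := by
  obtain ⟨n, hn, ⟨c, hc, hcn⟩, -, h1, h2⟩ := h.exists_normal hO hs ha hf ht hx hy hw
  have hout : hop f y w ≠ 0 := hop_ne_zero hs hf hy hw
  have hin : flip a (hop a x y) ≠ 0 := by
    simpa using hop_ne_zero hs ha hx hy
  refine ⟨n, hn, ?_, ?_, ?_⟩
  · have hν1 : 0 < inner ℝ ν (dir (hop f y w)) := by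
      have := hν y hy _ (Or.inr (tab_symm_mem_copy.2 hw))
      rw [dir, real_inner_smul_right, hop, inner_sub_right]
      exact mul_pos (inv_pos.2 (norm_pos_iff.2 hout)) (by linarith)
    have hν2 : inner ℝ ν (dir (flip a (hop a x y))) < 0 := by
      have := hν y hy _ (Or.inl (tab_symm_mem_copy.2 hx))
      rw [tab_symm_relCell_zero] at this
      rw [dir, real_inner_smul_right, flip_hop, inner_sub_right]
      exact mul_neg_of_pos_of_neg (inv_pos.2 (by rw [← flip_hop]; exact norm_pos_iff.2 hin))
        (by linarith)
    have h3 : 0 < c * inner ℝ ν n := by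
      rw [← real_inner_smul_right, hcn, inner_sub_right]; linarith
    exact pos_of_mul_pos_right h3 hc.le
  · rw [← norm_smul_dir (hop f y w), real_inner_smul_right]
    exact mul_pos (norm_pos_iff.2 hout) h1
  · rw [← norm_smul_dir (flip a (hop a x y)), inner_neg_right, real_inner_smul_right]
    have := mul_neg_of_pos_of_neg (norm_pos_iff.2 hin) h2
    linarith

lemma tab_add_smul_hop (a : Fin 2 → ℤ) (x y : Plane) (t : ℝ) :
    tab a (x + t • hop a x y) = y + (1 - t) • (-flip a (hop a x y)) := by
  rw [tab_add_smul, flip_hop, smul_neg, sub_smul, one_smul]; abel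

/-- A segment between two obstacles that leaves the first one and comes to the second one from
outside does not meet the obstacles in between. -/
lemma fold_notMem (hs : IsSmall O) {a : Fin 2 → ℤ} (ha : IsStep O a) {x y : Plane}
    (hx : x ∈ O) (hy : y ∈ O) (h1 : IsOutgoing O x (hop a x y))
    (h2 : IsOutgoing O y (-flip a (hop a x y))) {t : ℝ} (ht : t ∈ Ioo (0 : ℝ) 1) :
    fold (x + t • hop a x y) ∉ O := by
  intro hm
  obtain ⟨k, hk⟩ := (fold_mem_iff hs).1 hm
  by_cases h0 : k = 0
  · rw [h0, copy_zero] at hk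
    obtain ⟨n, hn, hp⟩ := h1
    have := hn.2 _ hk
    rw [add_sub_cancel_left, real_inner_smul_right] at this
    nlinarith [ht.1]
  by_cases hka : k = a
  · rw [hka, mem_copy, tab_add_smul_hop] at hk
    obtain ⟨n, hn, hp⟩ := h2
    have := hn.2 _ hk
    rw [add_sub_cancel_left, real_inner_smul_right] at this
    nlinarith [ht.2]
  · refine ha.2 k ⟨h0, hka, _, hk, ?_⟩
    rw [copy_zero]
    exact hop_mem_hull hx hy ⟨ht.1.le, ht.2.le⟩

lemma IsOutgoing.mem_frontier {x v : Plane} (hx : x ∈ O) (h : IsOutgoing O x v) :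
    x ∈ frontier O := by
  obtain ⟨n, hn, -⟩ := h
  exact isOuterNormal_mem_frontier hx hn

lemma fold_notMem_interior (hs : IsSmall O) {a : Fin 2 → ℤ} (ha : IsStep O a) {x y : Plane}
    (hx : x ∈ O) (hy : y ∈ O) (h1 : IsOutgoing O x (hop a x y))
    (h2 : IsOutgoing O y (-flip a (hop a x y))) {t : ℝ} (ht : t ∈ Icc (0 : ℝ) 1) :
    fold (x + t • hop a x y) ∉ interior O := by
  rcases eq_endpoints_or_mem_Ioo_of_mem_Icc ht with rfl | rfl | ht'
  · rw [zero_smul, add_zero, fold_of_mem_copy hs (k := 0) (by rwa [copy_zero]), tab_zero]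
    exact (h1.mem_frontier hx).2
  · rw [one_smul, add_hop, fold_of_mem_copy hs (tab_symm_mem_copy.2 hy),
      AffineIsometryEquiv.apply_symm_apply]
    exact (h2.mem_frontier hy).2
  · exact fun h => fold_notMem hs ha hx hy h1 h2 ht' (interior_subset h)

/-- The inner product with the normal `n` is positive on the half-line seen from `z`, and
nonpositive on the ray in the direction `-ν`. -/
lemma offSlit_of_outgoing {x n z ν v : Plane} (hn : IsOuterNormal O x n) (hz : z ∈ interior O)
    (hν : 0 < inner ℝ ν n) (hv : 0 < inner ℝ n v) {t : ℝ} (ht : 0 ≤ t) :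
    OffSlit ν (x + t • v - z) := by
  refine offSlit_of_forall (fun h => by simp [h] at hν) fun s hs h => ?_
  have h1 := congrArg (fun p => inner ℝ n p) h
  have h2 : x + t • v - z = (x - z) + t • v := by abel
  simp only [h2, inner_add_right, inner_neg_right, real_inner_smul_right] at h1
  rw [real_inner_comm] at hν
  have h3 := hn.inner_sub_pos hz
  have h4 := mul_nonneg ht hv.le
  have h5 := mul_nonneg hs hν.le
  linarith

lemma offSlit_of_lt {ν p z : Plane} (h : inner ℝ ν z < inner ℝ ν p) : OffSlit ν (p - z) := by
  refine offSlit_of_forall (fun h0 => by simp [h0] at h) fun s hs h1 => ?_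
  have h2 := congrArg (fun p => inner ℝ ν p) h1
  simp only [inner_sub_right, inner_neg_right, real_inner_smul_right,
    real_inner_self_eq_norm_sq] at h2
  have := mul_nonneg hs (sq_nonneg ‖ν‖)
  linarith

/-- The displacement along a path. -/
noncomputable def pathDisp (z : Plane) (e : ℕ → Fin 2 → ℤ) (y : ℕ → Plane) (s : ℕ) : ℝ :=
  ∑ n ∈ Finset.range s, disp z (y n) (hop (e n) (y n) (y (n + 1)))

/-- Two billiard paths that visit the same obstacles have almost the same displacement. -/
lemma IsChain.abs_pathDisp_sub_le (hO : IsObstacle O) (hs : IsSmall O) {e : ℕ → Fin 2 → ℤ}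
    {y y' : ℕ → Plane} {s : ℕ} (hstep : ∀ n < s, IsStep O (e n))
    (hturn : ∀ n, n + 1 < s → IsTurn O (e n) (e (n + 1))) {z : Plane} (hz : z ∈ interior O)
    (h : IsChain O e y s) (h' : IsChain O e y' s)
    (hav : ∀ n < s, Avoids z (y n) (hop (e n) (y n) (y (n + 1))))
    (hav' : ∀ n < s, Avoids z (y' n) (hop (e n) (y' n) (y' (n + 1)))) :
    |pathDisp z e y s - pathDisp z e y' s| ≤ 10 := by
  have hz0 := interior_subset hz
  -- This bound would accumulate along the path; it is used only for the first and the last hop, at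
  -- whose outer ends there is no bounce to provide a slit.
  have crude : ∀ n < s, |disp z (y n) (hop (e n) (y n) (y (n + 1))) -
      disp z (y' n) (hop (e n) (y' n) (y' (n + 1)))| ≤ 4 := by
    intro n hn
    obtain ⟨N, hN⟩ := exists_disp_near hO hs (hstep n hn) hz0
    have h1 := abs_le.1 (hN _ (h.1 n hn.le) _ (h.1 (n + 1) hn) (hav n hn))
    have h2 := abs_le.1 (hN _ (h'.1 n hn.le) _ (h'.1 (n + 1) hn) (hav' n hn))
    rw [abs_le]; constructor <;> linarith
  rcases s with - | s
  · simp [pathDisp]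
  have hsep : ∀ n, ∃ ν : Plane, n + 1 < s + 1 → ∀ q ∈ O,
      ∀ p ∈ obstacleCopy O (relCell (e n) 0) ∪ obstacleCopy O (e (n + 1)),
      inner ℝ ν q < inner ℝ ν p := by
    intro n
    by_cases hn : n + 1 < s + 1
    · obtain ⟨ν, hν⟩ := (hturn n hn).exists_separating hO (hstep n (by omega)).1
        (hstep (n + 1) hn).1
      exact ⟨ν, fun _ => hν⟩
    · exact ⟨0, fun h => absurd h hn⟩
  choose ν hν using hsep
  -- The slit `ν n` at the vertex `n + 1` serves the arriving and the departing hop alike, and the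
  -- constant of `exists_disp_eq` depends on the steps and the slits but not on the path. So the
  -- differences over the inner hops telescope.
  have hmid : ∀ n, n + 2 < s + 1 →
      disp z (y (n + 1)) (hop (e (n + 1)) (y (n + 1)) (y (n + 2))) -
      disp z (y' (n + 1)) (hop (e (n + 1)) (y' (n + 1)) (y' (n + 2))) =
      (slitArg (ν (n + 1)) (y (n + 2) - z) - slitArg (ν (n + 1)) (y' (n + 2) - z)) -
      (slitArg (ν n) (y (n + 1) - z) - slitArg (ν n) (y' (n + 1) - z)) := by
    intro n hn
    have hν1 := hν n (by omega)
    have hν2 := hν (n + 1) hn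
    have hback : ∀ q ∈ O, tab (e (n + 1)) q ∈ obstacleCopy O (relCell (e (n + 1)) 0) := by
      intro q hq
      rw [mem_copy, tab_relCell_zero, AffineIsometryEquiv.symm_apply_apply]; exact hq
    obtain ⟨N, hN⟩ := exists_disp_eq hO hs (hstep (n + 1) (by omega)) hz0 (ν := ν n)
      (μ := ν (n + 1))
      (fun h0 => by
        have := hν1 z hz0 _ (Or.inr (tab_symm_mem_copy.2 hz0))
        simp [h0] at this)
      (fun h0 => by
        have := hν2 z hz0 _ (Or.inr (tab_symm_mem_copy.2 hz0))
        simp [h0] at this)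
      (fun p hp => offSlit_of_lt (hν1 z hz0 p (Or.inr hp)))
      (fun q hq => offSlit_of_lt (hν2 z hz0 _ (Or.inl (hback q hq))))
    have key : ∀ w : ℕ → Plane, IsChain O e w (s + 1) →
        Avoids z (w (n + 1)) (hop (e (n + 1)) (w (n + 1)) (w (n + 2))) →
        disp z (w (n + 1)) (hop (e (n + 1)) (w (n + 1)) (w (n + 2))) =
          slitArg (ν (n + 1)) (w (n + 2) - z) - slitArg (ν n) (w (n + 1) - z) + N := by
      intro w hw hwa
      have w0 := hw.1 n (by omega)
      have w1 := hw.1 (n + 1) (by omega)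
      have w2 := hw.1 (n + 2) (by omega)
      have w3 := hw.1 (n + 3) (by omega)
      obtain ⟨n₁, hn₁, p1, p2, -⟩ := (hw.2 n (by omega)).exists_slit hO hs (hstep n (by omega)).1
        (hstep (n + 1) (by omega)).1 (hturn n (by omega)) w0 w1 w2 hν1
      obtain ⟨n₂, hn₂, q1, -, q2⟩ := (hw.2 (n + 1) hn).exists_slit hO hs
        (hstep (n + 1) (by omega)).1 (hstep (n + 2) hn).1 (hturn (n + 1) hn) w1 w2 w3 hν2
      refine hN _ w1 _ w2 hwa (fun t ht => offSlit_of_outgoing hn₁ hz p1 p2 ht.1) fun t ht => ?_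
      rw [tab_add_smul_hop]
      exact offSlit_of_outgoing hn₂ hz q1 q2 (by linarith [ht.2])
    rw [key y h (hav _ (by omega)), key y' h' (hav' _ (by omega))]; ring
  rcases s with - | s
  · simp only [pathDisp, zero_add, Finset.sum_range_one]
    exact (crude 0 (by omega)).trans (by norm_num)
  have htel : ∀ m ≤ s, pathDisp z e y (m + 1) - pathDisp z e y' (m + 1) =
      (disp z (y 0) (hop (e 0) (y 0) (y 1)) - disp z (y' 0) (hop (e 0) (y' 0) (y' 1))) +
      (slitArg (ν m) (y (m + 1) - z) - slitArg (ν m) (y' (m + 1) - z)) -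
      (slitArg (ν 0) (y 1 - z) - slitArg (ν 0) (y' 1 - z)) := by
    intro m
    induction m with
    | zero => intro _; simp [pathDisp]
    | succ m ih =>
      intro hm
      have h1 := ih (by omega)
      have h2 := hmid m (by omega)
      simp only [pathDisp] at h1 ⊢
      rw [Finset.sum_range_succ, Finset.sum_range_succ _ (m + 1)]
      linarith
  -- The constant is `4 + 4` from the extreme hops plus four slit angles of at most `1/2`.
  have h1 := htel s le_rfl
  have h2 := abs_le.1 (crude 0 (by omega))
  have h3 := abs_le.1 (crude (s + 1) (by omega))
  have b1 := abs_le.1 (abs_slitArg_le (ν s) (y (s + 1) - z))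
  have b2 := abs_le.1 (abs_slitArg_le (ν s) (y' (s + 1) - z))
  have b3 := abs_le.1 (abs_slitArg_le (ν 0) (y 1 - z))
  have b4 := abs_le.1 (abs_slitArg_le (ν 0) (y' 1 - z))
  simp only [pathDisp] at h1 ⊢
  rw [Finset.sum_range_succ, Finset.sum_range_succ _ (s + 1), abs_le]
  simp only [zero_add] at h2
  constructor <;> linarith

lemma IsChain.abs_pathLength_sub_le (hs : IsSmall O) {e : ℕ → Fin 2 → ℤ} {y y' : ℕ → Plane} {s : ℕ}
    (h : IsChain O e y s) (h' : IsChain O e y' s) :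
    |pathLength e y s - pathLength e y' s| ≤ 2 := by
  have h1 := h.pathLength_le hs h'.1
  have h2 := h'.pathLength_le hs h.1
  rw [abs_le]; constructor <;> linarith

/-- An infinite billiard path. -/
def IsInfChain (O : Set Plane) (e : ℕ → Fin 2 → ℤ) (y : ℕ → Plane) : Prop :=
  (∀ n, y n ∈ O) ∧ ∀ n, IsBounce O (e n) (y n) (y (n + 1)) (e (n + 1)) (y (n + 2))

lemma IsInfChain.shift {e : ℕ → Fin 2 → ℤ} {y : ℕ → Plane} (h : IsInfChain O e y) (m : ℕ) :
    IsInfChain O (fun i => e (m + i)) (fun i => y (m + i)) := ⟨fun _ => h.1 _, fun _ => h.2 _⟩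

/-- Reflection is known only at vertices with an incoming hop, hence the index `n + 1`. For the same
reason the trajectories built from chains start at the vertex number `1`. -/
lemma IsInfChain.outgoing (hO : IsObstacle O) (hs : IsSmall O) {e : ℕ → Fin 2 → ℤ}
    (he : IsWord O e) {y : ℕ → Plane} (h : IsInfChain O e y) (n : ℕ) :
    IsOutgoing O (y (n + 1)) (hop (e (n + 1)) (y (n + 1)) (y (n + 2))) ∧
      IsOutgoing O (y (n + 1)) (-flip (e n) (hop (e n) (y n) (y (n + 1)))) := by
  obtain ⟨ν, hν⟩ := (he.2 n).exists_separating hO (he.1 n).1 (he.1 (n + 1)).1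
  obtain ⟨m, hm, -, h1, h2⟩ := (h.2 n).exists_slit hO hs (he.1 n).1 (he.1 (n + 1)).1 (he.2 n)
    (h.1 _) (h.1 _) (h.1 _) hν
  exact ⟨⟨m, hm, h1⟩, ⟨m, hm, h2⟩⟩

lemma IsInfChain.fold_notMem_interior (hO : IsObstacle O) (hs : IsSmall O) {e : ℕ → Fin 2 → ℤ}
    (he : IsWord O e) {y : ℕ → Plane} (h : IsInfChain O e y) (n : ℕ) {t : ℝ}
    (ht : t ∈ Icc (0 : ℝ) 1) :
    fold (y (n + 1) + t • hop (e (n + 1)) (y (n + 1)) (y (n + 2))) ∉ interior O :=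
  SquareBilliard.fold_notMem_interior hs (he.1 _) (h.1 _) (h.1 _) (h.outgoing hO hs he n).1
    (h.outgoing hO hs he (n + 1)).2 ht

lemma avoids_of_notMem_interior {z x v : Plane} (hz : z ∈ interior O)
    (h : ∀ t ∈ Icc (0 : ℝ) 1, fold (x + t • v) ∉ interior O) : Avoids z x v :=
  fun t ht h0 => h t ht (h0 ▸ hz)

lemma IsInfChain.avoids (hO : IsObstacle O) (hs : IsSmall O) {e : ℕ → Fin 2 → ℤ}
    (he : IsWord O e) {y : ℕ → Plane} (h : IsInfChain O e y) {z : Plane} (hz : z ∈ interior O)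
    (n : ℕ) : Avoids z (y (n + 1)) (hop (e (n + 1)) (y (n + 1)) (y (n + 2))) :=
  avoids_of_notMem_interior hz fun _ ht => h.fold_notMem_interior hO hs he n ht

/-- The displacement along a segment is bounded in terms of its length. -/
lemma exists_abs_disp_le {z : Plane} (hz : z ∈ interior O) :
    ∃ C : ℝ, 0 < C ∧ ∀ x v : Plane, (∀ t ∈ Icc (0 : ℝ) 1, fold (x + t • v) ∉ interior O) →
      |disp z x v| ≤ C * ‖v‖ + 1 := by
  obtain ⟨ρ, hρ, hb⟩ := Metric.isOpen_iff.1 isOpen_interior z hz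
  refine ⟨1 / ρ, by positivity, fun x v h => ?_⟩
  refine (abs_disp_le hρ fun t ht => ?_).trans (by rw [div_eq_mul_one_div]; linarith)
  by_contra hc
  exact h t ht (hb (mem_ball_iff_norm.2 (not_le.1 hc)))

end

end SquareBilliard

namespace SquareBilliard

/-! ### From chains to trajectories -/

/-- The unfolded points of the chain `y` with the steps `e`. -/
noncomputable def pathPt (e : ℕ → Fin 2 → ℤ) (y : ℕ → Plane) (n : ℕ) : Plane :=
  (tab (cells e n)).symm (y n)

/-- The direction of the unfolded path between the points with the numbers `n` and `n + 1`. -/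
noncomputable def pathDir (e : ℕ → Fin 2 → ℤ) (y : ℕ → Plane) (n : ℕ) : Plane :=
  dir (pathPt e y (n + 1) - pathPt e y n)

/-- The time at which the path that starts at the point number `1` reaches the point
number `n + 1`. -/
noncomputable def pathTime (e : ℕ → Fin 2 → ℤ) (y : ℕ → Plane) (n : ℕ) : ℝ :=
  ∑ i ∈ Finset.range n, ‖hop (e (i + 1)) (y (i + 1)) (y (i + 2))‖

open Classical in
/-- The number of points, after the starting point, that the path reaches up to time `t`. -/
noncomputable def pathIdx (e : ℕ → Fin 2 → ℤ) (y : ℕ → Plane) (t : ℝ) : ℕ :=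
  if h : ∃ n, t ∈ Ico (pathTime e y n) (pathTime e y (n + 1)) then h.choose else 0

/-- The unfolded path. -/
noncomputable def pathPos (e : ℕ → Fin 2 → ℤ) (y : ℕ → Plane) (t : ℝ) : Plane :=
  pathPt e y (pathIdx e y t + 1) +
    (t - pathTime e y (pathIdx e y t)) • pathDir e y (pathIdx e y t + 1)

lemma flip_nextCell (k e : Fin 2 → ℤ) (v : Plane) :
    flip (nextCell k e) v = flip e (flip k v) := by
  have h1 := tab_nextCell k e
  have h2 : flip (nextCell k e) v = tab (nextCell k e) (0 + v) - tab (nextCell k e) 0 := by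
    rw [tab_sub]; simp
  rw [h2, h1, h1, tab_sub, tab_sub]; simp

lemma pathPt_sub (e : ℕ → Fin 2 → ℤ) (y : ℕ → Plane) (n : ℕ) :
    pathPt e y (n + 1) - pathPt e y n = flip (cells e n) (hop (e n) (y n) (y (n + 1))) := by
  rw [pathPt, pathPt, cells, tab_symm_nextCell, tab_symm_sub, hop]

lemma pathDir_eq (e : ℕ → Fin 2 → ℤ) (y : ℕ → Plane) (n : ℕ) :
    pathDir e y n = flip (cells e n) (dir (hop (e n) (y n) (y (n + 1)))) := by
  rw [pathDir, pathPt_sub, dir_flip]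

lemma pathPt_add (e : ℕ → Fin 2 → ℤ) (y : ℕ → Plane) (n : ℕ) :
    pathPt e y n + ‖hop (e n) (y n) (y (n + 1))‖ • pathDir e y n = pathPt e y (n + 1) := by
  rw [pathDir_eq, ← map_smul, norm_smul_dir, ← pathPt_sub]; abel

@[simp] lemma pathTime_zero (e : ℕ → Fin 2 → ℤ) (y : ℕ → Plane) : pathTime e y 0 = 0 := by
  simp [pathTime]

lemma pathTime_succ (e : ℕ → Fin 2 → ℤ) (y : ℕ → Plane) (n : ℕ) :
    pathTime e y (n + 1) = pathTime e y n + ‖hop (e (n + 1)) (y (n + 1)) (y (n + 2))‖ :=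
  Finset.sum_range_succ _ n

lemma tendsto_sub_nhdsGE (t : ℝ) : Tendsto (fun s : ℝ => s - t) (𝓝[≥] t) (𝓝[≥] 0) := by
  refine tendsto_nhdsWithin_of_tendsto_nhds_of_eventually_within _ ?_ ?_
  · have : Tendsto (fun s : ℝ => s - t) (𝓝 t) (𝓝 (t - t)) := Continuous.tendsto (by fun_prop) t
    rw [sub_self] at this
    exact this.mono_left nhdsWithin_le_nhds
  · filter_upwards [self_mem_nhdsWithin] with s (h : t ≤ s) using sub_nonneg.2 h

lemma tendsto_sub_nhdsLE (t : ℝ) : Tendsto (fun s : ℝ => t - s) (𝓝[≤] t) (𝓝[≥] 0) := by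
  refine tendsto_nhdsWithin_of_tendsto_nhds_of_eventually_within _ ?_ ?_
  · have : Tendsto (fun s : ℝ => t - s) (𝓝 t) (𝓝 (t - t)) := Continuous.tendsto (by fun_prop) t
    rw [sub_self] at this
    exact this.mono_left nhdsWithin_le_nhds
  · filter_upwards [self_mem_nhdsWithin] with s (h : s ≤ t) using sub_nonneg.2 h

section
variable {O : Set Plane} {e : ℕ → Fin 2 → ℤ} {y : ℕ → Plane}

/-- The lower bound for hops keeps reflection times from accumulating, so the path is defined for
all times. -/
lemma pathTime_add_le (hs : IsSmall O) (he : IsWord O e) (hy : IsInfChain O e y) (n : ℕ) :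
    pathTime e y n + 1 / 4 ≤ pathTime e y (n + 1) := by
  rw [pathTime_succ]
  have := norm_hop_ge hs (he.1 (n + 1)).1 (hy.1 (n + 1)) (hy.1 (n + 2))
  linarith

lemma strictMono_pathTime (hs : IsSmall O) (he : IsWord O e) (hy : IsInfChain O e y) :
    StrictMono (pathTime e y) :=
  strictMono_nat_of_lt_succ fun n => by linarith [pathTime_add_le hs he hy n]

lemma pathTime_nonneg (n : ℕ) : 0 ≤ pathTime e y n :=
  Finset.sum_nonneg fun _ _ => norm_nonneg _

lemma le_pathTime (hs : IsSmall O) (he : IsWord O e) (hy : IsInfChain O e y) (n : ℕ) :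
    n / 4 ≤ pathTime e y n := by
  induction n with
  | zero => simp
  | succ n ih => push_cast; linarith [pathTime_add_le hs he hy n]

lemma exists_mem_Ico (hs : IsSmall O) (he : IsWord O e) (hy : IsInfChain O e y) {t : ℝ}
    (ht : 0 ≤ t) : ∃ n, t ∈ Ico (pathTime e y n) (pathTime e y (n + 1)) := by
  have hex : ∃ n, t < pathTime e y n := by
    obtain ⟨n, hn⟩ := exists_nat_gt (4 * t)
    exact ⟨n, by linarith [le_pathTime hs he hy n]⟩
  classical
  have h0 : Nat.find hex ≠ 0 := fun h => by
    have := Nat.find_spec hex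
    rw [h, pathTime_zero] at this; linarith
  obtain ⟨m, hm⟩ := Nat.exists_eq_succ_of_ne_zero h0
  refine ⟨m, not_lt.1 (Nat.find_min hex (by omega)), ?_⟩
  have := Nat.find_spec hex
  rwa [hm] at this

lemma pathIdx_eq (hs : IsSmall O) (he : IsWord O e) (hy : IsInfChain O e y) {t : ℝ} {n : ℕ}
    (h : t ∈ Ico (pathTime e y n) (pathTime e y (n + 1))) : pathIdx e y t = n := by
  have hex : ∃ n, t ∈ Ico (pathTime e y n) (pathTime e y (n + 1)) := ⟨n, h⟩
  have hm := strictMono_pathTime hs he hy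
  rw [pathIdx, dif_pos hex]
  have h1 := hex.choose_spec
  have h2 := hm.lt_iff_lt.1 (h.1.trans_lt h1.2)
  have h3 := hm.lt_iff_lt.1 (h1.1.trans_lt h.2)
  omega

lemma mem_Ico_pathIdx (hs : IsSmall O) (he : IsWord O e) (hy : IsInfChain O e y) {t : ℝ}
    (ht : 0 ≤ t) :
    t ∈ Ico (pathTime e y (pathIdx e y t)) (pathTime e y (pathIdx e y t + 1)) := by
  obtain ⟨n, hn⟩ := exists_mem_Ico hs he hy ht
  rwa [pathIdx_eq hs he hy hn]

lemma pathIdx_pathTime (hs : IsSmall O) (he : IsWord O e) (hy : IsInfChain O e y) (n : ℕ) :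
    pathIdx e y (pathTime e y n) = n :=
  pathIdx_eq hs he hy ⟨le_rfl, strictMono_pathTime hs he hy n.lt_succ_self⟩

lemma pathPos_pathTime (hs : IsSmall O) (he : IsWord O e) (hy : IsInfChain O e y) (n : ℕ) :
    pathPos e y (pathTime e y n) = pathPt e y (n + 1) := by
  rw [pathPos, pathIdx_pathTime hs he hy]; simp

/-- At the right end the index jumps to the next hop, but the formulas of both hops give the same
vertex. -/
lemma pathPos_eq (hs : IsSmall O) (he : IsWord O e) (hy : IsInfChain O e y) {t : ℝ} {n : ℕ}
    (h : t ∈ Icc (pathTime e y n) (pathTime e y (n + 1))) :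
    pathPos e y t = pathPt e y (n + 1) + (t - pathTime e y n) • pathDir e y (n + 1) := by
  rcases h.2.lt_or_eq with h1 | h1
  · rw [pathPos, pathIdx_eq hs he hy ⟨h.1, h1⟩]
  · rw [h1, pathPos_pathTime hs he hy, pathTime_succ, add_sub_cancel_left, pathPt_add]

lemma pathPos_eq' (hs : IsSmall O) (he : IsWord O e) (hy : IsInfChain O e y) {t : ℝ} {n : ℕ}
    (h : t ∈ Icc (pathTime e y n) (pathTime e y (n + 1))) :
    pathPos e y t = (tab (cells e (n + 1))).symm (y (n + 1) +
      ((t - pathTime e y n) / (pathTime e y (n + 1) - pathTime e y n)) •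
        hop (e (n + 1)) (y (n + 1)) (y (n + 2))) := by
  rw [pathPos_eq hs he hy h, pathTime_succ, add_sub_cancel_left, pathDir_eq,
    eq_comm, AffineIsometryEquiv.symm_apply_eq, tab_add_smul, flip_flip, pathPt,
    AffineIsometryEquiv.apply_symm_apply, dir, smul_smul, div_eq_mul_inv]

lemma fold_pathPos (hs : IsSmall O) (he : IsWord O e) (hy : IsInfChain O e y) {t : ℝ} {n : ℕ}
    (h : t ∈ Icc (pathTime e y n) (pathTime e y (n + 1))) :
    fold (pathPos e y t) = fold (y (n + 1) +
      ((t - pathTime e y n) / (pathTime e y (n + 1) - pathTime e y n)) •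
        hop (e (n + 1)) (y (n + 1)) (y (n + 2))) := by
  rw [pathPos_eq' hs he hy h, fold_tab_symm]

lemma div_mem_Icc {a b t : ℝ} (hab : a < b) (h : t ∈ Icc a b) :
    (t - a) / (b - a) ∈ Icc (0 : ℝ) 1 :=
  ⟨div_nonneg (by linarith [h.1]) (by linarith), by
    rw [div_le_one (by linarith)]; linarith [h.2]⟩

lemma div_mem_Ioo {a b t : ℝ} (h : t ∈ Ioo a b) : (t - a) / (b - a) ∈ Ioo (0 : ℝ) 1 :=
  ⟨div_pos (by linarith [h.1]) (by linarith [h.1, h.2]), by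
    rw [div_lt_one (by linarith [h.1, h.2])]; linarith [h.2]⟩

lemma fold_pathPos_notMem_interior (hO : IsObstacle O) (hs : IsSmall O) (he : IsWord O e)
    (hy : IsInfChain O e y) {t : ℝ} (ht : 0 ≤ t) : fold (pathPos e y t) ∉ interior O := by
  obtain ⟨n, hn⟩ := exists_mem_Ico hs he hy ht
  rw [fold_pathPos hs he hy ⟨hn.1, hn.2.le⟩]
  exact hy.fold_notMem_interior hO hs he n
    (div_mem_Icc (strictMono_pathTime hs he hy n.lt_succ_self) ⟨hn.1, hn.2.le⟩)

lemma fold_pathPos_notMem (hO : IsObstacle O) (hs : IsSmall O) (he : IsWord O e)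
    (hy : IsInfChain O e y) {t : ℝ} {n : ℕ}
    (ht : t ∈ Ioo (pathTime e y n) (pathTime e y (n + 1))) : fold (pathPos e y t) ∉ O := by
  rw [fold_pathPos hs he hy (Ioo_subset_Icc_self ht)]
  exact fold_notMem hs (he.1 _) (hy.1 _) (hy.1 _) (hy.outgoing hO hs he n).1
    (hy.outgoing hO hs he (n + 1)).2 (div_mem_Ioo ht)

lemma fold_pathPt (hs : IsSmall O) (hy : IsInfChain O e y) (n : ℕ) :
    fold (pathPt e y n) = y n := by
  rw [pathPt, fold_of_mem_copy hs (tab_symm_mem_copy.2 (hy.1 n)),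
    AffineIsometryEquiv.apply_symm_apply]

lemma IsInfChain.mem_frontier (hO : IsObstacle O) (hs : IsSmall O) (he : IsWord O e)
    (hy : IsInfChain O e y) (n : ℕ) : y (n + 1) ∈ frontier O :=
  (hy.outgoing hO hs he n).1.mem_frontier (hy.1 _)

lemma norm_pathDir (hs : IsSmall O) (he : IsWord O e) (hy : IsInfChain O e y) (n : ℕ) :
    ‖pathDir e y n‖ = 1 := by
  rw [pathDir_eq, LinearIsometryEquiv.norm_map]
  exact norm_dir (hop_ne_zero hs (he.1 _).1 (hy.1 _) (hy.1 _))

variable (hO : IsObstacle O) (hs : IsSmall O) (he : IsWord O e) (hy : IsInfChain O e y)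

/-- The trajectory that is given by a chain; it starts at the point number `1`. -/
noncomputable def pathState (hO : IsObstacle O) (hs : IsSmall O) (he : IsWord O e)
    (hy : IsInfChain O e y) (t : ℝ) : State O :=
  ⟨(fold (pathPos e y (max t 0)), foldVel (pathPos e y (max t 0))
      (pathDir e y (pathIdx e y (max t 0) + 1))),
    fold_mem_square _, fold_pathPos_notMem_interior hO hs he hy (le_max_right _ _), by
      rw [norm_foldVel, norm_pathDir hs he hy]⟩

include hO hs he hy

lemma pos_pathState {t : ℝ} (ht : 0 ≤ t) :
    pos (pathState hO hs he hy t) = fold (pathPos e y t) := by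
  simp [pathState, pos, ht]

lemma vel_pathState {t : ℝ} (ht : 0 ≤ t) :
    vel (pathState hO hs he hy t) = foldVel (pathPos e y t)
      (pathDir e y (pathIdx e y t + 1)) := by
  simp [pathState, vel, ht]

lemma pos_pathState_mem_iff {t : ℝ} (ht : 0 ≤ t) :
    (pos (pathState hO hs he hy t) ∈ frontier O ↔ ∃ n, t = pathTime e y n) ∧
    (pos (pathState hO hs he hy t) ∈ O ↔ ∃ n, t = pathTime e y n) := by
  have h1 : ∀ n, t = pathTime e y n → pos (pathState hO hs he hy t) ∈ frontier O := by
    intro n hn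
    rw [pos_pathState hO hs he hy ht, hn, pathPos_pathTime hs he hy, fold_pathPt hs hy]
    exact hy.mem_frontier hO hs he n
  have h2 : pos (pathState hO hs he hy t) ∈ O → ∃ n, t = pathTime e y n := by
    intro h
    rw [pos_pathState hO hs he hy ht] at h
    obtain ⟨n, hn⟩ := exists_mem_Ico hs he hy ht
    rcases hn.1.eq_or_lt with h3 | h3
    · exact ⟨n, h3.symm⟩
    · exact absurd h (fold_pathPos_notMem hO hs he hy ⟨h3, hn.2⟩)
  exact ⟨⟨fun h => h2 (hO.isCompact.isClosed.frontier_subset h), fun ⟨n, hn⟩ => h1 n hn⟩,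
    ⟨h2, fun ⟨n, hn⟩ => hO.isCompact.isClosed.frontier_subset (h1 n hn)⟩⟩

omit hO he in
/-- At a point of the chain, the folded directions before and after the bounce. -/
lemma foldVel_pathPt (n : ℕ) :
    foldVel (pathPt e y (n + 1)) (pathDir e y (n + 1)) =
      dir (hop (e (n + 1)) (y (n + 1)) (y (n + 2))) ∧
    foldVel (pathPt e y (n + 1)) (-pathDir e y n) =
      -dir (flip (e n) (hop (e n) (y n) (y (n + 1)))) := by
  have h1 : ∀ u, foldVel (pathPt e y (n + 1)) u = flip (cells e (n + 1)) u := fun u =>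
    foldVel_of_abs_lt (abs_sub_lt_of_mem_copy hs (tab_symm_mem_copy.2 (hy.1 (n + 1))))
  rw [h1, h1, pathDir_eq, pathDir_eq, flip_flip, map_neg, cells, flip_nextCell, flip_flip, dir_flip]
  exact ⟨rfl, rfl⟩

lemma isTransversal_pathState (n : ℕ) :
    IsTransversal O (pathState hO hs he hy (pathTime e y n)) := by
  have h0 := pathTime_nonneg (e := e) (y := y) n
  obtain ⟨m, hm, -, -, h1, -⟩ := (hy.2 n).exists_normal hO hs (he.1 n).1 (he.1 (n + 1)).1 (he.2 n)
    (hy.1 _) (hy.1 _) (hy.1 _)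
  refine ⟨(pos_pathState_mem_iff hO hs he hy h0).1.2 ⟨n, rfl⟩, m, ?_, ?_⟩
  · rw [pos_pathState hO hs he hy h0, pathPos_pathTime hs he hy, fold_pathPt hs hy]; exact hm
  · rw [vel_pathState hO hs he hy h0, pathPos_pathTime hs he hy, pathIdx_pathTime hs he hy,
      (foldVel_pathPt hs hy n).1]
    exact h1.ne'

lemma isTransversal_pathState_iff {t : ℝ} (ht : 0 ≤ t) :
    IsTransversal O (pathState hO hs he hy t) ↔ ∃ n, t = pathTime e y n :=
  ⟨fun h => (pos_pathState_mem_iff hO hs he hy ht).1.1 h.1, by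
    rintro ⟨n, rfl⟩; exact isTransversal_pathState hO hs he hy n⟩

omit hO in
lemma pathPos_right {t : ℝ} (ht : 0 ≤ t) : ∀ᶠ s in 𝓝[≥] t,
    pathPos e y s = pathPos e y t + (s - t) • pathDir e y (pathIdx e y t + 1) := by
  have h := mem_Ico_pathIdx hs he hy ht
  filter_upwards [Ico_mem_nhdsGE h.2] with s hs'
  rw [pathPos_eq hs he hy ⟨h.1.trans hs'.1, hs'.2.le⟩, pathPos_eq hs he hy ⟨h.1, h.2.le⟩, add_assoc,
    ← add_smul]
  congr 2; ring

omit hO in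
lemma pathPos_left {t : ℝ} {n : ℕ} (h : t ∈ Ioc (pathTime e y n) (pathTime e y (n + 1))) :
    ∀ᶠ s in 𝓝[≤] t, pathPos e y s = pathPos e y t + (s - t) • pathDir e y (n + 1) := by
  filter_upwards [Ioc_mem_nhdsLE h.1] with s hs'
  rw [pathPos_eq hs he hy ⟨hs'.1.le, hs'.2.trans h.2⟩, pathPos_eq hs he hy (Ioc_subset_Icc_self h),
    add_assoc, ← add_smul]
  congr 2; ring

omit hO in
lemma continuousOn_pathPos : ContinuousOn (pathPos e y) (Ici 0) := by
  intro t ht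
  have hr : ContinuousWithinAt (pathPos e y) (Ici t) t := by
    have h1 : ContinuousWithinAt (fun s => pathPos e y t + (s - t) •
      pathDir e y (pathIdx e y t + 1)) (Ici t) t := by fun_prop
    exact h1.congr_of_eventuallyEq (pathPos_right hs he hy ht) (by simp)
  rcases (show (0 : ℝ) ≤ t from ht).eq_or_lt with h0 | h0
  · rw [h0]; exact hr
  · have hl : ContinuousWithinAt (pathPos e y) (Iic t) t := by
      obtain ⟨n, hn⟩ := exists_mem_Ico hs he hy ht
      have : ∃ m, t ∈ Ioc (pathTime e y m) (pathTime e y (m + 1)) := by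
        rcases hn.1.eq_or_lt with h1 | h1
        · rcases n with - | m
          · rw [pathTime_zero] at h1; linarith
          · exact ⟨m, by rw [← h1]; exact strictMono_pathTime hs he hy m.lt_succ_self, h1.ge⟩
        · exact ⟨n, h1, hn.2.le⟩
      obtain ⟨m, hm⟩ := this
      have h1 : ContinuousWithinAt (fun s => pathPos e y t + (s - t) •
        pathDir e y (m + 1)) (Iic t) t := by fun_prop
      exact h1.congr_of_eventuallyEq (pathPos_left hs he hy hm) (by simp)
    exact (continuousAt_iff_continuous_left_right.2 ⟨hl, hr⟩).continuousWithinAt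

omit hO in
lemma pathPos_near {t : ℝ} (ht : 0 ≤ t) (h : ∀ n, t ≠ pathTime e y n) : ∀ᶠ s in 𝓝 t,
    pathPos e y s = pathPos e y t + (s - t) • pathDir e y (pathIdx e y t + 1) := by
  have h1 := mem_Ico_pathIdx hs he hy ht
  have h2 := pathPos_left hs he hy (t := t) (n := pathIdx e y t)
    ⟨lt_of_le_of_ne h1.1 (h _).symm, h1.2.le⟩
  rw [← nhdsLE_sup_nhdsGE]
  exact eventually_sup.2 ⟨h2, pathPos_right hs he hy ht⟩

/-- The future is handled by `fold_add_smul`, the past by the same statement for the reversed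
half-line. At time zero the past consists of one instant, so the incoming velocity may be chosen as
the bounce at the vertex number `1` dictates. -/
lemma isTrajectory_pathState : IsTrajectory O (Ici 0) (pathState hO hs he hy) := by
  intro t ht
  have ht' : (0 : ℝ) ≤ t := ht
  rw [pos_pathState hO hs he hy ht', vel_pathState hO hs he hy ht']
  constructor
  · have h1 : 𝓝[Ici 0 ∩ Ici t] t ≤ 𝓝[≥] t := nhdsWithin_mono _ inter_subset_right
    have h2 := (tendsto_sub_nhdsGE t).eventually
      (fold_add_smul (pathPos e y t) (pathDir e y (pathIdx e y t + 1)))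
    filter_upwards [h1 h2, h1 (pathPos_right hs he hy ht'), self_mem_nhdsWithin] with s h3 h4 h5
    rw [pos_pathState hO hs he hy h5.1, h4, h3]
  · have key : ∀ W : Plane, (0 < t → ∀ᶠ s in 𝓝[≤] t, pathPos e y s = pathPos e y t + (s - t) • W) →
        ∀ᶠ s in 𝓝[Ici 0 ∩ Iic t] t, pos (pathState hO hs he hy s) = fold (pathPos e y t) +
          (s - t) • (-foldVel (pathPos e y t) (-W)) := by
      intro W hW
      rcases ht'.eq_or_lt with h0 | h0
      · filter_upwards [self_mem_nhdsWithin] with s h5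
        have : s = t := le_antisymm h5.2 (by rw [← h0]; exact h5.1)
        rw [this, pos_pathState hO hs he hy ht']; simp
      · have h1 : 𝓝[Ici 0 ∩ Iic t] t ≤ 𝓝[≤] t := nhdsWithin_mono _ inter_subset_right
        have h2 := (tendsto_sub_nhdsLE t).eventually
          (fold_add_smul (pathPos e y t) (-W))
        filter_upwards [h1 h2, h1 (hW h0), self_mem_nhdsWithin] with s h3 h4 h5
        have h6 : (s - t) • W = (t - s) • (-W) := by
          rw [smul_neg, ← neg_smul]; congr 1; ring
        rw [pos_pathState hO hs he hy h5.1, h4, h6, h3, smul_neg, ← neg_smul]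
        congr 2; ring
    by_cases hcase : ∃ n, t = pathTime e y n
    · obtain ⟨n, rfl⟩ := hcase
      refine ⟨_, ⟨fun _ => ?_, fun hf => ?_⟩, key (pathDir e y n) fun h0 => ?_⟩
      · rw [pathPos_pathTime hs he hy, pathIdx_pathTime hs he hy, (foldVel_pathPt hs hy n).1,
          (foldVel_pathPt hs hy n).2, fold_pathPt hs hy, neg_neg]
        obtain ⟨m, hm, -, h1, -⟩ := (hy.2 n).exists_normal hO hs (he.1 n).1 (he.1 (n + 1)).1 (he.2 n)
          (hy.1 _) (hy.1 _) (hy.1 _)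
        exact ⟨m, hm, h1⟩
      · rw [← pos_pathState hO hs he hy ht'] at hf
        exact absurd ((pos_pathState_mem_iff hO hs he hy ht').1.2 ⟨n, rfl⟩) hf
      · rcases n with - | n
        · simp at h0
        · exact pathPos_left hs he hy
            ⟨strictMono_pathTime hs he hy n.lt_succ_self, le_rfl⟩
    -- Away from the bounces the unfolded velocity is the same before and after, and `foldVel_neg`
    -- is the law of reflection at sides and vertices.
    · refine ⟨_, ⟨fun hf => ?_, fun _ i => ?_⟩, key (pathDir e y (pathIdx e y t + 1)) fun _ => ?_⟩
      · rw [← pos_pathState hO hs he hy ht'] at hf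
        exact absurd ((pos_pathState_mem_iff hO hs he hy ht').1.1 hf) hcase
      · rw [foldVel_neg]
        simp
      · push Not at hcase
        exact (pathPos_near hs he hy ht' hcase).filter_mono nhdsWithin_le_nhds

lemma isUnfolding_pathPos : IsUnfolding O (Ici 0) (pathState hO hs he hy) (pathPos e y) := by
  refine ⟨continuousOn_pathPos hs he hy, fun t ht => (pos_pathState hO hs he hy ht).symm,
    fun t ht hp => ?_⟩
  rw [(pos_pathState_mem_iff hO hs he hy ht).2] at hp
  push Not at hp
  exact ⟨_, (pathPos_near hs he hy ht hp).filter_mono nhdsWithin_le_nhds⟩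

/-- Let `m` be the first index whose reflection time is at least `a`. Viewed from the cell of that
reflection the unfolding starts its type at the cell `0`, and the remaining type is a shift of the
original word. -/
lemma hasAdmissibleType_pathState {a : ℝ} (ha : 0 ≤ a) :
    HasAdmissibleType O fun t => pathState hO hs he hy (a + t) := by
  classical
  have hmono := strictMono_pathTime hs he hy
  have hex : ∃ n, a ≤ pathTime e y n := by
    obtain ⟨n, hn⟩ := exists_nat_gt (4 * a)
    exact ⟨n, by linarith [le_pathTime hs he hy n]⟩
  set m := Nat.find hex with hm
  have hma : a ≤ pathTime e y m := Nat.find_spec hex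
  have hmin : ∀ n, a ≤ pathTime e y n → m ≤ n := fun n hn => Nat.find_min' hex hn
  have hadd : ContinuousOn (fun t => a + t) (Ici 0) := by fun_prop
  have hmaps : MapsTo (fun t => a + t) (Ici 0) (Ici 0) := fun t ht => by
    have : (0 : ℝ) ≤ t := ht
    exact add_nonneg ha this
  have hT := isUnfolding_pathPos hO hs he hy
  -- The shift is `m + 1` and not `m`, since `pathTime e y m` belongs to the vertex number `m + 1`.
  refine ⟨fun t => tab (cells e (m + 1)) (pathPos e y (a + t)), cells fun i => e (m + 1 + i),
    fun n => pathTime e y (m + n) - a, ⟨?_, ?_, ?_⟩, (he.shift (m + 1)).admissible, ?_, ?_, ?_, ?_⟩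
  · exact (tab _).continuous.comp_continuousOn (hT.1.comp hadd hmaps)
  · intro t ht
    rw [fold_tab]; exact hT.2.1 _ (hmaps ht)
  · intro t ht hp
    obtain ⟨u, hu⟩ := hT.2.2 _ (hmaps ht) hp
    refine ⟨flip (cells e (m + 1)) u, ?_⟩
    have h1 : Tendsto (fun s => a + s) (𝓝[Ici 0] t) (𝓝[Ici 0] (a + t)) :=
      tendsto_nhdsWithin_of_tendsto_nhds_of_eventually_within _
        ((Continuous.tendsto (by fun_prop) t).mono_left nhdsWithin_le_nhds)
        (by filter_upwards [self_mem_nhdsWithin] with s hs' using hmaps hs')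
    filter_upwards [h1.eventually hu] with s hs'
    rw [hs', add_sub_add_left_eq_sub, tab_add_smul]
  · simpa using hma
  · exact fun i j hij => sub_lt_sub_right (hmono (by omega)) a
  · intro n
    have h1 : cells e (m + 1 + n) = nextCell (cells e (m + 1)) (cells (fun i => e (m + 1 + i)) n) :=
      cells_shift e (m + 1) n
    simp only
    rw [mem_frontier_copy, add_sub_cancel, pathPos_pathTime hs he hy, ← tab_nextCell, ← h1,
      show m + n + 1 = m + 1 + n by omega, pathPt, AffineIsometryEquiv.apply_symm_apply,
      show m + 1 + n = m + n + 1 by omega]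
    exact hy.mem_frontier hO hs he _
  · intro t ht
    have h0 : 0 ≤ a + t := add_nonneg ha ht
    have h1 := isTransversal_pathState_iff hO hs he hy h0
    have h2 := (pos_pathState_mem_iff hO hs he hy h0).1
    constructor
    · intro h
      have : ∃ n, a + t = pathTime e y n := by
        rcases h with h | h
        · exact h1.1 h
        · exact h2.1 h.2
      obtain ⟨n, hn⟩ := this
      have h3 := hmin n (by linarith)
      refine ⟨n - m, ?_⟩
      simp only
      rw [Nat.add_sub_cancel' h3]; linarith
    · rintro ⟨n, hn⟩
      exact Or.inl (h1.2 ⟨m + n, by linarith⟩)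

end

end SquareBilliard

namespace SquareBilliard

/-! ### Rotation numbers of the trajectories of chains -/

section
variable {O : Set Plane} {e : ℕ → Fin 2 → ℤ} {y : ℕ → Plane}

lemma pathTime_add (e : ℕ → Fin 2 → ℤ) (y : ℕ → Plane) (m n : ℕ) :
    pathTime e y (m + n) = pathTime e y m +
      pathTime (fun i => e (m + i)) (fun i => y (m + i)) n := Finset.sum_range_add _ _ _

variable (hO : IsObstacle O) (hs : IsSmall O) (he : IsWord O e) (hy : IsInfChain O e y)

/-- In the frame of the cell last visited, the state depends only on the current step and its two
end points; the history of cells drops out. Shift invariance, periodicity and compactness of the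
hull use this form. -/
lemma pathState_eq {t : ℝ} {n : ℕ}
    (h : t ∈ Ico (pathTime e y n) (pathTime e y (n + 1))) :
    (pathState hO hs he hy t).1 =
      (fold (y (n + 1) + ((t - pathTime e y n) / (pathTime e y (n + 1) - pathTime e y n)) •
        hop (e (n + 1)) (y (n + 1)) (y (n + 2))),
       foldVel (y (n + 1) + ((t - pathTime e y n) / (pathTime e y (n + 1) - pathTime e y n)) •
        hop (e (n + 1)) (y (n + 1)) (y (n + 2))) (dir (hop (e (n + 1)) (y (n + 1)) (y (n + 2))))) := by
  have ht : 0 ≤ t := (pathTime_nonneg n).trans h.1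
  refine Prod.ext ?_ ?_
  · rw [← fold_pathPos hs he hy ⟨h.1, h.2.le⟩]
    exact pos_pathState hO hs he hy ht
  · refine (vel_pathState hO hs he hy ht).trans ?_
    rw [pathIdx_eq hs he hy h, ← foldVel_tab (cells e (n + 1)) (pathPos e y t),
      pathPos_eq' hs he hy ⟨h.1, h.2.le⟩, AffineIsometryEquiv.apply_symm_apply, pathDir_eq, flip_flip]

lemma pathState_shift (m : ℕ) {t : ℝ} (ht : 0 ≤ t) :
    pathState hO hs he hy (pathTime e y m + t) =
      pathState hO hs (he.shift m) (hy.shift m) t := by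
  obtain ⟨n, hn⟩ := exists_mem_Ico hs (he.shift m) (hy.shift m) ht
  have h1 := pathTime_add e y m n
  have h2 := pathTime_add e y m (n + 1)
  have h3 : pathTime e y m + t ∈ Ico (pathTime e y (m + n)) (pathTime e y (m + n + 1)) := by
    rw [add_assoc, h1, h2]
    exact ⟨by linarith [hn.1], by linarith [hn.2]⟩
  apply Subtype.ext
  rw [pathState_eq hO hs he hy h3, pathState_eq hO hs (he.shift m) (hy.shift m) hn]
  rw [show m + n + 1 = m + (n + 1) by omega, h1, h2, add_sub_add_left_eq_sub,
    add_sub_add_left_eq_sub]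
  rfl

include hO hs he hy in
lemma exists_pathAngle {z : Plane} (hz : z ∈ interior O) :
    ∃ φ : ℝ → ℝ, IsLift (fun t => foldC z (pathPos e y t)) φ (Ici 0) :=
  exists_isLift (convex_Ici 0)
    ((continuous_foldC z).comp_continuousOn (continuousOn_pathPos hs he hy))
    fun t ht h0 => fold_pathPos_notMem_interior hO hs he hy ht (by
      rw [foldC_eq_zero.1 h0]; exact hz)

lemma isAngle_pathState {z : Plane} {φ : ℝ → ℝ} {a : ℝ} (ha : 0 ≤ a)
    (h : IsLift (fun t => foldC z (pathPos e y t)) φ (Ici 0)) :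
    IsAngle z (Ici 0) (fun t => pathState hO hs he hy (a + t)) (fun t => φ (a + t)) := by
  rw [isAngle_iff]
  have hm : MapsTo (fun t => a + t) (Ici 0) (Ici 0) := fun t ht => by
    have : (0 : ℝ) ≤ t := ht
    exact add_nonneg ha this
  refine (h.comp (u := fun t => a + t) (by fun_prop) hm).congr fun t ht => ?_
  rw [pos_pathState hO hs he hy (hm ht)]; rfl

include hO hs he hy

lemma pathAngle_succ {z : Plane} (hz : z ∈ interior O) {φ : ℝ → ℝ}
    (h : IsLift (fun t => foldC z (pathPos e y t)) φ (Ici 0)) (n : ℕ) :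
    φ (pathTime e y (n + 1)) - φ (pathTime e y n) =
      disp z (y (n + 1)) (hop (e (n + 1)) (y (n + 1)) (y (n + 2))) := by
  refine (h.mono fun t ht => (pathTime_nonneg n).trans ht.1).sub_eq_disp
    (strictMono_pathTime hs he hy n.lt_succ_self) (hy.avoids hO hs he hz n) fun t ht => ?_
  rw [foldC, fold_pathPos hs he hy ht]; rfl

lemma pathAngle_eq {z : Plane} (hz : z ∈ interior O) {φ : ℝ → ℝ}
    (h : IsLift (fun t => foldC z (pathPos e y t)) φ (Ici 0)) (n : ℕ) :
    φ (pathTime e y n) - φ 0 = pathDisp z (fun i => e (i + 1)) (fun i => y (i + 1)) n := by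
  induction n with
  | zero => simp [pathDisp]
  | succ n ih =>
    have := pathAngle_succ hO hs he hy hz h n
    rw [pathDisp, Finset.sum_range_succ, ← pathDisp, ← ih]
    linarith

lemma exists_abs_pathAngle_sub_le {z : Plane} (hz : z ∈ interior O) {φ : ℝ → ℝ}
    (h : IsLift (fun t => foldC z (pathPos e y t)) φ (Ici 0)) {R : ℝ}
    (hR : ∀ n, ‖hop (e (n + 1)) (y (n + 1)) (y (n + 2))‖ ≤ R) :
    ∃ K : ℝ, ∀ n, ∀ t ∈ Icc (pathTime e y n) (pathTime e y (n + 1)),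
      |φ t - φ (pathTime e y n)| ≤ K := by
  obtain ⟨ρ, hρ, hb⟩ := Metric.isOpen_iff.1 isOpen_interior z hz
  refine ⟨R / ρ + 1, fun n t ht => ?_⟩
  have hn := pathTime_nonneg (e := e) (y := y) n
  refine ((h.mono fun s hs' => hn.trans hs'.1).abs_sub_le ht.1 (ρ := ρ) ?_ hρ ?_).trans ?_
  · intro s hs'
    rw [foldC, norm_toC]
    by_contra hc
    exact fold_pathPos_notMem_interior hO hs he hy (hn.trans hs'.1)
      (hb (mem_ball_iff_norm.2 (not_le.1 hc)))
  · intro s hs' r hr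
    rw [foldC, foldC, ← toC_sub, norm_toC, sub_sub_sub_cancel_right]
    refine (norm_fold_sub_le _ _).trans ?_
    rw [pathPos_eq hs he hy ⟨hs'.1, hs'.2.trans ht.2⟩, pathPos_eq hs he hy ⟨hr.1, hr.2.trans ht.2⟩,
      add_sub_add_left_eq_sub, ← sub_smul, norm_smul, norm_pathDir hs he hy, mul_one,
      sub_sub_sub_cancel_right, Real.norm_eq_abs]
  · have h1 := pathTime_succ e y n
    have h2 := hR n
    have h3 := ht.2
    gcongr
    linarith

/-- A path whose displacement differs from `u` times its length by a bounded amount has the rotation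
number `u`. -/
lemma hasRotationNumber_pathState {z : Plane} (hz : z ∈ interior O) {u C R : ℝ}
    (hR : ∀ n, ‖hop (e (n + 1)) (y (n + 1)) (y (n + 2))‖ ≤ R)
    (hC : ∀ n, |pathDisp z (fun i => e (i + 1)) (fun i => y (i + 1)) n - u * pathTime e y n| ≤ C)
    {a : ℝ} (ha : 0 ≤ a) :
    HasRotationNumber z (fun t => pathState hO hs he hy (a + t)) u := by
  obtain ⟨φ, hφ⟩ := exists_pathAngle hO hs he hy hz
  obtain ⟨K, hK⟩ := exists_abs_pathAngle_sub_le hO hs he hy hz hφ hR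
  refine ⟨_, isAngle_pathState hO hs he hy ha hφ, ?_⟩
  have hdev : ∀ t, 0 ≤ t → |φ t - φ 0 - u * t| ≤ K + C + |u| * R := by
    intro t ht
    obtain ⟨n, hn⟩ := exists_mem_Ico hs he hy ht
    have h1 := hK n t ⟨hn.1, hn.2.le⟩
    have h2 := hC n
    rw [← pathAngle_eq hO hs he hy hz hφ] at h2
    have h3 : |u * (t - pathTime e y n)| ≤ |u| * R := by
      rw [abs_mul]
      refine mul_le_mul_of_nonneg_left ?_ (abs_nonneg u)
      rw [abs_of_nonneg (by linarith [hn.1])]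
      linarith [pathTime_succ e y n, hR n, hn.2]
    have h4 : φ t - φ 0 - u * t = (φ t - φ (pathTime e y n)) +
        ((φ (pathTime e y n) - φ 0) - u * pathTime e y n) + -(u * (t - pathTime e y n)) := by ring
    rw [h4]
    refine (abs_add_le _ _).trans (add_le_add ((abs_add_le _ _).trans (add_le_add h1 h2)) ?_)
    rwa [abs_neg]
  set M := K + C + |u| * R
  have h1 : Tendsto (fun t : ℝ => 2 * M / t) atTop (𝓝 0) := tendsto_const_nhds.div_atTop tendsto_id
  rw [tendsto_iff_norm_sub_tendsto_zero]
  refine squeeze_zero' (Eventually.of_forall fun _ => norm_nonneg _) ?_ h1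
  filter_upwards [eventually_gt_atTop 0] with t ht
  have h2 := hdev (a + t) (by linarith)
  have h3 := hdev a ha
  have h4 : (φ (a + t) - φ (a + 0)) / t - u =
      ((φ (a + t) - φ 0 - u * (a + t)) - (φ a - φ 0 - u * a)) / t := by
    rw [add_zero]; field_simp; ring
  rw [h4, Real.norm_eq_abs, abs_div, abs_of_pos ht]
  refine div_le_div_of_nonneg_right ?_ ht.le
  have := abs_sub (φ (a + t) - φ 0 - u * (a + t)) (φ a - φ 0 - u * a)
  linarith

omit hO hs he hy in
lemma sum_range_shift {f : ℕ → ℝ} {p : ℕ} (hf : Function.Periodic f p) :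
    ∑ i ∈ Finset.range p, f (i + 1) = ∑ i ∈ Finset.range p, f i := by
  have h1 := Finset.sum_range_succ f p
  rw [Finset.sum_range_succ', ← zero_add p, hf 0, zero_add] at h1
  linarith

omit hO hs he hy in
lemma exists_abs_le_of_periodic {f : ℕ → ℝ} {p : ℕ} (hp : 0 < p) (hf : Function.Periodic f p) :
    ∃ C, ∀ n, |f n| ≤ C := by
  refine ⟨∑ i ∈ Finset.range p, |f i|, fun n => ?_⟩
  rw [← hf.map_mod_nat n]
  exact Finset.single_le_sum (f := fun i => |f i|) (fun i _ => abs_nonneg _)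
    (Finset.mem_range.2 (Nat.mod_lt n hp))

/-- The rotation number of a periodic path is the displacement over a period, divided by the length
of the period. -/
lemma mem_periodicRotationNumbers {z : Plane} (hz : z ∈ interior O) {p : ℕ} (hp : 0 < p)
    (hep : Function.Periodic e p) (hyp : Function.Periodic y p) :
    pathDisp z e y p / pathLength e y p ∈ periodicRotationNumbers O z := by
  set u := pathDisp z e y p / pathLength e y p with hu
  set f : ℕ → ℝ := fun n => disp z (y n) (hop (e n) (y n) (y (n + 1))) with hf
  set g : ℕ → ℝ := fun n => ‖hop (e n) (y n) (y (n + 1))‖ with hg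
  have hfp : Function.Periodic f p := fun n => by
    simp only [hf]
    rw [hep n, hyp n, add_right_comm, hyp (n + 1)]
  have hgp : Function.Periodic g p := fun n => by
    simp only [hg]
    rw [hep n, hyp n, add_right_comm, hyp (n + 1)]
  -- The time counts the hops `1, …, p`, the length the hops `0, …, p - 1`; over a full period the
  -- sums agree.
  have hT : pathTime e y p = pathLength e y p := sum_range_shift hgp
  have hTpos : 0 < pathTime e y p := by
    have := strictMono_pathTime hs he hy hp
    rwa [pathTime_zero] at this
  have hshift : (fun i => e (p + i)) = e ∧ (fun i => y (p + i)) = y :=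
    ⟨funext fun i => by rw [add_comm, hep], funext fun i => by rw [add_comm, hyp]⟩
  have hper : ∀ t, 0 ≤ t → pathState hO hs he hy (t + pathTime e y p) =
      pathState hO hs he hy t := by
    intro t ht
    rw [add_comm, pathState_shift hO hs he hy p ht]
    congr 1
    exacts [hshift.1, hshift.2]
  obtain ⟨R, hR⟩ := exists_abs_le_of_periodic hp hgp
  -- By the choice of `u` the deviation of the displacement from `u` times the length vanishes over
  -- a period, so it is periodic and therefore bounded.
  obtain ⟨C, hC⟩ := exists_abs_le_of_periodic (f := fun n =>
      pathDisp z (fun i => e (i + 1)) (fun i => y (i + 1)) n - u * pathTime e y n) hp (fun n => by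
    have h1 : pathDisp z (fun i => e (i + 1)) (fun i => y (i + 1)) (n + p) =
        pathDisp z (fun i => e (i + 1)) (fun i => y (i + 1)) n + pathDisp z e y p := by
      rw [add_comm n p, pathDisp, Finset.sum_range_add, add_comm]
      congr 1
      · refine Finset.sum_congr rfl fun i _ => ?_
        rw [show p + i + 1 = (i + 1) + p by omega]
        exact hfp (i + 1)
      · exact sum_range_shift hfp
    have h2 : pathTime e y (n + p) = pathTime e y n + pathLength e y p := by
      rw [add_comm n p, pathTime_add, hshift.1, hshift.2, hT, add_comm]
    have h3 : u * pathLength e y p = pathDisp z e y p := by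
      rw [hu, div_mul_cancel₀ _ (by rw [← hT]; exact hTpos.ne')]
    simp only [h1, h2, mul_add, h3]; ring)
  have h0 : (fun t => pathState hO hs he hy (0 + t)) = pathState hO hs he hy := by simp
  refine ⟨pathState hO hs he hy, isTrajectory_pathState hO hs he hy,
    ⟨pathTime e y p, hTpos, hper⟩, ?_, ?_⟩
  · rw [← h0]; exact hasAdmissibleType_pathState hO hs he hy le_rfl
  · rw [← h0]
    exact hasRotationNumber_pathState hO hs he hy hz
      (fun n => (le_abs_self _).trans (hR (n + 1))) hC le_rfl

end

end SquareBilliard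

namespace SquareBilliard

/-! ### Normal vectors of obstacles with a smooth boundary -/

section
variable {O : Set Plane}

/-- At a boundary point of an obstacle there is exactly one unit outer normal vector, and the
directions at an obtuse angle to it point into the interior of the obstacle. -/
lemma IsObstacle.exists_normal (hO : IsObstacle O) {p : Plane} (hp : p ∈ frontier O) :
    ∃ m, IsOuterNormal O p m ∧ (∀ n, IsOuterNormal O p n → n = m) ∧
      ∀ v, inner ℝ m v < 0 → ∀ᶠ t : ℝ in 𝓝[>] 0, p + t • v ∈ interior O := by
  obtain ⟨g, hg, hg0, hgO⟩ := hO.smooth p hp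
  have hpO : p ∈ O := hO.isCompact.isClosed.frontier_subset hp
  have hcont : ∀ᶠ y in 𝓝 p, ContinuousAt g y :=
    (hg.eventually (by simp)).mono fun y hy => hy.continuousAt
  -- A `C¹` function at `p` is continuous near `p`, so negativity of `g` persists in a neighborhood
  -- of `y`.
  have hint : ∀ᶠ y in 𝓝 p, g y < 0 → y ∈ interior O := by
    filter_upwards [hcont, hgO.eventually_nhds] with y h1 h2 h3
    rw [mem_interior_iff_mem_nhds]
    filter_upwards [h1.eventually_lt_const h3, h2] with x h4 h5
    exact h5.2 h4.le
  have hgp : g p = 0 := by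
    refine le_antisymm (hgO.self_of_nhds.1 hpO) (not_lt.1 fun h => ?_)
    exact hp.2 (hint.self_of_nhds h)
  set m0 := (InnerProductSpace.toDual ℝ Plane).symm (fderiv ℝ g p) with hm0
  have hm : ∀ v, fderiv ℝ g p v = inner ℝ m0 v := fun v => by
    rw [hm0, InnerProductSpace.toDual_symm_apply]
  have hm0' : m0 ≠ 0 := by simpa [hm0] using hg0
  have hpos : 0 < ‖m0‖ := norm_pos_iff.2 hm0'
  have hline : ∀ v : Plane, Tendsto (fun t : ℝ => p + t • v) (𝓝[>] 0) (𝓝 p) := fun v => by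
    have : Tendsto (fun t : ℝ => p + t • v) (𝓝 0) (𝓝 (p + (0 : ℝ) • v)) :=
      Continuous.tendsto (by fun_prop) 0
    simp only [zero_smul, add_zero] at this
    exact this.mono_left nhdsWithin_le_nhds
  have hder : ∀ v, HasDerivAt (fun t : ℝ => g (p + t • v)) (inner ℝ m0 v) 0 := fun v => by
    have h1 : HasFDerivAt g (fderiv ℝ g p) (p + (0 : ℝ) • v) := by
      simpa using (hg.differentiableAt (by simp)).hasFDerivAt
    have h2 : HasDerivAt (fun t : ℝ => p + t • v) v 0 := by
      simpa using ((hasDerivAt_id (0 : ℝ)).smul_const v).const_add p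
    rw [← hm]
    exact h1.comp_hasDerivAt 0 h2
  have hslope : ∀ v, Tendsto (fun t : ℝ => t⁻¹ * g (p + t • v)) (𝓝[>] 0) (𝓝 (inner ℝ m0 v)) := by
    intro v
    have := (hder v).tendsto_slope_zero_right
    simpa [hgp] using this
  have hin : ∀ v, inner ℝ m0 v < 0 → ∀ᶠ t : ℝ in 𝓝[>] 0, p + t • v ∈ interior O := by
    intro v hv
    filter_upwards [(hslope v).eventually_lt_const hv, (hline v).eventually hint,
      self_mem_nhdsWithin] with t h1 h2 (h3 : 0 < t)
    exact h2 (neg_of_mul_neg_right h1 (inv_nonneg.2 h3.le))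
  have hdir : ∀ v, inner ℝ (dir m0) v = ‖m0‖⁻¹ * inner ℝ m0 v := fun v => by
    rw [dir, real_inner_smul_left]
  have hin' : ∀ v, inner ℝ (dir m0) v < 0 → ∀ᶠ t : ℝ in 𝓝[>] 0, p + t • v ∈ interior O := by
    intro v hv
    rw [hdir] at hv
    exact hin v (neg_of_mul_neg_right hv (inv_nonneg.2 hpos.le))
  refine ⟨dir m0, ⟨norm_dir hm0', fun y hy => ?_⟩, fun n hn => ?_, hin'⟩
  -- A point `y ∈ O` with positive product would make `g` positive on the initial part of the
  -- segment from `p` to `y`, which lies in `O` by convexity.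
  · rw [hdir]
    refine mul_nonpos_of_nonneg_of_nonpos (inv_nonneg.2 hpos.le) (not_lt.1 fun h => ?_)
    have h1 : ∀ᶠ t : ℝ in 𝓝[>] 0, t < 1 := by
      filter_upwards [Ioo_mem_nhdsGT (show (0 : ℝ) < 1 by norm_num)] with t ht using ht.2
    obtain ⟨t, h2, h3, h4, h5⟩ := (((hslope (y - p)).eventually_const_lt h).and
      (h1.and (((hline (y - p)).eventually hgO).and self_mem_nhdsWithin))).exists
    have h5 : 0 < t := h5
    have h6 : p + t • (y - p) ∈ O := hO.convex.add_smul_sub_mem hpO hy ⟨h5.le, h3.le⟩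
    have h7 := h4.1 h6
    have := mul_nonpos_of_nonneg_of_nonpos (inv_nonneg.2 h5.le) h7
    linarith
  -- For another unit normal `n`, the direction `n - m`, where `m` is the normalized gradient, forms
  -- an obtuse angle with `m`, so it points into `O`; but its product with `n` is positive.
  · by_contra hne
    have h1 : inner ℝ (dir m0) n < 1 :=
      inner_lt_one_iff_real_of_norm_eq_one (norm_dir hm0') hn.1 |>.2 (Ne.symm hne)
    have h2 : inner ℝ (dir m0) (n - dir m0) < 0 := by
      rw [inner_sub_right, real_inner_self_eq_norm_sq, norm_dir hm0']; linarith
    obtain ⟨t, h3, h4⟩ := ((hin' _ h2).and self_mem_nhdsWithin).exists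
    have h4 : 0 < t := h4
    have h5 := hn.2 _ (interior_subset h3)
    rw [add_sub_cancel_left, real_inner_smul_right, inner_sub_right, real_inner_self_eq_norm_sq,
      hn.1, real_inner_comm] at h5
    nlinarith

lemma IsOuterNormal.inner_nonneg (hO : IsObstacle O) {p n v : Plane} (hp : p ∈ frontier O)
    (hn : IsOuterNormal O p n) (hv : ∃ᶠ t : ℝ in 𝓝[>] 0, p + t • v ∉ interior O) :
    0 ≤ inner ℝ n v := by
  obtain ⟨m, -, h1, h2⟩ := hO.exists_normal hp
  rw [h1 n hn]
  by_contra hc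
  exact hv ((h2 v (not_le.1 hc)).mono fun t ht => not_not.2 ht)

lemma IsOuterNormal.unique (hO : IsObstacle O) {p n n' : Plane} (hp : p ∈ frontier O)
    (hn : IsOuterNormal O p n) (hn' : IsOuterNormal O p n') : n = n' := by
  obtain ⟨m, -, h1, -⟩ := hO.exists_normal hp
  rw [h1 n hn, h1 n' hn']

end

/-! ### Trajectories and their unfoldings -/

/-- The relation "same derivative, and on the tangent line of the other point" is locally true,
symmetric and transitive, so it holds throughout the connected open interval; continuity adds the
end points. -/
lemma eq_affine_of_locally_affine {f : ℝ → Plane} {a b : ℝ} (hab : a < b)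
    (hc : ContinuousOn f (Icc a b))
    (h : ∀ t ∈ Ioo a b, ∃ u : Plane, ∀ᶠ s in 𝓝 t, f s = f t + (s - t) • u) :
    ∃ u : Plane, ∀ t ∈ Icc a b, f t = f a + (t - a) • u := by
  have hd : ∀ t u, (∀ᶠ s in 𝓝 t, f s = f t + (s - t) • u) → HasDerivAt f u t := by
    intro t u hu
    have h1 : HasDerivAt (fun s => f t + (s - t) • u) u t := by
      simpa using (((hasDerivAt_id t).sub_const t).smul_const u).const_add (f t)
    exact h1.congr_of_eventuallyEq hu
  have key : ∀ t ∈ Ioo a b, ∀ s ∈ Ioo a b, deriv f s = deriv f t ∧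
      f s = f t + (s - t) • deriv f t := by
    intro t ht s hs
    refine isPreconnected_Ioo.induction₂ (fun t s => deriv f s = deriv f t ∧
      f s = f t + (s - t) • deriv f t) (fun x hx => ?_) (fun x y z _ _ _ h1 h2 => ?_)
      (fun x y _ _ h1 => ?_) ht hs
    · obtain ⟨u, hu⟩ := h x hx
      have h1 := (hd x u hu).deriv
      refine Eventually.filter_mono nhdsWithin_le_nhds ?_
      filter_upwards [hu, hu.eventually_nhds] with y h2 h3
      refine ⟨?_, by rw [h1, h2]⟩
      rw [h1]
      refine (hd y u ?_).deriv
      filter_upwards [h3] with s h4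
      rw [h4, h2, add_assoc, ← add_smul]; congr 2; ring
    · refine ⟨h2.1.trans h1.1, ?_⟩
      rw [h2.2, h1.2, h1.1, add_assoc, ← add_smul]; congr 2; ring
    · refine ⟨h1.1.symm, ?_⟩
      rw [h1.2, h1.1, add_assoc, ← add_smul]
      simp
  obtain ⟨c, hac, hcb⟩ := exists_between hab
  have h1 : EqOn f (fun s => f c + (s - c) • deriv f c) (Icc a b) := by
    have h2 : EqOn f (fun s => f c + (s - c) • deriv f c) (Ioo a b) := fun s hs =>
      (key c ⟨hac, hcb⟩ s hs).2
    refine h2.of_subset_closure hc (by fun_prop) Ioo_subset_Icc_self ?_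
    rw [closure_Ioo hab.ne]
  refine ⟨deriv f c, fun t ht => ?_⟩
  rw [h1 ht, h1 (left_mem_Icc.2 hab.le)]
  simp only
  rw [add_assoc, ← add_smul]; congr 2; ring

section
variable {O : Set Plane}

lemma eq_of_eventually_smul_eq {v w : Plane} (h : ∀ᶠ t : ℝ in 𝓝[≥] 0, t • v = t • w) : v = w := by
  have hm : ∀ᶠ t : ℝ in 𝓝[>] 0, t ∈ Ioi (0 : ℝ) := self_mem_nhdsWithin
  obtain ⟨t, h1, h2⟩ := ((h.filter_mono (nhdsWithin_mono _ Ioi_subset_Ici_self)).and hm).exists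
  exact smul_right_injective _ (ne_of_gt h2) h1

lemma tendsto_add_nhdsGE {a b t : ℝ} (ht : t ∈ Ico a b) :
    Tendsto (fun h : ℝ => t + h) (𝓝[≥] 0) (𝓝[Icc a b ∩ Ici t] t) := by
  refine tendsto_nhdsWithin_of_tendsto_nhds_of_eventually_within _ ?_ ?_
  · have : Tendsto (fun s : ℝ => t + s) (𝓝 0) (𝓝 (t + 0)) := Continuous.tendsto (by fun_prop) 0
    rw [add_zero] at this
    exact this.mono_left nhdsWithin_le_nhds
  · filter_upwards [Ico_mem_nhdsGE (sub_pos.2 ht.2)] with s hs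
    exact ⟨⟨by linarith [ht.1, hs.1], by linarith [hs.2]⟩, by
      have := hs.1; rw [mem_Ici]; linarith⟩

lemma tendsto_sub_nhdsGE' {a b t : ℝ} (ht : t ∈ Ioc a b) :
    Tendsto (fun h : ℝ => t - h) (𝓝[≥] 0) (𝓝[Icc a b ∩ Iic t] t) := by
  refine tendsto_nhdsWithin_of_tendsto_nhds_of_eventually_within _ ?_ ?_
  · have : Tendsto (fun s : ℝ => t - s) (𝓝 0) (𝓝 (t - 0)) := Continuous.tendsto (by fun_prop) 0
    rw [sub_zero] at this
    exact this.mono_left nhdsWithin_le_nhds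
  · filter_upwards [Ico_mem_nhdsGE (sub_pos.2 ht.1)] with s hs
    exact ⟨⟨by linarith [hs.2], by linarith [ht.2, hs.1]⟩, by
      have := hs.1; rw [mem_Iic]; linarith⟩

variable {L : ℝ} {γ : ℝ → State O}

/-- The outgoing velocity is the folded velocity of the unfolding. -/
lemma IsTrajectory.foldVel_eq (h : IsTrajectory O (Icc 0 L) γ) {T : ℝ → Plane}
    (hT : ∀ t ∈ Icc 0 L, fold (T t) = pos (γ t)) {t b : ℝ} (ht : 0 ≤ t) (htb : t < b) (hb : b ≤ L)
    {u : Plane} (hu : ∀ s ∈ Icc t b, T s = T t + (s - t) • u) : foldVel (T t) u = vel (γ t) := by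
  have htL : t ∈ Ico 0 L := ⟨ht, htb.trans_le hb⟩
  have h1 := (tendsto_add_nhdsGE htL).eventually (h t (Ico_subset_Icc_self htL)).1
  refine eq_of_eventually_smul_eq ?_
  filter_upwards [h1, fold_add_smul (T t) u, Ico_mem_nhdsGE (sub_pos.2 htb)] with c h2 h3 h4
  have h5 := hu (t + c) ⟨by linarith [h4.1], by linarith [h4.2]⟩
  rw [add_sub_cancel_left] at h5 h2
  have h6 := hT (t + c) ⟨by linarith [h4.1], by linarith [h4.2]⟩
  rw [h5, h3, hT t (Ico_subset_Icc_self htL), h2] at h6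
  exact add_left_cancel h6

/-- The incoming velocity is the folded velocity of the unfolding. -/
lemma IsTrajectory.foldVel_neg_eq {T : ℝ → Plane}
    (hT : ∀ t ∈ Icc 0 L, fold (T t) = pos (γ t)) {t a : ℝ} (ht : t ≤ L) (hat : a < t) (ha : 0 ≤ a)
    {u w : Plane} (hu : ∀ s ∈ Icc a t, T s = T t + (s - t) • u)
    (hw : ∀ᶠ s in 𝓝[Icc 0 L ∩ Iic t] t, pos (γ s) = pos (γ t) + (s - t) • w) :
    foldVel (T t) (-u) = -w := by
  have htL : t ∈ Ioc 0 L := ⟨ha.trans_lt hat, ht⟩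
  have h1 := (tendsto_sub_nhdsGE' htL).eventually hw
  refine eq_of_eventually_smul_eq ?_
  filter_upwards [h1, fold_add_smul (T t) (-u), Ico_mem_nhdsGE (sub_pos.2 hat)] with c h2 h3 h4
  have h5 := hu (t - c) ⟨by linarith [h4.2], by linarith [h4.1]⟩
  rw [sub_sub_cancel_left, neg_smul] at h5 h2
  have h6 := hT (t - c) ⟨by linarith [h4.2], by linarith [h4.1]⟩
  rw [h5, ← smul_neg, h3, hT t (Ioc_subset_Icc_self htL), h2, ← smul_neg] at h6
  exact add_left_cancel h6

/-- At the obstacle, a trajectory does not come from the inside nor does it go inside. -/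
lemma IsTrajectory.inner_nonneg (hO : IsObstacle O) (h : IsTrajectory O (Icc 0 L) γ) {t : ℝ}
    (ht : t ∈ Ico 0 L) (hf : pos (γ t) ∈ frontier O) {n : Plane}
    (hn : IsOuterNormal O (pos (γ t)) n) : 0 ≤ inner ℝ n (vel (γ t)) := by
  refine hn.inner_nonneg hO hf ?_
  have h1 := (tendsto_add_nhdsGE ht).eventually (h t (Ico_subset_Icc_self ht)).1
  refine Eventually.frequently ?_
  filter_upwards [h1.filter_mono (nhdsWithin_mono _ Ioi_subset_Ici_self)] with c h2
  rw [add_sub_cancel_left] at h2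
  rw [← h2]
  exact (γ (t + c)).2.2.1

/-- Away from the transversal reflections, the unfolding is straight. -/
lemma IsUnfolding.locally_affine (hs : IsSmall O)
    (h : IsTrajectory O (Icc 0 L) γ) {T : ℝ → Plane} (hT : IsUnfolding O (Icc 0 L) γ T) {t : ℝ}
    (ht : t ∈ Ioo 0 L) (hn : ¬ IsTransversal O (γ t)) :
    ∃ u : Plane, ∀ᶠ s in 𝓝 t, T s = T t + (s - t) • u := by
  have htI : t ∈ Icc 0 L := Ioo_subset_Icc_self ht
  have hI : Icc 0 L ∈ 𝓝 t := Icc_mem_nhds ht.1 ht.2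
  by_cases hp : pos (γ t) ∈ O
  · have hf : pos (γ t) ∈ frontier O := ⟨subset_closure hp, (γ t).2.2.1⟩
    obtain ⟨h1, w, hw, h2⟩ := h t htI
    -- A tangential reflection is trivial, so at a grazing contact the folded path is straight; near
    -- the obstacle folding is an isometry, and the unfolding is straight as well.
    have hwv : w = vel (γ t) := by
      obtain ⟨n, hn1, hn2⟩ := hw.1 hf
      have h0 : inner ℝ n (vel (γ t)) = 0 := by
        by_contra hc; exact hn ⟨hf, n, hn1, hc⟩
      have h3 : inner ℝ w n = 0 := by
        rw [hn2, inner_sub_right, real_inner_smul_right, real_inner_self_eq_norm_sq, hn1.1,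
          real_inner_comm] at h0
        linarith
      rw [hn2, h3]; simp
    obtain ⟨k, hk⟩ := (fold_mem_iff hs).1 (show fold (T t) ∈ O by rwa [hT.2.1 t htI])
    have hc : ContinuousAt T t := (hT.1 t htI).continuousAt hI
    have h3 : ∀ᶠ s in 𝓝 t, pos (γ s) = pos (γ t) + (s - t) • vel (γ t) := by
      rw [← nhdsLE_sup_nhdsGE]
      refine eventually_sup.2 ⟨?_, ?_⟩
      · rw [hwv] at h2
        rwa [inter_comm, nhdsWithin_inter_of_mem' (mem_nhdsWithin_of_mem_nhds hI)] at h2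
      · rwa [inter_comm, nhdsWithin_inter_of_mem' (mem_nhdsWithin_of_mem_nhds hI)] at h1
    refine ⟨flip k (vel (γ t)), ?_⟩
    filter_upwards [h3, hc.eventually (fold_eventuallyEq_tab hs hk), hI] with s h4 h5 h6
    have h7 : T s = (tab k).symm (pos (γ s)) := by
      rw [← hT.2.1 s h6, h5]; simp
    have h8 : T t = (tab k).symm (pos (γ t)) := by
      rw [← hT.2.1 t htI, fold_of_mem_copy hs hk]; simp
    rw [h7, h8, h4, AffineIsometryEquiv.symm_apply_eq, tab_add_smul, flip_flip]; simp
  · obtain ⟨u, hu⟩ := hT.2.2 t htI hp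
    rw [nhdsWithin_eq_nhds.2 hI] at hu
    exact ⟨u, hu⟩

end

end SquareBilliard

namespace SquareBilliard

/-! ### From trajectories to chains -/

section
variable {O : Set Plane} {L : ℝ} {γ : ℝ → State O}

/-- A trajectory piece of admissible type is given by a chain. -/
lemma IsAdmissiblePiece.exists_chain (hO : IsObstacle O) (hs : IsSmall O)
    (h : IsAdmissiblePiece O L γ) {z : Plane} (hz : z ∈ interior O) {φ : ℝ → ℝ}
    (hφ : IsAngle z (Icc 0 L) γ φ) :
    ∃ (e : ℕ → Fin 2 → ℤ) (y : ℕ → Plane) (s : ℕ), 0 < s ∧ (∀ n < s, IsStep O (e n)) ∧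
      (∀ n, n + 1 < s → IsTurn O (e n) (e (n + 1))) ∧ IsChain O e y s ∧
      (∀ n < s, ∀ t ∈ Icc (0 : ℝ) 1,
        fold (y n + t • hop (e n) (y n) (y (n + 1))) ∉ interior O) ∧
      pathLength e y s = L ∧ pathDisp z e y s = φ L - φ 0 := by
  obtain ⟨hL, htr, T, s, k, τ, hT, hk, hτ0, hτs, hmono, hτk, hiff⟩ := h
  have hs0 : 0 < s := by
    rcases Nat.eq_zero_or_pos s with h0 | h0
    · rw [h0, hτ0] at hτs; exact absurd hτs hL.ne
    · exact h0
  have hlt : ∀ n < s, τ n < τ (n + 1) := fun n hn =>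
    hmono (mem_Iic.2 hn.le) (mem_Iic.2 hn) n.lt_succ_self
  have hle : ∀ n ≤ s, τ n ∈ Icc 0 L := fun n hn => by
    rw [← hτ0, ← hτs]
    exact ⟨hmono.monotoneOn (mem_Iic.2 hs0.le) (mem_Iic.2 hn) n.zero_le,
      hmono.monotoneOn (mem_Iic.2 hn) (mem_Iic.2 le_rfl) hn⟩
  -- the unfolding is straight between the reflections
  have hstr : ∀ n, ∃ u : Plane, n < s → ∀ t ∈ Icc (τ n) (τ (n + 1)),
      T t = T (τ n) + (t - τ n) • u := by
    intro n
    by_cases hn : n < s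
    swap; · exact ⟨0, fun h => absurd h hn⟩
    obtain ⟨u, hu⟩ := eq_affine_of_locally_affine (hlt n hn)
      (hT.1.mono (Icc_subset_Icc (hle n hn.le).1 (hle (n + 1) hn).2)) fun t ht => by
        have ht' : t ∈ Ioo 0 L := ⟨(hle n hn.le).1.trans_lt ht.1, ht.2.trans_le (hle (n + 1) hn).2⟩
        refine hT.locally_affine hs htr ht' fun htv => ?_
        obtain ⟨m, hm0, hms, rfl⟩ := (hiff t ht').1 htv
        have h1 := hmono.lt_iff_lt (mem_Iic.2 hn.le) (mem_Iic.2 hms.le) |>.1 ht.1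
        have h2 := hmono.lt_iff_lt (mem_Iic.2 hms.le) (mem_Iic.2 hn) |>.1 ht.2
        omega
    exact ⟨u, fun _ => hu⟩
  choose u hu using hstr
  have hv : ∀ n < s, foldVel (T (τ n)) (u n) = vel (γ (τ n)) := fun n hn =>
    htr.foldVel_eq hT.2.1 (hle n hn.le).1 (hlt n hn) (hle (n + 1) hn).2 (hu n hn)
  have hu1 : ∀ n < s, ‖u n‖ = 1 := fun n hn => by
    rw [← norm_foldVel (T (τ n)), hv n hn]; exact (γ (τ n)).2.2.2
  have hu' : ∀ n < s, ∀ t ∈ Icc (τ n) (τ (n + 1)),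
      T t = T (τ (n + 1)) + (t - τ (n + 1)) • u n := fun n hn t ht => by
    rw [hu n hn t ht, hu n hn _ (right_mem_Icc.2 (hlt n hn).le), add_assoc, ← add_smul]
    congr 2; ring
  set e : ℕ → Fin 2 → ℤ := fun n => relCell (k n) (k (n + 1)) with he
  set y : ℕ → Plane := fun n => tab (k n) (T (τ n)) with hy
  have hyf : ∀ n ≤ s, y n ∈ frontier O := fun n hn => mem_frontier_copy.1 (hτk n hn)
  have hyO : ∀ n ≤ s, y n ∈ O := fun n hn => hO.isCompact.isClosed.frontier_subset (hyf n hn)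
  have hfv : ∀ n ≤ s, ∀ v, foldVel (T (τ n)) v = flip (k n) v := fun n hn v =>
    foldVel_of_abs_lt (abs_sub_lt_of_mem_copy hs (mem_copy.2 (hyO n hn)))
  have hpos : ∀ n ≤ s, pos (γ (τ n)) = y n := fun n hn => by
    rw [← hT.2.1 _ (hle n hn), fold_of_mem_copy hs (mem_copy.2 (hyO n hn))]
  have hhop : ∀ n < s, hop (e n) (y n) (y (n + 1)) = (τ (n + 1) - τ n) • flip (k n) (u n) := by
    intro n hn
    rw [hop, (AffineIsometryEquiv.symm_apply_eq _).2 (tab_relCell (k n) (k (n + 1)) _).symm, tab_sub,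
      hu n hn _ (right_mem_Icc.2 (hlt n hn).le), add_sub_cancel_left, map_smul]
  have hhop' : ∀ n < s, flip (e n) (hop (e n) (y n) (y (n + 1))) =
      (τ (n + 1) - τ n) • flip (k (n + 1)) (u n) := by
    intro n hn
    rw [flip_hop, hy]
    simp only
    rw [tab_relCell, tab_sub, hu n hn _ (right_mem_Icc.2 (hlt n hn).le), add_sub_cancel_left,
      map_smul]
  have hdir : ∀ c : ℝ, 0 < c → ∀ (l : Fin 2 → ℤ) (v : Plane), ‖v‖ = 1 →
      dir (c • flip l v) = flip l v := by
    intro c hc l v hv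
    rw [dir, norm_smul, LinearIsometryEquiv.norm_map, hv, Real.norm_of_nonneg hc.le, mul_one,
      smul_smul, inv_mul_cancel₀ hc.ne', one_smul]
  have hseg : ∀ n < s, ∀ t ∈ Icc (τ n) (τ (n + 1)), pos (γ t) =
      fold (y n + ((t - τ n) / (τ (n + 1) - τ n)) • hop (e n) (y n) (y (n + 1))) := by
    intro n hn t ht
    have h0 : τ (n + 1) - τ n ≠ 0 := (sub_pos.2 (hlt n hn)).ne'
    rw [← hT.2.1 t ⟨(hle n hn.le).1.trans ht.1, ht.2.trans (hle _ hn).2⟩, hhop n hn, smul_smul,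
      div_mul_cancel₀ _ h0, hu n hn t ht, ← tab_add_smul, fold_tab]
  have hav : ∀ n < s, ∀ t ∈ Icc (0 : ℝ) 1,
      fold (y n + t • hop (e n) (y n) (y (n + 1))) ∉ interior O := by
    intro n hn t ht
    have h0 := sub_pos.2 (hlt n hn)
    have h1 := hseg n hn (τ n + t * (τ (n + 1) - τ n))
      ⟨by nlinarith [ht.1], by nlinarith [ht.2]⟩
    rw [add_sub_cancel_left, mul_div_cancel_right₀ _ h0.ne'] at h1
    rw [← h1]
    exact (γ _).2.2.1
  refine ⟨e, y, s, hs0, fun n hn => hk.isStep hn, fun n hn => hk.isTurn hn, ⟨hyO, ?_⟩, hav, ?_, ?_⟩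
  · intro n hn q hq
    have hn' : n < s := by omega
    have htI : τ (n + 1) ∈ Ioo 0 L := by
      refine ⟨(hle n hn'.le).1.trans_lt (hlt n hn'), ?_⟩
      exact (hlt (n + 1) hn).trans_le (hle (n + 2) hn).2
    obtain ⟨hf, m, hm, hmv⟩ := (hiff _ htI).2 ⟨n + 1, n.succ_pos, hn, rfl⟩
    -- Transversality excludes zero, and a negative value would lead into the interior of the
    -- obstacle.
    have hmv' : 0 < inner ℝ m (vel (γ (τ (n + 1)))) :=
      lt_of_le_of_ne (htr.inner_nonneg hO ⟨htI.1.le, htI.2⟩ hf hm) hmv.symm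
    obtain ⟨-, w, hw, hw2⟩ := htr _ (Ioo_subset_Icc_self htI)
    have h1 := IsTrajectory.foldVel_neg_eq hT.2.1 htI.2.le (hlt n hn') (hle n hn'.le).1
      (hu' n hn') hw2
    obtain ⟨m', hm', hv'⟩ := hw.1 hf
    rw [hm'.unique hO hf hm] at hv'
    have h2 := hv (n + 1) hn
    rw [hfv (n + 1) hn.le] at h1 h2
    rw [map_neg, neg_inj] at h1
    rw [hhop (n + 1) hn, hhop' n hn', hdir _ (sub_pos.2 (hlt _ hn)) _ _ (hu1 _ hn),
      hdir _ (sub_pos.2 (hlt _ hn')) _ _ (hu1 _ hn'), h1, h2]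
    have h3 : inner ℝ w m = -inner ℝ m (vel (γ (τ (n + 1)))) := by
      rw [hv', inner_sub_right, real_inner_smul_right, real_inner_self_eq_norm_sq, hm.1,
        real_inner_comm]
      ring
    -- The change of velocity is a positive multiple of the outer normal, which is the variational
    -- form of the reflection law.
    have h4 : vel (γ (τ (n + 1))) - w = (2 * inner ℝ m (vel (γ (τ (n + 1))))) • m := by
      conv_lhs => rw [hv', h3]
      rw [sub_sub_cancel_left, mul_neg, neg_smul, neg_neg]
    rw [h4, real_inner_smul_left, ← hpos (n + 1) hn.le]
    exact mul_nonpos_of_nonneg_of_nonpos (by linarith) (hm.2 q hq)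
  · have h1 : ∀ n ∈ Finset.range s, ‖hop (e n) (y n) (y (n + 1))‖ = τ (n + 1) - τ n := by
      intro n hn
      have hn := Finset.mem_range.1 hn
      rw [hhop n hn, norm_smul, LinearIsometryEquiv.norm_map, hu1 n hn, mul_one,
        Real.norm_of_nonneg (sub_pos.2 (hlt n hn)).le]
    rw [pathLength, Finset.sum_congr rfl h1, Finset.sum_range_sub, hτ0, hτs, sub_zero]
  · have h1 : ∀ n ∈ Finset.range s, disp z (y n) (hop (e n) (y n) (y (n + 1))) =
        φ (τ (n + 1)) - φ (τ n) := by
      intro n hn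
      have hn := Finset.mem_range.1 hn
      refine (IsLift.sub_eq_disp (hlt n hn) (avoids_of_notMem_interior hz (hav n hn))
        ((isAngle_iff.1 hφ).mono
        (Icc_subset_Icc (hle n hn.le).1 (hle (n + 1) hn).2)) fun t ht => ?_).symm
      rw [hseg n hn t ht, foldC]
    rw [pathDisp, Finset.sum_congr rfl h1, Finset.sum_range_sub fun n => φ (τ n), hτ0, hτs]

/-- The reflection times of an infinite trajectory of admissible type go to infinity. -/
lemma tendsto_reflection_times (hO : IsObstacle O) (hs : IsSmall O) {T : ℝ → Plane}
    (hT : ContinuousOn T (Ici 0)) {k : ℕ → Fin 2 → ℤ} (hk : ∀ n, k (n + 1) ≠ k n) {τ : ℕ → ℝ}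
    (hτ0 : 0 ≤ τ 0) (hmono : StrictMono τ) (hτk : ∀ n, T (τ n) ∈ frontier (obstacleCopy O (k n))) :
    Tendsto τ atTop atTop := by
  -- If the times stayed bounded they would converge, and so would the points of reflection by
  -- continuity of the unfolding; but consecutive ones are at least `1/4` apart.
  rcases tendsto_atTop_of_monotone hmono.monotone with h | ⟨l, hl⟩
  · exact h
  exfalso
  have hge : ∀ n, (0 : ℝ) ≤ τ n := fun n => hτ0.trans (hmono.monotone n.zero_le)
  have hl0 : l ∈ Ici (0 : ℝ) := ge_of_tendsto' hl hge
  have h1 : Tendsto (fun n => T (τ n)) atTop (𝓝 (T l)) :=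
    (hT l hl0).tendsto.comp (tendsto_nhdsWithin_iff.2 ⟨hl, Eventually.of_forall hge⟩)
  have h2 := ((h1.comp (tendsto_add_atTop_nat 1)).sub h1).norm
  rw [sub_self, norm_zero] at h2
  obtain ⟨n, hn⟩ := (h2.eventually_lt_const (show (0 : ℝ) < 1 / 4 by norm_num)).exists
  have hy : ∀ n, tab (k n) (T (τ n)) ∈ O := fun n =>
    hO.isCompact.isClosed.frontier_subset (mem_frontier_copy.1 (hτk n))
  have h3 := norm_hop_ge hs (a := relCell (k n) (k (n + 1)))
    (fun h0 => hk n (relCell_injective (k n) (by rw [h0, relCell_self]))) (hy n) (hy (n + 1))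
  rw [hop, (AffineIsometryEquiv.symm_apply_eq _).2 (tab_relCell (k n) (k (n + 1)) _).symm, tab_sub,
    LinearIsometryEquiv.norm_map] at h3
  simp only [Function.comp] at hn
  linarith

/-- An infinite trajectory of admissible type contains admissible pieces. -/
lemma HasAdmissibleType.exists_pieces (hO : IsObstacle O) (hs : IsSmall O)
    (h : HasAdmissibleType O γ) (htr : IsTrajectory O (Ici 0) γ) :
    ∃ τ : ℕ → ℝ, 0 ≤ τ 0 ∧ StrictMono τ ∧ Tendsto τ atTop atTop ∧
      ∀ s, 0 < s → IsAdmissiblePiece O (τ s - τ 0) (fun t => γ (τ 0 + t)) := by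
  obtain ⟨T, k, τ, hT, hk, hτ0, hmono, hτk, hiff⟩ := h
  refine ⟨τ, hτ0, hmono, tendsto_reflection_times hO hs hT.1 hk.2.1 hτ0 hmono hτk,
    fun s hs0 => ?_⟩
  have hpos : 0 < τ s - τ 0 := sub_pos.2 (hmono hs0)
  have hI : ∀ {t}, t ∈ Icc 0 (τ s - τ 0) → τ 0 + t ∈ Ici (0 : ℝ) := fun ht =>
    add_nonneg hτ0 ht.1
  have hadd : ∀ (J K : Set ℝ) (t : ℝ), MapsTo (fun s => τ 0 + s) J K →
      Tendsto (fun s => τ 0 + s) (𝓝[J] t) (𝓝[K] (τ 0 + t)) := fun J K t hm =>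
    tendsto_nhdsWithin_of_tendsto_nhds_of_eventually_within _
      ((Continuous.tendsto (by fun_prop) t).mono_left nhdsWithin_le_nhds)
      (by filter_upwards [self_mem_nhdsWithin] with s hs' using hm hs')
  have hmaps : MapsTo (fun t => τ 0 + t) (Icc 0 (τ s - τ 0)) (Ici 0) := fun t ht => hI ht
  refine ⟨hpos, fun t ht => ?_, fun t => T (τ 0 + t), s, k, fun n => τ n - τ 0,
    ⟨hT.1.comp (by fun_prop) hmaps, fun t ht => hT.2.1 _ (hI ht), fun t ht hp => ?_⟩, hk.upTo s,
    sub_self _, rfl, fun i _ j _ hij => sub_lt_sub_right (hmono hij) _, fun n _ => ?_,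
    fun t ht => ?_⟩
  · obtain ⟨h1, w, hw, h2⟩ := htr _ (hI ht)
    refine ⟨?_, w, hw, ?_⟩
    · filter_upwards [(hadd _ (Ici 0 ∩ Ici (τ 0 + t)) t fun x hx =>
        ⟨hmaps hx.1, add_le_add_right hx.2 (τ 0)⟩).eventually h1] with x hx
      rw [hx, add_sub_add_left_eq_sub]
    · filter_upwards [(hadd _ (Ici 0 ∩ Iic (τ 0 + t)) t fun x hx =>
        ⟨hmaps hx.1, add_le_add_right hx.2 (τ 0)⟩).eventually h2] with x hx
      rw [hx, add_sub_add_left_eq_sub]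
  · obtain ⟨u, hu⟩ := hT.2.2 _ (hI ht) hp
    refine ⟨u, ?_⟩
    filter_upwards [(hadd _ _ t hmaps).eventually hu] with x hx
    rw [hx, add_sub_add_left_eq_sub]
  · simp only
    rw [add_sub_cancel]; exact hτk n
  · have h1 := hiff (τ 0 + t) (hI (Ioo_subset_Icc_self ht))
    have h2 : τ 0 + t ≠ 0 := by linarith [ht.1]
    rw [or_iff_left (fun h => h2 h.1)] at h1
    rw [h1]
    constructor
    · rintro ⟨n, hn⟩
      refine ⟨n, Nat.pos_of_ne_zero fun h0 => ?_, hmono.lt_iff_lt.1 ?_, by linarith⟩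
      · rw [h0] at hn; linarith [ht.1]
      · linarith [ht.2]
    · rintro ⟨n, -, -, hn⟩
      exact ⟨n, by linarith⟩

/-- The rotation number of an infinite trajectory of admissible type is in the admissible rotation
set. -/
lemma mem_admissibleRotationSet (hO : IsObstacle O) (hs : IsSmall O) {z : Plane}
    (htr : IsTrajectory O (Ici 0) γ) (h : HasAdmissibleType O γ) {u : ℝ}
    (hu : HasRotationNumber z γ u) : u ∈ admissibleRotationSet O z := by
  obtain ⟨τ, hτ0, hmono, hτ, hp⟩ := h.exists_pieces hO hs htr
  obtain ⟨φ, hφ, hlim⟩ := hu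
  have hτ' := hτ.comp (tendsto_add_atTop_nat 1)
  have hL : Tendsto (fun n => τ (n + 1) - τ 0) atTop atTop :=
    tendsto_atTop_add_const_right _ _ hτ'
  refine ⟨fun n => τ (n + 1) - τ 0, fun _ t => γ (τ 0 + t), fun _ t => φ (τ 0 + t), fun n =>
    ⟨hp _ n.succ_pos, ?_⟩, hL, ?_⟩
  · rw [isAngle_iff] at hφ ⊢
    exact hφ.comp (u := fun t => τ 0 + t) (by fun_prop) fun t ht => add_nonneg hτ0 ht.1
  · have h1 : Tendsto (fun n => (φ (τ (n + 1)) - φ 0) / τ (n + 1)) atTop (𝓝 u) := hlim.comp hτ'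
    have h2 : Tendsto (fun n => 1 + τ 0 / (τ (n + 1) - τ 0)) atTop (𝓝 (1 + 0)) :=
      (hL.const_div_atTop _).const_add 1
    have h3 : Tendsto (fun n => (φ (τ 0) - φ 0) / (τ (n + 1) - τ 0)) atTop (𝓝 0) :=
      hL.const_div_atTop _
    have h4 := (h1.mul h2).sub h3
    rw [add_zero, mul_one, sub_zero] at h4
    refine h4.congr fun n => ?_
    have h5 : 0 < τ (n + 1) - τ 0 := sub_pos.2 (hmono n.succ_pos)
    have h6 : 0 < τ (n + 1) := by linarith
    simp only [add_sub_cancel, add_zero]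
    field_simp
    ring

end

end SquareBilliard

namespace SquareBilliard

/-! ### Paths and blocks -/

section
variable {O : Set Plane} {e e' : ℕ → Fin 2 → ℤ} {y y' : ℕ → Plane} {s : ℕ}

/-- A billiard path of admissible type, with the steps `e 0, …, e (s - 1)`, outside the
obstacles. -/
structure IsPath (O : Set Plane) (e : ℕ → Fin 2 → ℤ) (y : ℕ → Plane) (s : ℕ) : Prop where
  isStep : ∀ n < s, IsStep O (e n)
  isTurn : ∀ n, n + 1 < s → IsTurn O (e n) (e (n + 1))
  isChain : IsChain O e y s
  fold_notMem : ∀ n < s, ∀ t ∈ Icc (0 : ℝ) 1,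
    fold (y n + t • hop (e n) (y n) (y (n + 1))) ∉ interior O

lemma pathLength_congr (h : ∀ n < s, e n = e' n) : pathLength e y s = pathLength e' y s :=
  Finset.sum_congr rfl fun n hn => by rw [h n (Finset.mem_range.1 hn)]

lemma pathDisp_congr {z : Plane} (h : ∀ n < s, e n = e' n) :
    pathDisp z e y s = pathDisp z e' y s :=
  Finset.sum_congr rfl fun n hn => by rw [h n (Finset.mem_range.1 hn)]

lemma pathLength_add (e : ℕ → Fin 2 → ℤ) (y : ℕ → Plane) (m n : ℕ) :
    pathLength e y (m + n) = pathLength e y m +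
      pathLength (fun i => e (m + i)) (fun i => y (m + i)) n := Finset.sum_range_add _ _ _

lemma pathDisp_add (z : Plane) (e : ℕ → Fin 2 → ℤ) (y : ℕ → Plane) (m n : ℕ) :
    pathDisp z e y (m + n) = pathDisp z e y m +
      pathDisp z (fun i => e (m + i)) (fun i => y (m + i)) n := Finset.sum_range_add _ _ _

lemma IsPath.congr (h : IsPath O e y s) (he : ∀ n < s, e n = e' n) : IsPath O e' y s where
  isStep n hn := he n hn ▸ h.isStep n hn
  isTurn n hn := he n (by omega) ▸ he (n + 1) hn ▸ h.isTurn n hn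
  isChain := ⟨h.isChain.1, fun n hn => he n (by omega) ▸ he (n + 1) hn ▸ h.isChain.2 n hn⟩
  fold_notMem n hn := he n hn ▸ h.fold_notMem n hn

lemma IsPath.window (h : IsPath O e y s) {m n : ℕ} (hmn : m + n ≤ s) :
    IsPath O (fun i => e (m + i)) (fun i => y (m + i)) n where
  isStep i hi := h.isStep _ (by omega)
  isTurn i hi := h.isTurn (m + i) (by omega)
  isChain := ⟨fun i hi => h.isChain.1 _ (by omega), fun i hi => h.isChain.2 (m + i) (by omega)⟩
  fold_notMem i hi := h.fold_notMem (m + i) (by omega)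

lemma IsPath.avoids (h : IsPath O e y s) {z : Plane} (hz : z ∈ interior O) {n : ℕ} (hn : n < s) :
    Avoids z (y n) (hop (e n) (y n) (y (n + 1))) :=
  avoids_of_notMem_interior hz (h.fold_notMem n hn)

/-- The rigidity on which the combinatorial part rests: the finite word alone fixes displacement and
length up to constants, however the paths continue on either side. -/
lemma IsPath.abs_sub_le (hO : IsObstacle O) (hs : IsSmall O) {z : Plane} (hz : z ∈ interior O)
    (h : IsPath O e y s) (h' : IsPath O e' y' s) (he : ∀ n < s, e n = e' n) :
    |pathDisp z e y s - pathDisp z e' y' s| ≤ 10 ∧ |pathLength e y s - pathLength e' y' s| ≤ 2 := by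
  have h2 := h.congr he
  rw [pathDisp_congr he, pathLength_congr he]
  exact ⟨h2.isChain.abs_pathDisp_sub_le hO hs h2.isStep h2.isTurn hz h'.isChain
    (fun n hn => h2.avoids hz hn) (fun n hn => h'.avoids hz hn),
    h2.isChain.abs_pathLength_sub_le hs h'.isChain⟩

lemma IsPath.le_pathLength (hs : IsSmall O) (h : IsPath O e y s) : s / 4 ≤ pathLength e y s := by
  have h1 : ∑ n ∈ Finset.range s, (1 / 4 : ℝ) ≤ pathLength e y s := by
    refine Finset.sum_le_sum fun n hn => ?_
    have hn := Finset.mem_range.1 hn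
    exact norm_hop_ge hs (h.isStep n hn).1 (h.isChain.1 n hn.le) (h.isChain.1 (n + 1) hn)
  rw [Finset.sum_const, Finset.card_range, nsmul_eq_mul] at h1
  linarith

/-- Every hop has length at least `1/4`, so the additive `1` per hop is at most four times the
length. -/
lemma IsPath.abs_pathDisp_le {z : Plane} {C : ℝ} (hs : IsSmall O)
    (hC : ∀ x v : Plane, (∀ t ∈ Icc (0 : ℝ) 1, fold (x + t • v) ∉ interior O) →
      |disp z x v| ≤ C * ‖v‖ + 1) (h : IsPath O e y s) :
    |pathDisp z e y s| ≤ (C + 4) * pathLength e y s := by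
  have h1 : |pathDisp z e y s| ≤ ∑ n ∈ Finset.range s, (C * ‖hop (e n) (y n) (y (n + 1))‖ + 1) :=
    (Finset.abs_sum_le_sum_abs _ _).trans (Finset.sum_le_sum fun n hn =>
      hC _ _ (h.fold_notMem n (Finset.mem_range.1 hn)))
  have h2 := h.le_pathLength hs
  rw [Finset.sum_add_distrib, ← Finset.mul_sum, Finset.sum_const, Finset.card_range,
    nsmul_eq_mul] at h1
  change _ ≤ C * pathLength e y s + s * 1 at h1
  linarith

lemma IsInfChain.isPath (hO : IsObstacle O) (hs : IsSmall O) (he : IsWord O e)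
    (h : IsInfChain O e y) (s : ℕ) :
    IsPath O (fun i => e (i + 1)) (fun i => y (i + 1)) s where
  isStep _ _ := he.1 _
  isTurn _ _ := he.2 _
  isChain := ⟨fun _ _ => h.1 _, fun _ _ => h.2 _⟩
  fold_notMem n _ _ ht := h.fold_notMem_interior hO hs he n ht

/-! ### Reversing a path -/

lemma between_symm {i j k : Fin 2 → ℤ} (h : Between O i j k) : Between O k j i :=
  ⟨h.2.1, h.1, by rw [union_comm]; exact h.2.2⟩

lemma relCell_relCell_zero_zero (a : Fin 2 → ℤ) : relCell (relCell a 0) 0 = a := by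
  rw [relCell_relCell_zero, relCell_zero_left]

lemma IsStep.reverse {a : Fin 2 → ℤ} (h : IsStep O a) : IsStep O (relCell a 0) :=
  isStep_relCell.2 ⟨h.1.symm, fun j hj => h.2 j (between_symm hj)⟩

lemma IsTurn.reverse {a f : Fin 2 → ℤ} (h : IsTurn O a f) :
    IsTurn O (relCell f 0) (relCell a 0) := fun hb => by
  rw [relCell_relCell_zero_zero] at hb
  exact h (between_symm hb)

lemma neg_hop (f : Fin 2 → ℤ) (y w : Plane) :
    flip (relCell f 0) (hop (relCell f 0) w y) = -hop f y w := by
  rw [flip_hop, tab_relCell_zero, hop, neg_sub]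

/-- Reversal exchanges the incoming and outgoing directions and negates both, so their difference is
unchanged. -/
lemma IsBounce.reverse {a f : Fin 2 → ℤ} {x y w : Plane} (h : IsBounce O a x y f w) :
    IsBounce O (relCell f 0) w y (relCell a 0) x := fun q hq => by
  rw [neg_hop, ← flip_neg_hop, dir_neg, dir_neg, sub_neg_eq_add, neg_add_eq_sub]
  exact h q hq

lemma IsLift.neg_time {f : ℝ → ℂ} {θ : ℝ → ℝ} (h : IsLift f θ (Icc 0 1)) :
    IsLift (fun t => f (1 - t)) (fun t => θ (1 - t)) (Icc 0 1) :=
  h.comp (u := fun t : ℝ => 1 - t) (by fun_prop) fun t ht =>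
    ⟨by linarith [ht.2], by linarith [ht.1]⟩

lemma disp_reverse {z x v : Plane} (h : Avoids z x v) : disp z (x + v) (-v) = -disp z x v := by
  obtain ⟨θ, hθ⟩ := exists_isLift (convex_Icc (0 : ℝ) 1) (f := fun t : ℝ => foldC z (x + t • v))
    (by fun_prop) fun t ht h0 => h t ht (foldC_eq_zero.1 h0)
  have h1 : (fun t : ℝ => foldC z (x + v + t • -v)) = fun t : ℝ => foldC z (x + (1 - t) • v) := by
    ext t; congr 1; rw [sub_smul, one_smul, smul_neg]; abel
  have h2 : Avoids z (x + v) (-v) := fun t ht => by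
    have := h (1 - t) ⟨by linarith [ht.2], by linarith [ht.1]⟩
    rwa [sub_smul, one_smul, add_sub, sub_eq_add_neg (x + v), ← smul_neg] at this
  rw [← IsLift.disp_eq h2 (θ := fun t => θ (1 - t)) (by rw [h1]; exact hθ.neg_time), ← hθ.disp_eq h]
  simp

lemma disp_hop_reverse {a : Fin 2 → ℤ} {z x y : Plane} (h : Avoids z x (hop a x y)) :
    disp z y (hop (relCell a 0) y x) = -disp z x (hop a x y) := by
  rw [← disp_reverse h, add_hop, ← flip_neg_hop, ← map_neg, ← disp_tab a z ((tab a).symm y)]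
  simp

/-- The source of the symmetry of the rotation set: the inequalities defining bounces and the
relations defining admissible words are invariant under time reversal. -/
lemma IsPath.reverse {z : Plane} (hz : z ∈ interior O) (h : IsPath O e y s) :
    ∃ e' y', IsPath O e' y' s ∧ pathDisp z e' y' s = -pathDisp z e y s ∧
      pathLength e' y' s = pathLength e y s := by
  have hstep : ∀ n < s, s - n = s - 1 - n + 1 ∧ s - (n + 1) = s - 1 - n := fun n hn => by omega
  refine ⟨fun n => relCell (e (s - 1 - n)) 0, fun n => y (s - n), ⟨?_, ?_, ⟨?_, ?_⟩, ?_⟩, ?_, ?_⟩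
  · exact fun n hn => (h.isStep _ (by omega)).reverse
  · intro n hn
    have := (h.isTurn (s - 1 - (n + 1)) (by omega)).reverse
    rwa [show s - 1 - (n + 1) + 1 = s - 1 - n by omega] at this
  · exact fun n hn => h.isChain.1 _ (by omega)
  · intro n hn
    have := (h.isChain.2 (s - 1 - (n + 1)) (by omega)).reverse
    rwa [show s - 1 - (n + 1) + 1 = s - 1 - n by omega,
      show s - 1 - (n + 1) + 2 = s - n by omega,
      show y (s - 1 - (n + 1)) = y (s - (n + 2)) by congr 1; omega,
      show y (s - 1 - n) = y (s - (n + 1)) by congr 1; omega] at this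
  · intro n hn t ht
    rw [(hstep n hn).1, (hstep n hn).2, ← flip_neg_hop]
    have := h.fold_notMem (s - 1 - n) (by omega) (1 - t) ⟨by linarith [ht.2], by linarith [ht.1]⟩
    rwa [← fold_tab (e (s - 1 - n)), tab_add_smul_hop, sub_sub_cancel] at this
  · rw [pathDisp, pathDisp, ← Finset.sum_neg_distrib, ← Finset.sum_range_reflect]
    refine Finset.sum_congr rfl fun n hn => ?_
    have hn := Finset.mem_range.1 hn
    have hn' : s - 1 - n < s := by omega
    rw [(hstep _ hn').1, (hstep _ hn').2, show s - 1 - (s - 1 - n) = n by omega]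
    exact disp_hop_reverse (h.avoids hz hn)
  · rw [pathLength, pathLength, ← Finset.sum_range_reflect]
    refine Finset.sum_congr rfl fun n hn => ?_
    have hn := Finset.mem_range.1 hn
    have hn' : s - 1 - n < s := by omega
    rw [(hstep _ hn').1, (hstep _ hn').2, show s - 1 - (s - 1 - n) = n by omega, ← flip_neg_hop,
      norm_neg, LinearIsometryEquiv.norm_map]

/-! ### Blocks -/

/-- A nonempty admissible word that begins with a step up and ends with a horizontal step; such
words can be concatenated. -/
structure IsBlock (O : Set Plane) (w : List (Fin 2 → ℤ)) : Prop where
  head : w.head? = some stepUp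
  last : ∃ f, w.getLast? = some (stepBefore f)
  isStep : ∀ a ∈ w, IsStep O a
  isTurn : w.IsChain (IsTurn O)

/-- The periodic word with the period `w`. -/
def cyc (w : List (Fin 2 → ℤ)) (n : ℕ) : Fin 2 → ℤ := w.getD (n % w.length) 0

lemma cyc_periodic (w : List (Fin 2 → ℤ)) : Function.Periodic (cyc w) w.length := fun n => by
  simp [cyc]

lemma cyc_of_lt {w : List (Fin 2 → ℤ)} {n : ℕ} (h : n < w.length) : cyc w n = w[n] := by
  simp [cyc, Nat.mod_eq_of_lt h, h]

variable {w v : List (Fin 2 → ℤ)}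

/-- The first step is vertical and the last horizontal. The minimization behind periodic chains
needs a period of at least two. -/
lemma IsBlock.length_ge (h : IsBlock O w) : 2 ≤ w.length := by
  obtain ⟨h1, ⟨f, h2⟩, -, -⟩ := h
  match w with
  | [] => simp at h1
  | [a] =>
    simp only [List.head?_cons, List.getLast?_singleton, Option.some.injEq] at h1 h2
    rw [h1] at h2
    have := congrFun h2 1
    rcases stepBefore_cases f with h | h <;> rw [h] at this <;> simp [stepUp, stepRight] at this
  | a :: b :: l => simp

lemma IsBlock.append (hs : IsSmall O) (hw : IsBlock O w) (hv : IsBlock O v) :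
    IsBlock O (w ++ v) where
  head := by simp [List.head?_append, hw.head]
  last := by
    obtain ⟨f, hf⟩ := hv.last
    exact ⟨f, by simp [List.getLast?_append, hf]⟩
  isStep a ha := (List.mem_append.1 ha).elim (hw.isStep a) (hv.isStep a)
  isTurn := by
    rw [List.isChain_append]
    refine ⟨hw.isTurn, hv.isTurn, fun x hx y hy => ?_⟩
    obtain ⟨f, hf⟩ := hw.last
    rw [hf, Option.mem_some_iff] at hx
    rw [hv.head, Option.mem_some_iff] at hy
    rw [← hx, ← hy]
    exact isTurn_stepBefore_stepUp hs f

lemma IsBlock.isWord (hs : IsSmall O) (h : IsBlock O w) : IsWord O (cyc w) := by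
  have h2 := h.length_ge
  have hlt : ∀ n, n % w.length < w.length := fun n => Nat.mod_lt _ (by omega)
  have hc : ∀ n, cyc w n = w[n % w.length]'(hlt n) := fun n => by simp [cyc, hlt n]
  refine ⟨fun n => ?_, fun n => ?_⟩
  · rw [hc]; exact h.isStep _ (List.getElem_mem _)
  · by_cases hn : n % w.length + 1 < w.length
    · have h3 : cyc w (n + 1) = w[n % w.length + 1] := by
        rw [hc]; congr 1
        rw [Nat.add_mod, Nat.mod_eq_of_lt (show 1 < w.length by omega), Nat.mod_eq_of_lt hn]
      rw [hc, h3]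
      exact List.isChain_iff_getElem.1 h.isTurn _ hn
    · have h3 : n % w.length = w.length - 1 := by have := hlt n; omega
      have h4 : (n + 1) % w.length = 0 := by
        rw [Nat.add_mod, h3, Nat.mod_eq_of_lt (show 1 < w.length by omega),
          show w.length - 1 + 1 = w.length by omega, Nat.mod_self]
      obtain ⟨f, hf⟩ := h.last
      have h5 : cyc w n = stepBefore f := by
        rw [List.getLast?_eq_getElem?] at hf
        simp [cyc, h3, List.getD_eq_getElem?_getD, hf]
      have h6 : cyc w (n + 1) = stepUp := by
        have := h.head
        rw [List.head?_eq_getElem?] at this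
        simp [cyc, h4, List.getD_eq_getElem?_getD, this]
      rw [h5, h6]
      exact isTurn_stepBefore_stepUp hs f

open Classical in
/-- A periodic billiard orbit with the periodic word `w`. -/
noncomputable def orbit (O : Set Plane) (w : List (Fin 2 → ℤ)) : ℕ → Plane :=
  if h : ∃ y, Function.Periodic y w.length ∧ IsInfChain O (cyc w) y then h.choose else 0

lemma IsBlock.orbit_spec (hO : IsObstacle O) (hs : IsSmall O) (h : IsBlock O w) :
    Function.Periodic (orbit O w) w.length ∧ IsInfChain O (cyc w) (orbit O w) := by
  have hex : ∃ y, Function.Periodic y w.length ∧ IsInfChain O (cyc w) y := by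
    obtain ⟨y, hy, h1⟩ := exists_periodic_chain hO hs (fun n => ((h.isWord hs).1 n).1) h.length_ge
      (cyc_periodic w)
    exact ⟨y, hy, fun n => (h1 n).1 n le_rfl, fun n => (h1 (n + 2)).2 n (by omega)⟩
  rw [orbit, dif_pos hex]
  exact hex.choose_spec

lemma IsBlock.isPath (hO : IsObstacle O) (hs : IsSmall O) (h : IsBlock O w) (s : ℕ) :
    IsPath O (cyc w) (orbit O w) s := by
  obtain ⟨h1, h2⟩ := h.orbit_spec hO hs
  obtain ⟨m, hm⟩ := Nat.exists_eq_add_of_le' h.length_ge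
  -- Paths extracted from infinite chains begin at the vertex `1`. Starting one full period later
  -- reaches a vertex equal to the vertex `0` that has an incoming hop.
  have h3 := (h2.isPath hO hs (h.isWord hs) (w.length - 1 + s)).window (m := w.length - 1) le_rfl
  have h4 : (fun i => cyc w (w.length - 1 + i + 1)) = cyc w := funext fun i => by
    rw [show w.length - 1 + i + 1 = i + w.length by omega, cyc_periodic w i]
  have h5 : (fun i => orbit O w (w.length - 1 + i + 1)) = orbit O w := funext fun i => by
    rw [show w.length - 1 + i + 1 = i + w.length by omega, h1 i]
  rwa [h4, h5] at h3

/-- The displacement along one period of the periodic orbit of the block `w`. -/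
noncomputable def blockDisp (O : Set Plane) (z : Plane) (w : List (Fin 2 → ℤ)) : ℝ :=
  pathDisp z (cyc w) (orbit O w) w.length

/-- The length of one period of the periodic orbit of the block `w`. -/
noncomputable def blockLength (O : Set Plane) (w : List (Fin 2 → ℤ)) : ℝ :=
  pathLength (cyc w) (orbit O w) w.length

lemma IsBlock.blockLength_pos (hO : IsObstacle O) (hs : IsSmall O) (h : IsBlock O w) :
    0 < blockLength O w := by
  refine lt_of_lt_of_le ?_ ((h.isPath hO hs _).le_pathLength hs)
  have := h.length_ge
  have : 0 < w.length := by omega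
  positivity

lemma IsBlock.path_mul (hO : IsObstacle O) (hs : IsSmall O) (h : IsBlock O w) (z : Plane) (p : ℕ) :
    pathDisp z (cyc w) (orbit O w) (p * w.length) = p * blockDisp O z w ∧
      pathLength (cyc w) (orbit O w) (p * w.length) = p * blockLength O w := by
  have h1 := (h.orbit_spec hO hs).1
  induction p with
  | zero => simp [pathDisp, pathLength]
  | succ p ih =>
    have h4 : (fun i => cyc w (p * w.length + i)) = cyc w := funext fun i => by
      rw [add_comm]; exact (cyc_periodic w).nat_mul p i
    have h5 : (fun i => orbit O w (p * w.length + i)) = orbit O w := funext fun i => by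
      rw [add_comm]; exact h1.nat_mul p i
    rw [add_mul, one_mul, pathDisp_add, pathLength_add, ih.1, ih.2, h4, h5]
    push_cast
    constructor
    · rw [add_mul, one_mul]; rfl
    · rw [add_mul, one_mul]; rfl

/-- A path that runs `p` times through the block `w`. -/
lemma IsBlock.abs_sub_le (hO : IsObstacle O) (hs : IsSmall O) (h : IsBlock O w) {z : Plane}
    (hz : z ∈ interior O) (hy : IsPath O e y s) {p : ℕ} (hsp : s = p * w.length)
    (he : ∀ n < s, e n = cyc w n) :
    |pathDisp z e y s - p * blockDisp O z w| ≤ 10 ∧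
      |pathLength e y s - p * blockLength O w| ≤ 2 := by
  rw [← (h.path_mul hO hs z p).1, ← (h.path_mul hO hs z p).2, ← hsp]
  exact hy.abs_sub_le hO hs hz (h.isPath hO hs _) he

/-- The periodic orbit of the concatenation splits into a path with the word `w` and one with the
word `v`; each is compared with the corresponding periodic orbit, and the errors add. -/
lemma IsBlock.append_abs_sub_le (hO : IsObstacle O) (hs : IsSmall O) (hw : IsBlock O w)
    (hv : IsBlock O v) {z : Plane} (hz : z ∈ interior O) :
    |blockDisp O z (w ++ v) - (blockDisp O z w + blockDisp O z v)| ≤ 20 ∧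
      |blockLength O (w ++ v) - (blockLength O w + blockLength O v)| ≤ 4 := by
  have h := (hw.append hs hv).isPath hO hs (w ++ v).length
  have hl : (w ++ v).length = w.length + v.length := List.length_append
  have h1 := hw.abs_sub_le hO hs hz (h.window (m := 0) (n := w.length) (by omega)) (p := 1)
    (one_mul _).symm fun n hn => by
      rw [zero_add, cyc_of_lt (by omega), cyc_of_lt hn, List.getElem_append_left]
  have h2 := hv.abs_sub_le hO hs hz (h.window (m := w.length) (n := v.length) (by omega)) (p := 1)
    (one_mul _).symm fun n hn => by
      rw [cyc_of_lt (by omega), cyc_of_lt hn, List.getElem_append_right (by omega)]; simp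
  simp only [zero_add, Nat.cast_one, one_mul] at h1 h2
  rw [blockDisp, blockLength, hl, pathDisp_add, pathLength_add]
  have a1 := abs_le.1 h1.1
  have a2 := abs_le.1 h2.1
  have a3 := abs_le.1 h1.2
  have a4 := abs_le.1 h2.2
  constructor <;> rw [abs_le] <;> constructor <;> linarith

/-- The concatenation of `p` copies of `w`. -/
def blockPow (w : List (Fin 2 → ℤ)) (p : ℕ) : List (Fin 2 → ℤ) := (List.replicate p w).flatten

lemma blockPow_succ (w : List (Fin 2 → ℤ)) (p : ℕ) : blockPow w (p + 1) = w ++ blockPow w p := by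
  simp [blockPow, List.replicate_succ]

lemma IsBlock.pow (hs : IsSmall O) (h : IsBlock O w) (p : ℕ) : IsBlock O (blockPow w (p + 1)) := by
  induction p with
  | zero => rw [blockPow_succ]; simpa [blockPow] using h
  | succ p ih => rw [blockPow_succ]; exact h.append hs ih

lemma length_blockPow (w : List (Fin 2 → ℤ)) (p : ℕ) : (blockPow w p).length = p * w.length := by
  simp [blockPow]

lemma getElem_blockPow (w : List (Fin 2 → ℤ)) (p n : ℕ) (h : n < (blockPow w p).length) :
    (blockPow w p)[n] = cyc w n := by
  induction p generalizing n with
  | zero => simp [blockPow] at h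
  | succ p ih =>
    by_cases hn : n < w.length
    · simp only [blockPow_succ, List.getElem_append_left hn, cyc_of_lt hn]
    · simp only [blockPow_succ, List.getElem_append_right (not_lt.1 hn)]
      rw [ih]
      conv_rhs => rw [show n = n - w.length + w.length by omega, cyc_periodic w]

/-- All repetitions are compared at once with one path of the same word, so the error does not grow
with `p`. -/
lemma IsBlock.pow_abs_sub_le (hO : IsObstacle O) (hs : IsSmall O) (h : IsBlock O w) {z : Plane}
    (hz : z ∈ interior O) (p : ℕ) :
    |blockDisp O z (blockPow w (p + 1)) - ((p + 1 : ℕ) : ℝ) * blockDisp O z w| ≤ 10 ∧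
      |blockLength O (blockPow w (p + 1)) - ((p + 1 : ℕ) : ℝ) * blockLength O w| ≤ 2 :=
  h.abs_sub_le hO hs hz ((h.pow hs p).isPath hO hs _) (length_blockPow w _) fun n hn => by
    rw [cyc_of_lt hn, getElem_blockPow]

lemma norm_center_stepUp : ‖center stepUp‖ ≤ 1 := by
  rw [← sq_le_one_iff₀ (norm_nonneg _), norm_sq_plane]; simp [stepUp]

lemma norm_center_stepBefore (f : Fin 2 → ℤ) : ‖center (stepBefore f)‖ ≤ 1 := by
  rw [← sq_le_one_iff₀ (norm_nonneg _), norm_sq_plane]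
  rcases stepBefore_cases f with h | h <;> rw [h] <;> simp [stepRight]

/-- Prepend a step up and a horizontal step that fits the first step, and append a horizontal step
that fits the last one. The three unit hops have length at most `2` and displacement at most `2C +
1` each; rigidity adds `10` and `2`. -/
lemma IsPath.exists_block (hO : IsObstacle O) (hs : IsSmall O) {z : Plane} (hz : z ∈ interior O)
    {C : ℝ} (hC0 : 0 < C)
    (hC : ∀ x v : Plane, (∀ t ∈ Icc (0 : ℝ) 1, fold (x + t • v) ∉ interior O) →
      |disp z x v| ≤ C * ‖v‖ + 1) (h : IsPath O e y s) (hs0 : 0 < s) :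
    ∃ w, IsBlock O w ∧ |blockDisp O z w - pathDisp z e y s| ≤ 6 * C + 13 ∧
      |blockLength O w - pathLength e y s| ≤ 8 := by
  obtain ⟨t, rfl⟩ := Nat.exists_eq_add_of_le' hs0
  set l : List (Fin 2 → ℤ) := (List.range (t + 1)).map e with hl
  have hhead : l.head? = some (e 0) := by simp [hl, List.range_succ_eq_map]
  have hlast : l.getLast? = some (e t) := by simp [hl, List.range_succ]
  have hstep : ∀ a ∈ l, IsStep O a := fun a ha => by
    obtain ⟨n, hn, rfl⟩ := List.mem_map.1 ha
    exact h.isStep n (List.mem_range.1 hn)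
  have hturn : l.IsChain (IsTurn O) := by
    rw [List.isChain_iff_getElem]
    intro i hi
    have hi' : i + 1 < t + 1 := by simpa [hl] using hi
    simpa [hl] using h.isTurn i hi'
  set w : List (Fin 2 → ℤ) := stepUp :: stepBefore (e 0) :: (l ++ [stepAfter (e t)]) with hw
  have hne : ∀ n < t + 1, e n ≠ 0 := fun n hn => (h.isStep n hn).1
  have hwb : IsBlock O w := by
    refine ⟨rfl, ⟨relCell (e t) 0, ?_⟩, fun a ha => ?_, ?_⟩
    · simp [hw, stepAfter, List.getLast?_cons]
    · simp only [hw, List.mem_cons, List.mem_append, List.not_mem_nil, or_false] at ha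
      rcases ha with rfl | rfl | ha | rfl
      · exact isStep_stepUp hs
      · exact isStep_stepBefore hs _
      · exact hstep a ha
      · exact isStep_stepBefore hs _
    · rw [hw, List.isChain_cons_cons, List.isChain_cons, List.isChain_append]
      refine ⟨isTurn_stepUp_stepBefore hs _, fun y hy => ?_, hturn, by simp, fun x hx y hy => ?_⟩
      · rw [List.head?_append, hhead] at hy
        simp only [Option.some_or, Option.mem_some_iff] at hy
        rw [← hy]; exact isTurn_stepBefore hs (hne 0 (by omega))
      · rw [hlast, Option.mem_some_iff] at hx
        simp only [List.head?_cons, Option.mem_some_iff] at hy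
        rw [← hx, ← hy]; exact isTurn_stepAfter hs (hne t (by omega))
  have hlen : l.length = t + 1 := by simp [hl]
  have hwl : w.length = 2 + ((t + 1) + 1) := by simp [hw, hlen]; omega
  have hp := hwb.isPath hO hs w.length
  have hc0 : cyc w 0 = stepUp := by rw [cyc_of_lt (by omega)]; rfl
  have hc1 : cyc w 1 = stepBefore (e 0) := by rw [cyc_of_lt (by omega)]; rfl
  have hcm : ∀ n < t + 1, cyc w (2 + n) = e n := fun n hn => by
    rw [cyc_of_lt (by omega)]
    simp only [hw, show 2 + n = n + 1 + 1 by omega, List.getElem_cons_succ]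
    rw [List.getElem_append_left (by omega)]
    simp [hl]
  have hce : cyc w (2 + (t + 1)) = stepAfter (e t) := by
    rw [cyc_of_lt (by omega)]
    simp only [hw, show 2 + (t + 1) = (t + 1) + 1 + 1 by omega, List.getElem_cons_succ]
    rw [List.getElem_append_right (by omega)]
    simp [hlen]
  have key := h.abs_sub_le hO hs hz (hp.window (m := 2) (n := t + 1) (by omega))
    fun n hn => (hcm n hn).symm
  have hunit : ∀ n < w.length, ‖center (cyc w n)‖ ≤ 1 →
      ‖hop (cyc w n) (orbit O w n) (orbit O w (n + 1))‖ ≤ 2 ∧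
      |disp z (orbit O w n) (hop (cyc w n) (orbit O w n) (orbit O w (n + 1)))| ≤ 2 * C + 1 := by
    intro n hn h1
    have h2 := norm_hop_le hs (a := cyc w n) (hp.isChain.1 n hn.le) (hp.isChain.1 (n + 1) hn)
    have h3 : ‖hop (cyc w n) (orbit O w n) (orbit O w (n + 1))‖ ≤ 2 := by linarith
    refine ⟨h3, (hC _ _ (hp.fold_notMem n hn)).trans ?_⟩
    nlinarith
  have u0 := hunit 0 (by omega) (by rw [hc0]; exact norm_center_stepUp)
  have u1 := hunit 1 (by omega) (by rw [hc1]; exact norm_center_stepBefore _)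
  have u2 := hunit (2 + (t + 1)) (by omega) (by rw [hce]; exact norm_center_stepBefore _)
  refine ⟨w, hwb, ?_, ?_⟩
  · rw [blockDisp, hwl, pathDisp_add, pathDisp, Finset.sum_range_succ, Finset.sum_range_one]
    rw [pathDisp, Finset.sum_range_succ]
    have k1 := abs_le.1 key.1
    have k2 := abs_le.1 u0.2
    have k3 := abs_le.1 u1.2
    have k4 := abs_le.1 u2.2
    simp only [pathDisp] at k1 ⊢
    simp only [← add_assoc, zero_add] at k1 k2 k3 k4 ⊢
    rw [abs_le]; constructor <;> linarith
  · rw [blockLength, hwl, pathLength_add, pathLength, Finset.sum_range_succ, Finset.sum_range_one]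
    rw [pathLength, Finset.sum_range_succ]
    have k1 := abs_le.1 key.2
    have k2 := u0.1
    have k3 := u1.1
    have k4 := u2.1
    have n2 := norm_nonneg (hop (cyc w 0) (orbit O w 0) (orbit O w 1))
    have n3 := norm_nonneg (hop (cyc w 1) (orbit O w 1) (orbit O w 2))
    have n4 := norm_nonneg (hop (cyc w (2 + (t + 1))) (orbit O w (2 + (t + 1)))
      (orbit O w (2 + (t + 1) + 1)))
    simp only [pathLength] at k1 ⊢
    simp only [← add_assoc, zero_add] at k1 k2 k3 k4 n4 ⊢
    rw [abs_le]; constructor <;> linarith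

end

end SquareBilliard

namespace SquareBilliard

/-! ### The admissible rotation set -/

section
variable {O : Set Plane} {z : Plane}

lemma mem_admissibleRotationSet_iff {r : ℝ} : r ∈ admissibleRotationSet O z ↔
    ∀ ε > 0, ∀ M : ℝ, ∃ (L : ℝ) (γ : ℝ → State O) (φ : ℝ → ℝ), IsAdmissiblePiece O L γ ∧
      IsAngle z (Icc 0 L) γ φ ∧ M < L ∧ |(φ L - φ 0) / L - r| < ε := by
  constructor
  · rintro ⟨L, γ, φ, h, hL, hr⟩ ε hε M
    obtain ⟨n, h1, h2⟩ := ((hL.eventually_gt_atTop M).and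
      (Metric.tendsto_nhds.1 hr ε hε)).exists
    exact ⟨L n, γ n, φ n, (h n).1, (h n).2, h1, h2⟩
  · intro h
    choose L γ φ h1 h2 h3 h4 using fun n : ℕ => h (1 / (n + 1)) (by positivity) n
    refine ⟨L, γ, φ, fun n => ⟨h1 n, h2 n⟩,
      tendsto_atTop_mono (fun n => (h3 n).le) tendsto_natCast_atTop_atTop, ?_⟩
    rw [tendsto_iff_dist_tendsto_zero]
    exact squeeze_zero (fun _ => dist_nonneg) (fun n => (h4 n).le)
      tendsto_one_div_add_atTop_nhds_zero_nat

lemma isClosed_admissibleRotationSet : IsClosed (admissibleRotationSet O z) := by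
  refine isClosed_of_closure_subset fun r hr => mem_admissibleRotationSet_iff.2 fun ε hε M => ?_
  obtain ⟨r', hr', hd⟩ := Metric.mem_closure_iff.1 hr (ε / 2) (half_pos hε)
  obtain ⟨L, γ, φ, h1, h2, h3, h4⟩ :=
    mem_admissibleRotationSet_iff.1 hr' (ε / 2) (half_pos hε) M
  refine ⟨L, γ, φ, h1, h2, h3, ?_⟩
  rw [dist_comm, Real.dist_eq] at hd
  calc |(φ L - φ 0) / L - r| = |((φ L - φ 0) / L - r') + (r' - r)| := by congr 1; ring
    _ ≤ _ := abs_add_le _ _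
    _ < ε := by linarith

/-- The rotation numbers of the periodic orbits of blocks. -/
def blockRotationNumbers (O : Set Plane) (z : Plane) : Set ℝ :=
  {r | ∃ w, IsBlock O w ∧ r = blockDisp O z w / blockLength O w}

variable (hO : IsObstacle O) (hs : IsSmall O) (hz : z ∈ interior O)
include hO hs hz

lemma blockRotationNumbers_subset : blockRotationNumbers O z ⊆ periodicRotationNumbers O z := by
  rintro r ⟨w, hw, rfl⟩
  have h := hw.orbit_spec hO hs
  exact mem_periodicRotationNumbers hO hs (hw.isWord hs) h.2 hz
    (by have := hw.length_ge; omega) (cyc_periodic w) h.1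

omit hz in
lemma periodicRotationNumbers_subset :
    periodicRotationNumbers O z ⊆ admissibleRotationSet O z := by
  rintro r ⟨γ, h1, -, h2, h3⟩
  exact mem_admissibleRotationSet hO hs h1 h2 h3

/-- The limits of displacement divided by length, for long paths of admissible type, are limits of
rotation numbers of blocks. -/
lemma mem_closure_of_paths {e : ℕ → ℕ → Fin 2 → ℤ} {y : ℕ → ℕ → Plane} {s : ℕ → ℕ} {r : ℝ}
    (h : ∀ n, IsPath O (e n) (y n) (s n)) (hs0 : ∀ n, 0 < s n)
    (hL : Tendsto (fun n => pathLength (e n) (y n) (s n)) atTop atTop)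
    (hr : Tendsto (fun n => pathDisp z (e n) (y n) (s n) / pathLength (e n) (y n) (s n)) atTop
      (𝓝 r)) : r ∈ closure (blockRotationNumbers O z) := by
  obtain ⟨C, hC0, hC⟩ := exists_abs_disp_le hz
  choose w hw hd hl using fun n => (h n).exists_block hO hs hz hC0 hC (hs0 n)
  have hpos : ∀ n, 0 < pathLength (e n) (y n) (s n) := fun n =>
    lt_of_lt_of_le (by have := hs0 n; positivity) ((h n).le_pathLength hs)
  -- Bounded errors disappear after division by lengths that tend to infinity.
  have key : ∀ (a b : ℕ → ℝ) (c c' : ℝ), (∀ n, |a n - b n| ≤ c) →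
      Tendsto (fun n => b n / pathLength (e n) (y n) (s n)) atTop (𝓝 c') →
      Tendsto (fun n => a n / pathLength (e n) (y n) (s n)) atTop (𝓝 c') := by
    intro a b c c' hab hb
    have h1 : Tendsto (fun n => (a n - b n) / pathLength (e n) (y n) (s n)) atTop (𝓝 0) := by
      refine squeeze_zero_norm (a := fun n => c / pathLength (e n) (y n) (s n)) (fun n => ?_)
        (hL.const_div_atTop c)
      rw [Real.norm_eq_abs, abs_div, abs_of_pos (hpos n)]
      exact div_le_div_of_nonneg_right (hab n) (hpos n).le
    have h2 := h1.add hb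
    rw [zero_add] at h2
    refine h2.congr fun n => ?_
    rw [← add_div, sub_add_cancel]
  have h1 := key _ _ _ _ hd hr
  have h2 := key _ _ _ 1 hl (tendsto_const_nhds.congr fun n => (div_self (hpos n).ne').symm)
  have h3 := h1.div h2 one_ne_zero
  rw [div_one] at h3
  refine mem_closure_of_tendsto h3 (Eventually.of_forall fun n => ⟨w n, hw n, ?_⟩)
  simp only [Pi.div_apply]
  rw [div_div_div_cancel_right₀ (hpos n).ne']

lemma admissibleRotationSet_subset :
    admissibleRotationSet O z ⊆ closure (blockRotationNumbers O z) := by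
  rintro r ⟨L, γ, φ, h, hL, hr⟩
  choose e y s hs0 h1 h2 h3 h4 h5 h6 using fun n => (h n).1.exists_chain hO hs hz (h n).2
  refine mem_closure_of_paths hO hs hz (fun n => ⟨h1 n, h2 n, h3 n, h4 n⟩) hs0 ?_ ?_
  · simpa only [h5] using hL
  · simpa only [h5, h6] using hr

/-- Block orbits are periodic orbits of admissible type, whose rotation numbers are in the rotation
set; long admissible pieces are approximated by blocks; and the rotation set is closed. -/
lemma admissibleRotationSet_eq :
    admissibleRotationSet O z = closure (blockRotationNumbers O z) :=
  (admissibleRotationSet_subset hO hs hz).antisymm (isClosed_admissibleRotationSet.closure_subset_iff.2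
    ((blockRotationNumbers_subset hO hs hz).trans (periodicRotationNumbers_subset hO hs)))

/-- Reverse more and more periods of the orbit of a block. The reversed word need not be a block,
but `mem_closure_of_paths` accepts arbitrary long admissible paths. -/
lemma neg_mem_admissibleRotationSet {r : ℝ} (hr : r ∈ admissibleRotationSet O z) :
    -r ∈ admissibleRotationSet O z := by
  rw [admissibleRotationSet_eq hO hs hz] at hr ⊢
  refine map_mem_closure continuous_neg hr ?_ |> fun h => by rwa [closure_closure] at h
  rintro r ⟨w, hw, rfl⟩
  have hl := hw.length_ge
  have hm := fun n : ℕ => hw.path_mul hO hs z (n + 1)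
  have hlp := hw.blockLength_pos hO hs
  choose e y h1 h2 h3 using fun n : ℕ =>
    (hw.isPath hO hs ((n + 1) * w.length)).reverse hz
  refine mem_closure_of_paths hO hs hz h1 (fun n => by positivity) ?_ ?_
  · simp only [h3, (hm _).2]
    exact ((tendsto_natCast_atTop_atTop (R := ℝ)).comp (tendsto_add_atTop_nat 1)).atTop_mul_const hlp
  · simp only [h2, h3, (hm _).1, (hm _).2]
    refine tendsto_const_nhds.congr fun n => ?_
    rw [neg_div, mul_div_mul_left _ _ (by positivity)]

/-- Concatenate about `a n` divided by the length of `w` copies of `w` with about `b n` divided by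
the length of `v` copies of `v`. The result has length `n` and displacement `n` times the convex
combination, up to bounded errors. One extra copy of each keeps both factors nonempty. -/
lemma convex_admissibleRotationSet : Convex ℝ (admissibleRotationSet O z) := by
  rw [admissibleRotationSet_eq hO hs hz]
  intro r₁ hr₁ r₂ hr₂ a b ha hb hab
  have hcont : Continuous (Function.uncurry fun x y : ℝ => a • x + b • y) := by
    unfold Function.uncurry; fun_prop
  refine map_mem_closure₂ hcont hr₁ hr₂ ?_ |> fun h => by rwa [closure_closure] at h
  rintro r₁ ⟨w, hw, rfl⟩ r₂ ⟨v, hv, rfl⟩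
  have hwp := hw.blockLength_pos hO hs
  have hvp := hv.blockLength_pos hO hs
  -- run through the blocks in the right proportion
  set p : ℕ → ℕ := fun n => ⌊a / blockLength O w * n⌋₊ with hp
  set q : ℕ → ℕ := fun n => ⌊b / blockLength O v * n⌋₊ with hq
  have hpl : Tendsto (fun n : ℕ => ((p n + 1 : ℕ) : ℝ) / n) atTop (𝓝 (a / blockLength O w)) := by
    have h1 := (tendsto_nat_floor_mul_div_atTop (div_nonneg ha hwp.le)).comp
      (tendsto_natCast_atTop_atTop (R := ℝ))
    have h2 := h1.add (tendsto_one_div_atTop_nhds_zero_nat (𝕜 := ℝ))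
    rw [add_zero] at h2
    refine h2.congr fun n => ?_
    simp only [Function.comp, hp]
    push_cast
    rw [add_div]
  have hql : Tendsto (fun n : ℕ => ((q n + 1 : ℕ) : ℝ) / n) atTop (𝓝 (b / blockLength O v)) := by
    have h1 := (tendsto_nat_floor_mul_div_atTop (div_nonneg hb hvp.le)).comp
      (tendsto_natCast_atTop_atTop (R := ℝ))
    have h2 := h1.add (tendsto_one_div_atTop_nhds_zero_nat (𝕜 := ℝ))
    rw [add_zero] at h2
    refine h2.congr fun n => ?_
    simp only [Function.comp, hq]
    push_cast
    rw [add_div]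
  set W : ℕ → List (Fin 2 → ℤ) := fun n => blockPow w (p n + 1) ++ blockPow v (q n + 1) with hW
  have hWb : ∀ n, IsBlock O (W n) := fun n => (hw.pow hs _).append hs (hv.pow hs _)
  have hlim : ∀ (x : ℕ → ℝ) (c s t : ℝ),
      (∀ n, |x n - (((p n + 1 : ℕ) : ℝ) * s + ((q n + 1 : ℕ) : ℝ) * t)| ≤ c) →
      Tendsto (fun n : ℕ => x n / n) atTop
        (𝓝 (a / blockLength O w * s + b / blockLength O v * t)) := by
    intro x c s t hx
    have h1 : Tendsto (fun n : ℕ => (x n - (((p n + 1 : ℕ) : ℝ) * s + ((q n + 1 : ℕ) : ℝ) * t)) / n)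
        atTop (𝓝 0) := by
      refine squeeze_zero_norm (a := fun n : ℕ => c / n) (fun n => ?_)
        (tendsto_const_div_atTop_nhds_zero_nat c)
      rw [Real.norm_eq_abs, abs_div, abs_of_nonneg (n.cast_nonneg (α := ℝ))]
      exact div_le_div_of_nonneg_right (hx n) (n.cast_nonneg (α := ℝ))
    have h2 := ((hpl.mul_const s).add (hql.mul_const t)).add h1
    rw [add_zero] at h2
    refine h2.congr fun n => ?_
    ring
  have hB : ∀ n, |blockDisp O z (W n) - (((p n + 1 : ℕ) : ℝ) * blockDisp O z w +
        ((q n + 1 : ℕ) : ℝ) * blockDisp O z v)| ≤ 40 ∧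
      |blockLength O (W n) - (((p n + 1 : ℕ) : ℝ) * blockLength O w +
        ((q n + 1 : ℕ) : ℝ) * blockLength O v)| ≤ 8 := by
    intro n
    have h1 := (hw.pow hs (p n)).append_abs_sub_le hO hs (hv.pow hs (q n)) hz
    have h2 := hw.pow_abs_sub_le hO hs hz (p n)
    have h3 := hv.pow_abs_sub_le hO hs hz (q n)
    simp only [abs_le] at h1 h2 h3 ⊢
    refine ⟨⟨?_, ?_⟩, ?_, ?_⟩ <;> linarith [h1.1.1, h1.1.2, h1.2.1, h1.2.2, h2.1.1, h2.1.2, h2.2.1,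
      h2.2.2, h3.1.1, h3.1.2, h3.2.1, h3.2.2]
  have h1 := hlim _ _ _ _ fun n => (hB n).1
  have h2 := hlim _ _ _ _ fun n => (hB n).2
  rw [div_mul_cancel₀ _ hwp.ne', div_mul_cancel₀ _ hvp.ne', hab] at h2
  have h3 := h1.div h2 one_ne_zero
  rw [div_one] at h3
  have h4 : a • (blockDisp O z w / blockLength O w) + b • (blockDisp O z v / blockLength O v) =
      a / blockLength O w * blockDisp O z w + b / blockLength O v * blockDisp O z v := by
    simp only [smul_eq_mul]; ring
  rw [h4]
  refine mem_closure_of_tendsto h3 ?_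
  filter_upwards [eventually_gt_atTop 0] with n hn
  refine ⟨W n, hWb n, ?_⟩
  simp only [Pi.div_apply]
  rw [div_div_div_cancel_right₀ (by positivity)]

omit hO hz in
lemma isBlock_stepUp_stepRight : IsBlock O [stepUp, stepRight] where
  head := rfl
  last := ⟨0, by simp [stepBefore]⟩
  isStep a ha := by
    simp only [List.mem_cons, List.not_mem_nil, or_false] at ha
    rcases ha with rfl | rfl
    exacts [isStep_stepUp hs, isStep_stepRight hs]
  isTurn := by
    have := isTurn_stepUp_stepBefore hs 0
    simpa [stepBefore] using this

/-- A nonempty, closed, bounded, convex set of reals that is symmetric about zero; `a` is its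
maximum. -/
lemma exists_admissibleRotationSet_eq_Icc :
    ∃ a : ℝ, 0 ≤ a ∧ admissibleRotationSet O z = Icc (-a) a := by
  have hne : (admissibleRotationSet O z).Nonempty := by
    rw [admissibleRotationSet_eq hO hs hz]
    exact ⟨_, subset_closure ⟨_, isBlock_stepUp_stepRight hs, rfl⟩⟩
  obtain ⟨C, hC0, hC⟩ := exists_abs_disp_le hz
  have hbd : BddAbove (admissibleRotationSet O z) := by
    rw [admissibleRotationSet_eq hO hs hz]
    refine BddAbove.closure ⟨C + 4, ?_⟩
    rintro r ⟨w, hw, rfl⟩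
    rw [div_le_iff₀ (hw.blockLength_pos hO hs)]
    exact (le_abs_self _).trans ((hw.isPath hO hs _).abs_pathDisp_le hs hC)
  have hmem := isClosed_admissibleRotationSet.csSup_mem hne hbd
  set a := sSup (admissibleRotationSet O z)
  have hle : ∀ r ∈ admissibleRotationSet O z, r ≤ a := fun r hr => le_csSup hbd hr
  have hneg := fun r hr => neg_mem_admissibleRotationSet hO hs hz (r := r) hr
  have ha := hle _ (hneg a hmem)
  refine ⟨a, by linarith, Subset.antisymm (fun r hr => ⟨?_, hle r hr⟩) ?_⟩
  · linarith [hle _ (hneg r hr)]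
  · exact (convex_admissibleRotationSet hO hs hz).ordConnected.out (hneg a hmem) hmem

end

end SquareBilliard

namespace SquareBilliard

/-! ### Uniqueness of trajectories -/

section
variable {O : Set Plane}

lemma abs_lt_of_mem_frontier (hO : IsObstacle O) (hs : IsSmall O) {x : Plane} (hx : x ∈ frontier O)
    (i : Fin 2) : |x i| < 1 / 2 := by
  have := abs_sub_lt_of_mem_copy hs (k := 0) (x := x)
    (by rw [copy_zero]; exact hO.isCompact.isClosed.frontier_subset hx) i
  simpa using this

open Classical in
/-- The part of the state `(x, v)` that does not change at a collision. -/
noncomputable def collisionInvariant (O : Set Plane) (x v : Plane) :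
    Plane × (Fin 2 → ℝ) × (Plane → Plane × ℝ) :=
  (x, fun i => if x ∈ frontier O then 0 else if |x i| = 1 / 2 then |v i| else v i,
    fun n => if x ∈ frontier O ∧ IsOuterNormal O x n then
      (v - inner ℝ n v • n, |inner ℝ n v|) else 0)

/-- Gluing changes the sign of the normal component at the obstacle, or of one coordinate at a side,
and nothing else. The obstacle does not reach the sides, so the two cases never mix. -/
lemma Glued.collisionInvariant_eq (hO : IsObstacle O) (hs : IsSmall O) {p q : State O}
    (h : Glued O p q) :
    collisionInvariant O (pos p) (vel p) = collisionInvariant O (pos q) (vel q) := by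
  obtain ⟨hpos, h⟩ := h
  rw [← hpos]
  unfold collisionInvariant
  rcases h with ⟨hf, m, hm, hv⟩ | ⟨i, hi, hv⟩
  · refine Prod.ext rfl (Prod.ext ?_ ?_)
    · ext i; simp only [if_pos hf]
    · ext1 n
      simp only
      split_ifs with hn
      · have h1 := hn.2.unique hO hf hm
        have h2 : inner ℝ n (vel q) = -inner ℝ n (vel p) := by
          rw [hv, inner_sub_right, real_inner_smul_right, ← h1, real_inner_self_eq_norm_sq, hn.2.1,
            real_inner_comm]
          ring
        rw [h2, abs_neg]
        refine Prod.ext ?_ rfl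
        simp only
        rw [hv, ← h1, real_inner_comm n (vel p), neg_smul, two_mul, add_smul]
        abel
      · rfl
  · have hf : pos p ∉ frontier O := fun hf => (abs_lt_of_mem_frontier hO hs hf i).ne hi
    refine Prod.ext rfl (Prod.ext ?_ ?_)
    · ext j
      simp only [if_neg hf, hv j]
      by_cases hj : j = i
      · rw [if_pos hj, hj, if_pos hi, if_pos hi, abs_neg]
      · rw [if_neg hj]
    · ext1 n
      simp only [hf, false_and, if_false]

lemma collisionInvariant_eq_of_mk_eq (hO : IsObstacle O) (hs : IsSmall O) {p q : State O}
    (h : (Quot.mk _ p : PhaseSpace O) = Quot.mk _ q) :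
    collisionInvariant O (pos p) (vel p) = collisionInvariant O (pos q) (vel q) :=
  congrArg (Quot.lift (fun p => collisionInvariant O (pos p) (vel p))
    fun _ _ h => h.collisionInvariant_eq hO hs) h

lemma tendsto_add_nhdsGE_Ici {t : ℝ} (ht : 0 ≤ t) :
    Tendsto (fun h : ℝ => t + h) (𝓝[≥] 0) (𝓝[Ici 0 ∩ Ici t] t) := by
  have := tendsto_add_nhdsGE (a := 0) (b := t + 1) (t := t) ⟨ht, by linarith⟩
  exact this.mono_right (nhdsWithin_mono _ (inter_subset_inter_left _ Icc_subset_Ici_self))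

lemma tendsto_sub_nhdsGE_Ici {t : ℝ} (ht : 0 < t) :
    Tendsto (fun h : ℝ => t - h) (𝓝[≥] 0) (𝓝[Ici 0 ∩ Iic t] t) := by
  have := tendsto_sub_nhdsGE' (a := 0) (b := t + 1) (t := t) ⟨ht, by linarith⟩
  exact this.mono_right (nhdsWithin_mono _ (inter_subset_inter_left _ Icc_subset_Ici_self))

variable {γ σ : ℝ → State O}

lemma IsTrajectory.pos_add (h : IsTrajectory O (Ici 0) γ) {t : ℝ} (ht : 0 ≤ t) :
    ∀ᶠ c in 𝓝[≥] (0 : ℝ), pos (γ (t + c)) = pos (γ t) + c • vel (γ t) := by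
  filter_upwards [(tendsto_add_nhdsGE_Ici ht).eventually (h t ht).1] with c hc
  rw [hc, add_sub_cancel_left]

/-- A trajectory keeps its state's velocity for a while. -/
lemma IsTrajectory.vel_add (h : IsTrajectory O (Ici 0) γ) {t : ℝ} (ht : 0 ≤ t) :
    ∀ᶠ c in 𝓝[≥] (0 : ℝ), pos (γ (t + c)) = pos (γ t) + c • vel (γ t) ∧
      vel (γ (t + c)) = vel (γ t) := by
  obtain ⟨b, hb0, hb⟩ := mem_nhdsGE_iff_exists_Ico_subset.1 (h.pos_add ht)
  have hb0 : (0 : ℝ) < b := hb0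
  filter_upwards [Ico_mem_nhdsGE hb0] with c hc
  refine ⟨hb hc, ?_⟩
  have htc : 0 ≤ t + c := add_nonneg ht hc.1
  refine eq_of_eventually_smul_eq ?_
  filter_upwards [h.pos_add htc, Ico_mem_nhdsGE (sub_pos.2 hc.2)] with d hd hd'
  have h1 : pos (γ (t + (c + d))) = pos (γ t) + (c + d) • vel (γ t) :=
    hb ⟨add_nonneg hc.1 hd'.1, by linarith [hd'.2]⟩
  have h2 : pos (γ (t + c)) = pos (γ t) + c • vel (γ t) := hb hc
  rw [← add_assoc, hd, h2, add_smul, add_assoc] at h1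
  exact add_left_cancel (add_left_cancel h1)

/-- The invariant determines the velocity up to the signs of the components that collisions reverse.
A trajectory can start neither into the obstacle nor out of the square, and this fixes those signs.
-/
lemma IsTrajectory.eq_initial (hO : IsObstacle O) (hγ : IsTrajectory O (Ici 0) γ)
    (hσ : IsTrajectory O (Ici 0) σ) 
    (h : collisionInvariant O (pos (γ 0)) (vel (γ 0)) =
      collisionInvariant O (pos (σ 0)) (vel (σ 0))) :
    γ 0 = σ 0 := by
  have hpos : pos (γ 0) = pos (σ 0) := (Prod.ext_iff.1 h).1
  rw [← hpos] at h
  refine Subtype.ext (Prod.ext hpos ?_)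
  change vel (γ 0) = vel (σ 0)
  have hle : 𝓝[>] (0 : ℝ) ≤ 𝓝[≥] 0 := nhdsWithin_mono _ Ioi_subset_Ici_self
  by_cases hf : pos (γ 0) ∈ frontier O
  · obtain ⟨n, hn, -⟩ := hO.exists_normal hf
    have h1 := congrFun (congrArg (fun x => x.2.2) h) n
    simp only [collisionInvariant, hf, hn, and_self, if_true, Prod.mk.injEq] at h1
    have key : ∀ {ρ : ℝ → State O}, IsTrajectory O (Ici 0) ρ → pos (ρ 0) = pos (γ 0) →
        0 ≤ inner ℝ n (vel (ρ 0)) := by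
      intro ρ hρ he
      refine hn.inner_nonneg hO hf (Eventually.frequently ?_)
      filter_upwards [(hρ.pos_add le_rfl).filter_mono hle] with c hc
      rw [← he, ← hc]
      exact (ρ _).2.2.1
    have h2 := h1.2
    rw [abs_of_nonneg (key hγ rfl), abs_of_nonneg (key hσ hpos.symm)] at h2
    have h3 := h1.1
    rw [h2] at h3
    exact sub_left_injective h3
  · ext i
    have h1 := congrFun (congrArg (fun x => x.2.1) h) i
    simp only [collisionInvariant, hf, if_false] at h1
    split_ifs at h1 with hi
    · have key : ∀ {ρ : ℝ → State O}, IsTrajectory O (Ici 0) ρ → pos (ρ 0) = pos (γ 0) →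
          pos (γ 0) i * vel (ρ 0) i ≤ 0 := by
        intro ρ hρ he
        have h2 : ∀ᶠ c in 𝓝[>] (0 : ℝ), |pos (γ 0) i + c * vel (ρ 0) i| ≤ 1 / 2 := by
          filter_upwards [(hρ.pos_add le_rfl).filter_mono hle] with c hc
          have := (ρ (0 + c)).2.1 i
          change |pos (ρ (0 + c)) i| ≤ 1 / 2 at this
          rw [hc, he] at this
          simpa using this
        obtain ⟨c, hc, hc0⟩ := (h2.and self_mem_nhdsWithin).exists
        have hc0 : (0 : ℝ) < c := hc0
        have h3 := sq_le_sq' (abs_le.1 hc).1 (abs_le.1 hc).2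
        have h4 : pos (γ 0) i ^ 2 = (1 / 2) ^ 2 := by rw [← hi, sq_abs]
        by_contra hcon
        rw [not_le] at hcon
        nlinarith [mul_pos hc0 hcon, sq_nonneg (c * vel (ρ 0) i)]
      have k1 := key hγ rfl
      have k2 := key hσ hpos.symm
      rcases abs_eq_abs.1 h1 with h2 | h2
      · exact h2
      · have h3 : pos (γ 0) i * vel (σ 0) i = 0 := by rw [h2] at k1; linarith
        have h4 : pos (γ 0) i ≠ 0 := fun h0 => by rw [h0] at hi; norm_num at hi
        have h5 : vel (σ 0) i = 0 := (mul_eq_zero.1 h3).resolve_left h4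
        rw [h2, h5, neg_zero]
    · exact h1

lemma CollisionLaw.unique (hO : IsObstacle O) {x w v v' : Plane} (h : CollisionLaw O x w v)
    (h' : CollisionLaw O x w v') : v = v' := by
  by_cases hf : x ∈ frontier O
  · obtain ⟨n, hn, hv⟩ := h.1 hf
    obtain ⟨n', hn', hv'⟩ := h'.1 hf
    rw [hv, hv', hn.unique hO hf hn']
  · ext i; rw [h.2 hf, h'.2 hf]

/-- The position and the incoming velocity at `t` are determined by the past, and the unique normal
makes the collision law deterministic. -/
lemma IsTrajectory.eq_of_eq_on_Ico (hO : IsObstacle O) (hγ : IsTrajectory O (Ici 0) γ)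
    (hσ : IsTrajectory O (Ici 0) σ) {t : ℝ} (ht : 0 < t) (h : ∀ s ∈ Ico 0 t, γ s = σ s) :
    γ t = σ t := by
  obtain ⟨-, w, hw, h1⟩ := hγ t ht.le
  obtain ⟨-, w', hw', h2⟩ := hσ t ht.le
  have hle : 𝓝[>] (0 : ℝ) ≤ 𝓝[≥] 0 := nhdsWithin_mono _ Ioi_subset_Ici_self
  have h3 : ∀ᶠ c in 𝓝[>] (0 : ℝ), pos (γ t) + (-c) • w = pos (σ t) + (-c) • w' := by
    filter_upwards [hle ((tendsto_sub_nhdsGE_Ici ht).eventually h1),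
      hle ((tendsto_sub_nhdsGE_Ici ht).eventually h2), Ioo_mem_nhdsGT ht] with c hc hc' hc0
    have h4 := h (t - c) ⟨by linarith [hc0.2], by linarith [hc0.1]⟩
    rw [sub_sub_cancel_left] at hc hc'
    rw [← hc, ← hc', h4]
  have hpos : pos (γ t) = pos (σ t) := by
    have l : ∀ a b : Plane, Tendsto (fun c : ℝ => a + (-c) • b) (𝓝[>] 0) (𝓝 a) := fun a b => by
      have : Tendsto (fun c : ℝ => a + (-c) • b) (𝓝 0) (𝓝 (a + (-(0 : ℝ)) • b)) :=
        Continuous.tendsto (by fun_prop) 0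
      simp only [neg_zero, zero_smul, add_zero] at this
      exact this.mono_left nhdsWithin_le_nhds
    exact tendsto_nhds_unique_of_eventuallyEq (l _ w) (l _ w') h3
  have hww : w = w' := by
    obtain ⟨c, hc, hc0⟩ := (h3.and self_mem_nhdsWithin).exists
    rw [hpos] at hc
    exact smul_right_injective _ (neg_ne_zero.2 (ne_of_gt hc0)) (add_left_cancel hc)
  refine Subtype.ext (Prod.ext hpos ?_)
  rw [hpos, hww] at hw
  exact hw.unique hO hw'

/-- A trajectory is determined by its initial point in the phase space. -/
lemma IsTrajectory.eq_of_mk_eq (hO : IsObstacle O) (hs : IsSmall O) (hγ : IsTrajectory O (Ici 0) γ)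
    (hσ : IsTrajectory O (Ici 0) σ) (h : (Quot.mk _ (γ 0) : PhaseSpace O) = Quot.mk _ (σ 0)) {t : ℝ}
    (ht : 0 ≤ t) : γ t = σ t := by
  by_contra hne
  set B : Set ℝ := {t | 0 ≤ t ∧ γ t ≠ σ t} with hB
  have hBne : B.Nonempty := ⟨t, ht, hne⟩
  have hBb : BddBelow B := ⟨0, fun s hs => hs.1⟩
  set m := sInf B with hm
  have hm0 : 0 ≤ m := le_csInf hBne fun s hs => hs.1
  have hlt : ∀ s ∈ Ico 0 m, γ s = σ s := fun s hs => by
    by_contra hc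
    exact absurd (csInf_le hBb (show s ∈ B from ⟨hs.1, hc⟩)) (not_le.2 hs.2)
  have hmeq : γ m = σ m := by
    rcases hm0.eq_or_lt with h0 | h0
    · rw [← h0]; exact hγ.eq_initial hO hσ (collisionInvariant_eq_of_mk_eq hO hs h)
    · exact hγ.eq_of_eq_on_Ico hO hσ h0 hlt
  obtain ⟨b, hb0, hb⟩ := mem_nhdsGE_iff_exists_Ico_subset.1 ((hγ.vel_add hm0).and (hσ.vel_add hm0))
  have hb0 : (0 : ℝ) < b := hb0
  obtain ⟨s, hsB, hsb⟩ := exists_lt_of_csInf_lt hBne (show sInf B < m + b by linarith)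
  have hms : m ≤ s := csInf_le hBb hsB
  obtain ⟨h1, h2⟩ := hb (show s - m ∈ Ico 0 b from ⟨by linarith, by linarith⟩)
  rw [add_sub_cancel] at h1 h2
  refine hsB.2 (Subtype.ext (Prod.ext ?_ ?_))
  · exact h1.1.trans (by rw [hmeq]; exact h2.1.symm)
  · exact h1.2.trans (by rw [hmeq]; exact h2.2.symm)

lemma HasAdmissibleType.congr (h : HasAdmissibleType O γ) (he : ∀ t, 0 ≤ t → γ t = σ t) :
    HasAdmissibleType O σ := by
  obtain ⟨T, k, τ, hT, hk, h0, h1, h2, h3⟩ := h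
  exact ⟨T, k, τ, ⟨hT.1, fun t ht => he t ht ▸ hT.2.1 t ht, fun t ht hp => hT.2.2 t ht
    (by rwa [he t ht])⟩, hk, h0, h1, h2, fun t ht => he t ht ▸ h3 t ht⟩

lemma HasRotationNumber.congr {z : Plane} {u : ℝ} (h : HasRotationNumber z γ u)
    (he : ∀ t, 0 ≤ t → γ t = σ t) : HasRotationNumber z σ u := by
  obtain ⟨φ, h1, h2⟩ := h
  exact ⟨φ, ⟨h1.1, fun t ht => he t ht ▸ h1.2 t ht⟩, h2⟩

lemma IsTrajectory.shift (h : IsTrajectory O (Ici 0) γ) {a : ℝ} (ha : 0 ≤ a) :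
    IsTrajectory O (Ici 0) fun t => γ (a + t) := by
  intro t ht
  have hat : a + t ∈ Ici (0 : ℝ) := add_nonneg ha ht
  obtain ⟨h1, w, hw, h2⟩ := h _ hat
  have hadd : ∀ J : Set ℝ, Tendsto (fun s => a + s) (𝓝[Ici 0 ∩ J] t)
      (𝓝[Ici 0 ∩ (fun s => s - a) ⁻¹' J] (a + t)) := fun J =>
    tendsto_nhdsWithin_of_tendsto_nhds_of_eventually_within _
      ((Continuous.tendsto (by fun_prop) t).mono_left nhdsWithin_le_nhds)
      (by
        filter_upwards [self_mem_nhdsWithin] with s hs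
        exact ⟨add_nonneg ha hs.1, by simpa using hs.2⟩)
  have e1 : (fun s => s - a) ⁻¹' Ici t = Ici (a + t) := by ext s; simp [add_comm]
  have e2 : (fun s => s - a) ⁻¹' Iic t = Iic (a + t) := by ext s; simp [add_comm]
  refine ⟨?_, w, hw, ?_⟩
  · have := hadd (Ici t)
    rw [e1] at this
    filter_upwards [this.eventually h1] with s hs
    rw [hs, add_sub_add_left_eq_sub]
  · have := hadd (Iic t)
    rw [e2] at this
    filter_upwards [this.eventually h2] with s hs
    rw [hs, add_sub_add_left_eq_sub]

end

end SquareBilliard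

namespace SquareBilliard

/-! ### Balanced words -/

section
variable {O : Set Plane}

lemma continuous_hop_uncurried :
    Continuous fun q : (Fin 2 → ℤ) × Plane × Plane => hop q.1 q.2.1 q.2.2 := by
  rw [continuous_prod_of_discrete_left]
  exact fun a => continuous_hop a

lemma continuous_flip_uncurried : Continuous fun q : (Fin 2 → ℤ) × Plane => flip q.1 q.2 := by
  rw [continuous_prod_of_discrete_left]
  exact fun a => (flip a).continuous

lemma continuous_hop_apply (n : ℕ) : Continuous fun p : (ℕ → Fin 2 → ℤ) × (ℕ → Plane) =>
    hop (p.1 n) (p.2 n) (p.2 (n + 1)) := by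
  have h1 : Continuous fun p : (ℕ → Fin 2 → ℤ) × (ℕ → Plane) => p.1 n :=
    (continuous_apply n).comp continuous_fst
  have h2 : ∀ m, Continuous fun p : (ℕ → Fin 2 → ℤ) × (ℕ → Plane) => p.2 m := fun m =>
    (continuous_apply m).comp continuous_snd
  have h3 := continuous_hop_uncurried.comp (h1.prodMk ((h2 n).prodMk (h2 (n + 1))))
  simpa only [Function.comp_def] using h3

/-- On `S` all hops are nonzero, so their directions are continuous and each test point `q` imposes
a closed condition. -/
lemma isClosed_setOf_isBounce {S : Set ((ℕ → Fin 2 → ℤ) × (ℕ → Plane))} (hs : IsSmall O)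
    (hS : IsClosed S) (h : ∀ p ∈ S, ∀ n, p.1 n ≠ 0 ∧ p.2 n ∈ O) (n : ℕ) :
    IsClosed {p ∈ S | IsBounce O (p.1 n) (p.2 n) (p.2 (n + 1)) (p.1 (n + 1)) (p.2 (n + 2))} := by
  have hne : ∀ p ∈ S, ∀ n, hop (p.1 n) (p.2 n) (p.2 (n + 1)) ≠ 0 := fun p hp n =>
    hop_ne_zero hs (h p hp n).1 (h p hp n).2 (h p hp (n + 1)).2
  have heq : {p ∈ S | IsBounce O (p.1 n) (p.2 n) (p.2 (n + 1)) (p.1 (n + 1)) (p.2 (n + 2))} =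
      S ∩ ⋂ q ∈ O, S ∩ (fun p : (ℕ → Fin 2 → ℤ) × (ℕ → Plane) =>
        inner ℝ (dir (hop (p.1 (n + 1)) (p.2 (n + 1)) (p.2 (n + 2))) -
          dir (flip (p.1 n) (hop (p.1 n) (p.2 n) (p.2 (n + 1))))) (q - p.2 (n + 1))) ⁻¹' Iic 0 := by
    ext p
    simp only [mem_ofPred_eq, mem_inter_iff, mem_iInter, mem_preimage, mem_Iic, IsBounce]
    exact ⟨fun hp => ⟨hp.1, fun q hq => ⟨hp.1, hp.2 q hq⟩⟩, fun hp => ⟨hp.1, fun q hq => (hp.2 q hq).2⟩⟩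
  rw [heq]
  refine hS.inter (isClosed_biInter fun q _ => ?_)
  refine ContinuousOn.preimage_isClosed_of_isClosed ?_ hS isClosed_Iic
  intro p hp
  have h1 : ContinuousAt (fun p : (ℕ → Fin 2 → ℤ) × (ℕ → Plane) =>
      dir (hop (p.1 (n + 1)) (p.2 (n + 1)) (p.2 (n + 2)))) p :=
    (continuousAt_dir (hne p hp (n + 1))).comp (f := fun p : (ℕ → Fin 2 → ℤ) × (ℕ → Plane) =>
      hop (p.1 (n + 1)) (p.2 (n + 1)) (p.2 (n + 2))) (continuous_hop_apply (n + 1)).continuousAt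
  have h2 : ContinuousAt (fun p : (ℕ → Fin 2 → ℤ) × (ℕ → Plane) =>
      dir (flip (p.1 n) (hop (p.1 n) (p.2 n) (p.2 (n + 1))))) p := by
    refine (continuousAt_dir ?_).comp (f := fun p : (ℕ → Fin 2 → ℤ) × (ℕ → Plane) =>
      flip (p.1 n) (hop (p.1 n) (p.2 n) (p.2 (n + 1)))) ?_
    · simpa using hne p hp n
    · exact (continuous_flip_uncurried.comp (((continuous_apply n).comp continuous_fst).prodMk
        (continuous_hop_apply n))).continuousAt
  have h3 : ContinuousAt (fun p : (ℕ → Fin 2 → ℤ) × (ℕ → Plane) => q - p.2 (n + 1)) p := by fun_prop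
  exact ((h1.sub h2).inner h3).continuousWithinAt

/-- An infinite billiard path exists if all finite ones exist. -/
lemma exists_isInfChain (hO : IsObstacle O) (hs : IsSmall O) {e : ℕ → Fin 2 → ℤ}
    (he : ∀ n, e n ≠ 0) (h : ∀ N, ∃ y, (∀ n, y n ∈ O) ∧ IsChain O e y N) :
    ∃ y, IsInfChain O e y := by
  set S : Set ((ℕ → Fin 2 → ℤ) × (ℕ → Plane)) := {e} ×ˢ univ.pi fun _ => O with hS
  have hpi : IsCompact (univ.pi fun _ : ℕ => O) := isCompact_univ_pi fun _ => hO.isCompact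
  have hSc : IsClosed S := isClosed_singleton.prod hpi.isClosed
  have hSn : ∀ p ∈ S, ∀ n, p.1 n ≠ 0 ∧ p.2 n ∈ O := fun p hp n =>
    ⟨by rw [mem_singleton_iff.1 hp.1]; exact he n, hp.2 n (mem_univ n)⟩
  -- Nested nonempty compact sets of point sequences obeying the first bounce conditions; a common
  -- element obeys all of them.
  set t : ℕ → Set (ℕ → Plane) := fun N => (univ.pi fun _ => O) ∩ ⋂ n ∈ {n | n + 1 < N},
    (fun y => (e, y)) ⁻¹' {p ∈ S | IsBounce O (p.1 n) (p.2 n) (p.2 (n + 1)) (p.1 (n + 1))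
      (p.2 (n + 2))} with ht
  have htc : ∀ N, IsClosed (t N) := fun N => hpi.isClosed.inter (isClosed_biInter fun n _ =>
    (isClosed_setOf_isBounce hs hSc hSn n).preimage (by fun_prop))
  obtain ⟨y, hy⟩ := IsCompact.nonempty_iInter_of_sequence_nonempty_isCompact_isClosed t
    (fun N => inter_subset_inter_right _ (biInter_subset_biInter_left fun n (hn : n + 1 < N) =>
      show n + 1 < N + 1 by omega))
    (fun N => by
      obtain ⟨y, hy, hc⟩ := h N
      refine ⟨y, fun n _ => hy n, mem_iInter₂.2 fun n hn => ⟨⟨rfl, fun n _ => hy n⟩, hc.2 n hn⟩⟩)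
    (hpi.of_isClosed_subset (htc 0) inter_subset_left) htc
  rw [mem_iInter] at hy
  exact ⟨y, fun n => (hy 0).1 n (mem_univ n), fun n =>
    (mem_iInter₂.1 (hy (n + 2)).2 n (show n + 1 < n + 2 by omega)).2⟩

/-- The excess of the displacement along the block `w` over `u` times its length. -/
noncomputable def excess (O : Set Plane) (z : Plane) (u : ℝ) (w : List (Fin 2 → ℤ)) : ℝ :=
  blockDisp O z w - u * blockLength O w

lemma abs_sub_mul_le {d d' l l' u c c' : ℝ} (h : |d - d'| ≤ c ∧ |l - l'| ≤ c') :
    |(d - u * l) - (d' - u * l')| ≤ c + c' * |u| := by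
  have h1 : (d - u * l) - (d' - u * l') = (d - d') - u * (l - l') := by ring
  rw [h1]
  refine (abs_sub _ _).trans (add_le_add h.1 ?_)
  rw [abs_mul, mul_comm]
  exact mul_le_mul_of_nonneg_right h.2 (abs_nonneg u)

/-- Repeating a block multiplies its excess up to an error independent of the number of repetitions,
so any nonzero excess can be amplified. -/
lemma IsBlock.exists_excess (hO : IsObstacle O) (hs : IsSmall O) {z : Plane} (hz : z ∈ interior O)
    {w : List (Fin 2 → ℤ)} (hw : IsBlock O w) (u K : ℝ) :
    (0 < excess O z u w → ∃ A, IsBlock O A ∧ K < excess O z u A) ∧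
      (excess O z u w < 0 → ∃ B, IsBlock O B ∧ excess O z u B < K) := by
  have h1 : ∀ p : ℕ, |excess O z u (blockPow w (p + 1)) - ((p + 1 : ℕ) : ℝ) * excess O z u w| ≤
      10 + 2 * |u| := fun p => by
    have := abs_sub_mul_le (u := u) (hw.pow_abs_sub_le hO hs hz p)
    rw [excess, excess, mul_sub]
    convert this using 3
    ring
  constructor
  · intro h
    obtain ⟨p, hp⟩ := exists_nat_gt ((K + (10 + 2 * |u|)) / excess O z u w)
    rw [div_lt_iff₀ h] at hp
    refine ⟨_, hw.pow hs p, ?_⟩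
    have h2 := (abs_le.1 (h1 p)).1
    push_cast at h2
    linarith
  · intro h
    obtain ⟨p, hp⟩ := exists_nat_gt ((-K + (10 + 2 * |u|)) / -excess O z u w)
    rw [div_lt_iff₀ (neg_pos.2 h)] at hp
    refine ⟨_, hw.pow hs p, ?_⟩
    have h2 := (abs_le.1 (h1 p)).2
    push_cast at h2
    linarith

open Classical in
/-- Longer and longer words made of the blocks `A` and `B`, such that the excess is bounded. -/
noncomputable def balanced (O : Set Plane) (z : Plane) (u : ℝ) (A B : List (Fin 2 → ℤ)) :
    ℕ → List (Fin 2 → ℤ)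
  | 0 => A
  | n + 1 => balanced O z u A B n ++ if excess O z u (balanced O z u A B n) ≤ 0 then A else B

section
variable {z : Plane} {u : ℝ} {A B : List (Fin 2 → ℤ)}

lemma isBlock_balanced (hs : IsSmall O) (hA : IsBlock O A) (hB : IsBlock O B) (N : ℕ) :
    IsBlock O (balanced O z u A B N) := by
  induction N with
  | zero => exact hA
  | succ N ih => rw [balanced]; split_ifs; exacts [ih.append hs hA, ih.append hs hB]

lemma length_balanced_le (hA : IsBlock O A) (hB : IsBlock O B) (N : ℕ) :
    (balanced O z u A B N).length < (balanced O z u A B (N + 1)).length ∧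
      (balanced O z u A B (N + 1)).length ≤
        (balanced O z u A B N).length + (A.length + B.length) := by
  have h1 := hA.length_ge
  have h2 := hB.length_ge
  rw [balanced, List.length_append]
  split_ifs <;> omega

lemma lt_length_balanced (hA : IsBlock O A) (hB : IsBlock O B) (N : ℕ) :
    N < (balanced O z u A B N).length := by
  induction N with
  | zero => have := hA.length_ge; rw [balanced]; omega
  | succ N ih => have := (length_balanced_le (z := z) (u := u) hA hB N).1; omega

lemma mem_balanced {N : ℕ} {a : Fin 2 → ℤ} (h : a ∈ balanced O z u A B N) : a ∈ A ++ B := by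
  induction N with
  | zero => exact List.mem_append_left _ h
  | succ N ih =>
    rw [balanced, List.mem_append] at h
    rcases h with h | h
    · exact ih h
    · split_ifs at h
      exacts [List.mem_append_left _ h, List.mem_append_right _ h]

lemma balanced_prefix {M N : ℕ} (h : M ≤ N) : balanced O z u A B M <+: balanced O z u A B N := by
  induction N, h using Nat.le_induction with
  | base => exact List.prefix_rfl
  | succ N _ ih => rw [balanced]; exact ih.trans (List.prefix_append _ _)

/-- The appended block has an excess of the opposite sign, or an arbitrary one when the excess is
zero, and it outweighs the concatenation error `20 + 4 |u|`. So the total is pushed back towards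
zero and overshoots by a bounded amount. -/
lemma abs_excess_balanced_le (hO : IsObstacle O) (hs : IsSmall O) (hz : z ∈ interior O)
    (hA : IsBlock O A) (hB : IsBlock O B) (hAu : 20 + 4 * |u| < excess O z u A)
    (hBu : excess O z u B < -(20 + 4 * |u|)) (N : ℕ) :
    |excess O z u (balanced O z u A B N)| ≤
      excess O z u A - excess O z u B + (20 + 4 * |u|) := by
  have h0 := abs_nonneg u
  have happ : ∀ {w v}, IsBlock O w → IsBlock O v →
      |excess O z u (w ++ v) - (excess O z u w + excess O z u v)| ≤ 20 + 4 * |u| := by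
    intro w v hw hv
    have := abs_sub_mul_le (u := u) (hw.append_abs_sub_le hO hs hv hz)
    simp only [excess]
    convert this using 3
    ring
  induction N with
  | zero => rw [balanced, abs_le]; constructor <;> linarith
  | succ N ih =>
    have hb := isBlock_balanced (z := z) (u := u) hs hA hB N
    rw [balanced]
    rw [abs_le] at ih ⊢
    split_ifs with h
    · have := abs_le.1 (happ hb hA)
      constructor <;> linarith
    · have := abs_le.1 (happ hb hB)
      constructor <;> linarith

end

/-- The word `e` is balanced around the rotation number `u`. -/
def IsBalanced (O : Set Plane) (z : Plane) (u : ℝ) (e : ℕ → Fin 2 → ℤ) : Prop :=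
  ∃ C : ℝ, ∀ (m n : ℕ) (e' : ℕ → Fin 2 → ℤ) (y' : ℕ → Plane), IsPath O e' y' n →
    (∀ i < n, e' i = e (m + i)) → |pathDisp z e' y' n - u * pathLength e' y' n| ≤ C

/-- A finite subword is the difference of two initial words. An initial word is some `balanced`
word, of bounded excess, followed by fewer letters than the two blocks have together, of bounded
effect; a very short one is covered by the second estimate alone. Rigidity transfers the bound to
every path with that subword. -/
lemma exists_isBalanced_of_blocks (hO : IsObstacle O) (hs : IsSmall O) {z : Plane}
    (hz : z ∈ interior O) {u : ℝ} {A B : List (Fin 2 → ℤ)} (hA : IsBlock O A) (hB : IsBlock O B)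
    (hAu : 20 + 4 * |u| < excess O z u A) (hBu : excess O z u B < -(20 + 4 * |u|)) :
    ∃ e, IsWord O e ∧ (∀ n, e n ∈ A ++ B) ∧ (∃ y, IsInfChain O e y) ∧ IsBalanced O z u e := by
  set W := balanced O z u A B with hW
  have hWb : ∀ N, IsBlock O (W N) := isBlock_balanced hs hA hB
  have hWl : ∀ N, N < (W N).length := lt_length_balanced hA hB
  -- The words `W N` are prefixes of each other and `W n` has more than `n` letters, so this is
  -- their common limit.
  set e : ℕ → Fin 2 → ℤ := fun n => (W n)[n]'(hWl n) with he
  have hcyc : ∀ N n, n < (W N).length → cyc (W N) n = e n := by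
    intro N n hn
    rw [cyc_of_lt hn]
    rcases le_total n N with h | h
    · exact ((balanced_prefix h).getElem (hWl n)).symm
    · exact (balanced_prefix h).getElem hn
  have hword : IsWord O e := by
    refine ⟨fun n => ?_, fun n => ?_⟩
    · rw [← hcyc n n (hWl n)]; exact ((hWb n).isWord hs).1 n
    · rw [← hcyc (n + 1) n (by have := hWl (n + 1); omega), ← hcyc (n + 1) (n + 1) (hWl (n + 1))]
      exact ((hWb (n + 1)).isWord hs).2 n
  refine ⟨e, hword, fun n => mem_balanced (List.getElem_mem _), ?_, ?_⟩
  -- The periodic orbit of `W N` follows `e` for at least `N` steps; compactness then yields an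
  -- infinite path.
  · refine exists_isInfChain hO hs (fun n => (hword.1 n).1) fun N => ⟨orbit O (W N),
      ((hWb N).orbit_spec hO hs).2.1, ?_⟩
    exact (((hWb N).isPath hO hs N).congr fun n hn => hcyc N n (hn.trans (hWl N))).isChain
  obtain ⟨C, hC0, hC⟩ := exists_abs_disp_le hz
  obtain ⟨H, hH⟩ : ∃ H : ℝ, ∀ a ∈ A ++ B, ‖center a‖ ≤ H := by
    obtain ⟨H, hH⟩ := ((A ++ B).toFinset.image fun a => ‖center a‖).bddAbove
    exact ⟨H, fun a ha => hH (by simpa using ⟨a, by simpa using ha, rfl⟩)⟩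
  have hH0 : 0 ≤ H := (norm_nonneg _).trans (hH _ (mem_balanced (List.getElem_mem (hWl 0))))
  -- short paths
  set R : ℕ := A.length + B.length with hR
  have hshort : ∀ N m r, m + r ≤ (W N).length → r ≤ R →
      |pathDisp z (fun i => cyc (W N) (m + i)) (fun i => orbit O (W N) (m + i)) r -
        u * pathLength (fun i => cyc (W N) (m + i)) (fun i => orbit O (W N) (m + i)) r| ≤
        (C + 4 + |u|) * (R * (H + 1)) := by
    intro N m r hmr hr
    have hp := ((hWb N).isPath hO hs (m + r)).window (m := m) (n := r) le_rfl
    have h1 := hp.abs_pathDisp_le hs hC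
    have h2 : pathLength (fun i => cyc (W N) (m + i)) (fun i => orbit O (W N) (m + i)) r ≤
        R * (H + 1) := by
      have h3 : pathLength (fun i => cyc (W N) (m + i)) (fun i => orbit O (W N) (m + i)) r ≤
          ∑ i ∈ Finset.range r, (H + 1) := by
        refine Finset.sum_le_sum fun i hi => ?_
        have hi := Finset.mem_range.1 hi
        refine (norm_hop_le hs (hp.isChain.1 i hi.le) (hp.isChain.1 (i + 1) hi)).trans ?_
        simp only
        rw [hcyc N (m + i) (by omega)]
        linarith [hH _ (mem_balanced (List.getElem_mem (hWl (m + i))))]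
      rw [Finset.sum_const, Finset.card_range, nsmul_eq_mul] at h3
      have h4 : (r : ℝ) ≤ R := by exact_mod_cast hr
      nlinarith
    have h5 : 0 ≤ pathLength (fun i => cyc (W N) (m + i)) (fun i => orbit O (W N) (m + i)) r :=
      Finset.sum_nonneg fun _ _ => norm_nonneg _
    refine (abs_sub _ _).trans ?_
    rw [abs_mul, abs_of_nonneg h5]
    have := abs_nonneg u
    nlinarith
  -- initial paths
  set M : ℝ := excess O z u A - excess O z u B + (20 + 4 * |u|) with hM
  set C₁ : ℝ := M + (10 + 2 * |u|) + (C + 4 + |u|) * (R * (H + 1)) with hC₁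
  have hM0 : 0 ≤ M := by have := abs_nonneg u; rw [hM]; linarith
  have hinit : ∀ N n, n ≤ (W N).length → |pathDisp z (cyc (W N)) (orbit O (W N)) n -
      u * pathLength (cyc (W N)) (orbit O (W N)) n| ≤ C₁ := by
    intro N n hn
    have hcase : n < A.length ∨ ∃ K r, n = (W K).length + r ∧ r ≤ R := by
      have hex : ∃ K, n < (W K).length := ⟨n, hWl n⟩
      classical
      rcases Nat.eq_zero_or_pos (Nat.find hex) with h0 | h0
      · left
        have := Nat.find_spec hex
        rw [h0] at this
        exact this
      · right
        obtain ⟨K, hK⟩ := Nat.exists_eq_succ_of_ne_zero h0.ne'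
        have h1 := Nat.find_spec hex
        rw [hK] at h1
        have h2 := Nat.find_min hex (show K < Nat.find hex by omega)
        have h3 : (W (K + 1)).length ≤ (W K).length + R := (length_balanced_le hA hB K).2
        rw [Nat.succ_eq_add_one] at h1
        exact ⟨K, n - (W K).length, by omega, by omega⟩
    have h0 := abs_nonneg u
    rcases hcase with h | ⟨K, r, rfl, hr⟩
    · have := hshort N 0 n (by omega) (by omega)
      simp only [zero_add] at this
      linarith
    · have hp := (hWb N).isPath hO hs ((W K).length + r)
      have h1 := (hp.window (m := 0) (n := (W K).length) (by omega)).abs_sub_le hO hs hz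
        ((hWb K).isPath hO hs _) fun i hi => by
          rw [zero_add, hcyc N i (by omega), hcyc K i hi]
      simp only [zero_add] at h1
      have h2 := abs_le.1 (abs_sub_mul_le (u := u) h1)
      have h3 := abs_le.1 (show |pathDisp z (cyc (W K)) (orbit O (W K)) (W K).length -
        u * pathLength (cyc (W K)) (orbit O (W K)) (W K).length| ≤ M from
          abs_excess_balanced_le hO hs hz hA hB hAu hBu K)
      have h4 := abs_le.1 (hshort N (W K).length r hn hr)
      rw [pathDisp_add, pathLength_add, abs_le]
      constructor <;> linarith [h2.1, h2.2, h3.1, h3.2, h4.1, h4.2]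
  refine ⟨2 * C₁ + (10 + 2 * |u|), fun m n e' y' hp heq => ?_⟩
  have hl := hWl (m + n)
  have h1 := hp.abs_sub_le hO hs hz
    (((hWb (m + n)).isPath hO hs (m + n)).window (m := m) (n := n) le_rfl) fun i hi => by
      rw [heq i hi, hcyc (m + n) (m + i) (by omega)]
  have h2 := abs_le.1 (abs_sub_mul_le (u := u) h1)
  -- Both initial parts are taken on the same periodic orbit, so additivity along the path gives the
  -- window between `m` and `m + n`.
  have h3 := abs_le.1 (hinit (m + n) (m + n) hl.le)
  have h4 := abs_le.1 (hinit (m + n) m (by omega))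
  rw [pathDisp_add, pathLength_add] at h3
  rw [abs_le]
  constructor <;> linarith [h2.1, h2.2, h3.1, h3.2, h4.1, h4.2]

/-- For every rotation number in the interior of the admissible rotation set there is a balanced
word. -/
lemma exists_isBalanced (hO : IsObstacle O) (hs : IsSmall O) {z : Plane} (hz : z ∈ interior O)
    {u : ℝ} (hu : u ∈ interior (admissibleRotationSet O z)) :
    ∃ e, IsWord O e ∧ (∃ l : List (Fin 2 → ℤ), ∀ n, e n ∈ l) ∧ (∃ y, IsInfChain O e y) ∧
      IsBalanced O z u e := by
  rw [admissibleRotationSet_eq hO hs hz, mem_interior_iff_mem_nhds, Metric.mem_nhds_iff] at hu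
  obtain ⟨ε, hε, hb⟩ := hu
  have key : ∀ r : ℝ, |r - u| < ε → ∀ δ > 0, ∃ w, IsBlock O w ∧
      |blockDisp O z w / blockLength O w - r| < δ := by
    intro r hr δ hδ
    obtain ⟨r', ⟨w, hw, rfl⟩, hd⟩ := Metric.mem_closure_iff.1
      (hb (show r ∈ Metric.ball u ε by rwa [Metric.mem_ball, Real.dist_eq])) δ hδ
    exact ⟨w, hw, by rwa [dist_comm, Real.dist_eq] at hd⟩
  -- Blocks with rotation numbers strictly above and strictly below `u`: the errors are smaller than
  -- the distances of `u ± ε / 2` from `u`.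
  obtain ⟨w, hw, h1⟩ := key (u + ε / 2) (by rw [add_sub_cancel_left, abs_of_pos] <;> linarith)
    (ε / 2) (by linarith)
  obtain ⟨v, hv, h2⟩ := key (u - ε / 2) (by rw [sub_sub_cancel_left, abs_neg, abs_of_pos] <;> linarith)
    (ε / 2) (by linarith)
  have hwp := hw.blockLength_pos hO hs
  have hvp := hv.blockLength_pos hO hs
  have h3 : 0 < excess O z u w := by
    have : u < blockDisp O z w / blockLength O w := by linarith [(abs_lt.1 h1).1]
    rw [lt_div_iff₀ hwp] at this
    rw [excess]; linarith
  have h4 : excess O z u v < 0 := by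
    have : blockDisp O z v / blockLength O v < u := by linarith [(abs_lt.1 h2).2]
    rw [div_lt_iff₀ hvp] at this
    rw [excess]; linarith
  obtain ⟨A, hA, hAu⟩ := (hw.exists_excess hO hs hz u (20 + 4 * |u|)).1 h3
  obtain ⟨B, hB, hBu⟩ := (hv.exists_excess hO hs hz u (-(20 + 4 * |u|))).2 h4
  obtain ⟨e, he, hl, hy, hb⟩ := exists_isBalanced_of_blocks hO hs hz hA hB hAu hBu
  exact ⟨e, he, ⟨_, hl⟩, hy, hb⟩

end

end SquareBilliard

namespace SquareBilliard

/-! ### Forward invariant sets -/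

/-- The words all of whose finite subwords occur in `e`. -/
def wordHull (e : ℕ → Fin 2 → ℤ) : Set (ℕ → Fin 2 → ℤ) :=
  {e' | ∀ n, ∃ m, ∀ i < n, e' i = e (m + i)}

section
variable {O : Set Plane} {e e' : ℕ → Fin 2 → ℤ} {y' : ℕ → Plane}

lemma self_mem_wordHull : e ∈ wordHull e := fun _ => ⟨0, fun i _ => by rw [zero_add]⟩

lemma shift_mem_wordHull (h : e' ∈ wordHull e) (k : ℕ) : (fun i => e' (k + i)) ∈ wordHull e := by
  intro n
  obtain ⟨m, hm⟩ := h (k + n)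
  exact ⟨m + k, fun i hi => by
    show e' (k + i) = _
    rw [hm (k + i) (by omega), add_assoc]⟩

lemma isWord_of_mem_wordHull (he : IsWord O e) (h : e' ∈ wordHull e) : IsWord O e' := by
  refine ⟨fun n => ?_, fun n => ?_⟩ <;> obtain ⟨m, hm⟩ := h (n + 2)
  · rw [hm n (by omega)]; exact he.1 _
  · rw [hm n (by omega), hm (n + 1) (by omega)]; exact he.2 _

lemma mem_of_mem_wordHull {l : List (Fin 2 → ℤ)} (hl : ∀ n, e n ∈ l) (h : e' ∈ wordHull e)
    (n : ℕ) : e' n ∈ l := by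
  obtain ⟨m, hm⟩ := h (n + 1)
  rw [hm n (by omega)]; exact hl _

/-- For each `n` the condition involves finitely many letters, and every set in a finite product of
discrete spaces is closed. -/
lemma isClosed_wordHull (e : ℕ → Fin 2 → ℤ) : IsClosed (wordHull e) := by
  have h : wordHull e = ⋂ n : ℕ, (fun (e' : ℕ → Fin 2 → ℤ) (i : Fin n) => e' i) ⁻¹'
      {w | ∃ m, ∀ i : Fin n, w i = e (m + i)} := by
    ext e'
    simp only [wordHull, mem_ofPred_eq, mem_iInter, mem_preimage]
    exact forall_congr' fun n => exists_congr fun m =>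
      ⟨fun h i => h i i.2, fun h i hi => h ⟨i, hi⟩⟩
  rw [h]
  exact isClosed_iInter fun n => (isClosed_discrete _).preimage (by fun_prop)

/-- The billiard paths whose words are in the hull of `e`. -/
def hullPaths (O : Set Plane) (e : ℕ → Fin 2 → ℤ) : Set ((ℕ → Fin 2 → ℤ) × (ℕ → Plane)) :=
  {p | p.1 ∈ wordHull e ∧ IsInfChain O p.1 p.2}

/-- Only finitely many steps occur, so the words lie in a compact product; the points lie in a
product of copies of `O`, and the bounce conditions are closed. -/
lemma isCompact_hullPaths (hO : IsObstacle O) (hs : IsSmall O) (he : IsWord O e)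
    {l : List (Fin 2 → ℤ)} (hl : ∀ n, e n ∈ l) : IsCompact (hullPaths O e) := by
  set S : Set ((ℕ → Fin 2 → ℤ) × (ℕ → Plane)) := wordHull e ×ˢ univ.pi fun _ => O with hS
  have h1 : IsCompact (wordHull e) := by
    refine (isCompact_univ_pi fun _ : ℕ => (l.toFinset : Set (Fin 2 → ℤ)).toFinite.isCompact)
      |>.of_isClosed_subset (isClosed_wordHull e) fun e' he' n _ => ?_
    simpa using mem_of_mem_wordHull hl he' n
  have hSc : IsCompact S := h1.prod (isCompact_univ_pi fun _ => hO.isCompact)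
  have hSn : ∀ p ∈ S, ∀ n, p.1 n ≠ 0 ∧ p.2 n ∈ O := fun p hp n =>
    ⟨((isWord_of_mem_wordHull he hp.1).1 n).1, hp.2 n (mem_univ n)⟩
  have heq : hullPaths O e = ⋂ n, {p ∈ S | IsBounce O (p.1 n) (p.2 n) (p.2 (n + 1)) (p.1 (n + 1))
      (p.2 (n + 2))} := by
    ext p
    simp only [hullPaths, mem_ofPred_eq, mem_iInter]
    exact ⟨fun h n => ⟨⟨h.1, fun i _ => h.2.1 i⟩, h.2.2 n⟩, fun h => ⟨(h 0).1.1,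
      fun n => (h 0).1.2 n (mem_univ n), fun n => (h n).2⟩⟩
  rw [heq]
  refine hSc.of_isClosed_subset (isClosed_iInter fun n =>
    isClosed_setOf_isBounce hs hSc.isClosed hSn n) fun p hp => (mem_iInter.1 hp 0).1

/-- The unfolded point of the first segment of a path with the parameter `c`. -/
noncomputable def segPt (p : (ℕ → Fin 2 → ℤ) × (ℕ → Plane)) (c : ℝ) : Plane :=
  p.2 1 + c • hop (p.1 1) (p.2 1) (p.2 2)

/-- The positions and velocities on the first segments of the paths in the hull of `e`. -/
def hullStates (O : Set Plane) (e : ℕ → Fin 2 → ℤ) : Set (Plane × Plane) :=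
  {q | ∃ p ∈ hullPaths O e, ∃ c ∈ Icc (0 : ℝ) 1, ∃ k : Fin 2 → ℤ,
    (∀ i, |segPt p c i - k i| ≤ 1 / 2) ∧
      q = (tab k (segPt p c), flip k (dir (hop (p.1 1) (p.2 1) (p.2 2))))}

lemma continuous_tab_uncurried : Continuous fun q : (Fin 2 → ℤ) × Plane => tab q.1 q.2 := by
  rw [continuous_prod_of_discrete_left]
  exact fun a => (tab a).continuous

/-- The set is a continuous image of triples (path, parameter, cell). Every closed cell containing
the point is admitted, and the parameter `1` is included, so that the triples form a closed set;
bounded hops leave finitely many cells. The ambiguity at sides and bounces is removed later by the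
gluing. -/
lemma isCompact_hullStates (hO : IsObstacle O) (hs : IsSmall O) (he : IsWord O e)
    {l : List (Fin 2 → ℤ)} (hl : ∀ n, e n ∈ l) : IsCompact (hullStates O e) := by
  obtain ⟨H, hH⟩ : ∃ H : ℝ, ∀ a ∈ l, ‖center a‖ ≤ H := by
    obtain ⟨H, hH⟩ := (l.toFinset.image fun a => ‖center a‖).bddAbove
    exact ⟨H, fun a ha => hH (by simpa using ⟨a, by simpa using ha, rfl⟩)⟩
  obtain ⟨N, hN⟩ := exists_nat_gt (H + 3)
  have hpN : ∀ p ∈ hullPaths O e, ∀ c ∈ Icc (0 : ℝ) 1, ∀ k : Fin 2 → ℤ,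
      (∀ i, |segPt p c i - k i| ≤ 1 / 2) → k ∈ Icc (fun _ => -(N : ℤ)) (fun _ => (N : ℤ)) := by
    intro p hp c hc k hk
    have h1 : ‖segPt p c‖ ≤ H + 2 := by
      have h2 := norm_hop_le hs (a := p.1 1) (hp.2.1 1) (hp.2.1 2)
      have h3 := hH _ (mem_of_mem_wordHull hl hp.1 1)
      have h4 := hs.norm_lt (hp.2.1 1)
      have h5 := sqrt_two_div_four_lt
      refine (norm_add_le _ _).trans ?_
      rw [norm_smul, Real.norm_of_nonneg hc.1]
      have := mul_le_of_le_one_left (norm_nonneg (hop (p.1 1) (p.2 1) (p.2 2))) hc.2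
      linarith
    have h6 : ∀ i, |(k i : ℝ)| ≤ N := fun i => by
      have h7 := abs_le.1 (hk i)
      have h8 := abs_le.1 ((abs_apply_le_norm (segPt p c) i).trans h1)
      rw [abs_le]; constructor <;> linarith
    refine ⟨fun i => ?_, fun i => ?_⟩
    · have := (abs_le.1 (h6 i)).1; exact_mod_cast this
    · have := (abs_le.1 (h6 i)).2; exact_mod_cast this
  set D := ((ℕ → Fin 2 → ℤ) × (ℕ → Plane)) × ℝ × (Fin 2 → ℤ) with hD
  have hseg : Continuous fun x : D => segPt x.1 x.2.1 := by
    have h1 : Continuous fun x : D => hop (x.1.1 1) (x.1.2 1) (x.1.2 2) := by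
      simpa only [Function.comp_def] using (continuous_hop_apply 1).comp (continuous_fst (X :=
        (ℕ → Fin 2 → ℤ) × (ℕ → Plane)) (Y := ℝ × (Fin 2 → ℤ)))
    have h2 : Continuous fun x : D => x.1.2 1 := by fun_prop
    have h3 : Continuous fun x : D => x.2.1 := by fun_prop
    exact h2.add (h3.smul h1)
  set Z : Set D := (hullPaths O e ×ˢ Icc (0 : ℝ) 1 ×ˢ Icc (fun _ => -(N : ℤ)) (fun _ => (N : ℤ))) ∩
    {x : D | ∀ i, |segPt x.1 x.2.1 i - x.2.2 i| ≤ 1 / 2} with hZ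
  have hZc : IsCompact Z := by
    refine ((isCompact_hullPaths hO hs he hl).prod (isCompact_Icc.prod
      (finite_Icc _ _).isCompact)).inter_right ?_
    rw [ofPred_forall]
    refine isClosed_iInter fun i => isClosed_le ?_ continuous_const
    have h1 : Continuous fun x : D => segPt x.1 x.2.1 i := by fun_prop
    have h2 : Continuous fun x : D => (x.2.2 i : ℝ) := by
      have h3 : Continuous fun x : D => x.2.2 i := by fun_prop
      exact continuous_of_discreteTopology.comp h3
    exact (h1.sub h2).abs
  have himg : hullStates O e = (fun x : D => (tab x.2.2 (segPt x.1 x.2.1),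
      flip x.2.2 (dir (hop (x.1.1 1) (x.1.2 1) (x.1.2 2))))) '' Z := by
    ext q
    constructor
    · rintro ⟨p, hp, c, hc, k, hk, rfl⟩
      exact ⟨(p, c, k), ⟨⟨hp, hc, hpN p hp c hc k hk⟩, hk⟩, rfl⟩
    · rintro ⟨⟨p, c, k⟩, ⟨⟨hp, hc, -⟩, hk⟩, rfl⟩
      exact ⟨p, hp, c, hc, k, hk, rfl⟩
  rw [himg]
  refine hZc.image_of_continuousOn (ContinuousOn.prodMk ?_ ?_)
  · have h2 : Continuous fun x : D => x.2.2 := by fun_prop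
    exact (continuous_tab_uncurried.comp (h2.prodMk hseg)).continuousOn
  · intro x hx
    have h2 : ContinuousAt (fun x : D => x.2.2) x := by fun_prop
    have h1 : ContinuousAt (fun x : D => hop (x.1.1 1) (x.1.2 1) (x.1.2 2)) x := by
      simpa only [Function.comp_def] using ((continuous_hop_apply 1).comp (continuous_fst (X :=
        (ℕ → Fin 2 → ℤ) × (ℕ → Plane)) (Y := ℝ × (Fin 2 → ℤ)))).continuousAt (x := x)
    have hx' := hx.1.1
    have h3 : ContinuousAt (fun x : D => dir (hop (x.1.1 1) (x.1.2 1) (x.1.2 2))) x :=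
      (continuousAt_dir (hop_ne_zero hs ((isWord_of_mem_wordHull he hx'.1).1 1).1 (hx'.2.1 1)
        (hx'.2.1 2))).comp (f := fun x : D => hop (x.1.1 1) (x.1.2 1) (x.1.2 2)) h1
    exact (continuous_flip_uncurried.continuousAt.comp (f := fun x : D =>
      (x.2.2, dir (hop (x.1.1 1) (x.1.2 1) (x.1.2 2)))) (h2.prodMk h3)).continuousWithinAt

lemma hullStates_subset (hO : IsObstacle O) (hs : IsSmall O) (he : IsWord O e) :
    ∀ q ∈ hullStates O e, q.1 ∈ square ∧ q.1 ∉ interior O ∧ ‖q.2‖ = 1 := by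
  rintro q ⟨p, hp, c, hc, k, hk, rfl⟩
  have hw := isWord_of_mem_wordHull he hp.1
  simp only
  rw [← fold_eq_tab hk]
  refine ⟨fold_mem_square _, hp.2.fold_notMem_interior hO hs hw 0 hc, ?_⟩
  rw [LinearIsometryEquiv.norm_map]
  exact norm_dir (hop_ne_zero hs (hw.1 1).1 (hp.2.1 1) (hp.2.1 2))

/-- The points of the phase space on the trajectories of the paths in the hull of `e`. -/
def hullSet (O : Set Plane) (e : ℕ → Fin 2 → ℤ) : Set (PhaseSpace O) :=
  Quot.mk _ '' (Subtype.val ⁻¹' hullStates O e : Set (State O))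

lemma isCompact_hullSet (hO : IsObstacle O) (hs : IsSmall O) (he : IsWord O e)
    {l : List (Fin 2 → ℤ)} (hl : ∀ n, e n ∈ l) : IsCompact (hullSet O e) := by
  refine IsCompact.image ?_ continuous_quot_mk
  rw [Subtype.isCompact_iff, image_preimage_eq_of_subset fun q hq =>
    ⟨⟨q, hullStates_subset hO hs he q hq⟩, rfl⟩]
  exact isCompact_hullStates hO hs he hl

/-- At a side of the square, the two ways of folding a state are glued. -/
lemma mk_tab_eq {x v : Plane} {k l : Fin 2 → ℤ} (hk : ∀ i, |x i - k i| ≤ 1 / 2)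
    (hl : ∀ i, |x i - l i| ≤ 1 / 2) {p q : State O} (hp : p.1 = (tab k x, flip k v))
    (hq : q.1 = (tab l x, flip l v)) : (Quot.mk _ p : PhaseSpace O) = Quot.mk _ q := by
  have step : ∀ (k l : Fin 2 → ℤ) (i : Fin 2), (∀ i, |x i - k i| ≤ 1 / 2) →
      (∀ i, |x i - l i| ≤ 1 / 2) → (∀ j, j ≠ i → k j = l j) → ∀ p q : State O,
      p.1 = (tab k x, flip k v) → q.1 = (tab l x, flip l v) →
      (Quot.mk _ p : PhaseSpace O) = Quot.mk _ q := by
    intro k l i hk hl hkl p q hp hq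
    by_cases hi : k i = l i
    · have : k = l := funext fun j => by
        by_cases hj : j = i
        · rw [hj, hi]
        · exact hkl j hj
      rw [Subtype.ext (hp.trans (by rw [this, hq]))]
    · have hpos : tab k x = tab l x := by rw [← fold_eq_tab hk, ← fold_eq_tab hl]
      have h1 := abs_le.1 (hk i)
      have h2 := abs_le.1 (hl i)
      have habs : |x i - k i| = 1 / 2 ∧ (l i = k i + 1 ∨ l i = k i - 1) := by
        rcases lt_or_gt_of_ne hi with h | h
        · have h3 : (k i : ℝ) + 1 ≤ l i := by exact_mod_cast h
          have h4 : x i - k i = 1 / 2 := by linarith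
          refine ⟨by rw [h4]; norm_num, Or.inl ?_⟩
          have : (l i : ℝ) = k i + 1 := by linarith
          exact_mod_cast this
        · have h3 : (l i : ℝ) + 1 ≤ k i := by exact_mod_cast h
          have h4 : x i - k i = -(1 / 2) := by linarith
          refine ⟨by rw [h4]; norm_num, Or.inr ?_⟩
          have : (l i : ℝ) = k i - 1 := by linarith
          exact_mod_cast this
      refine Quot.sound ⟨?_, Or.inr ⟨i, ?_, fun j => ?_⟩⟩
      · change p.1.1 = q.1.1
        rw [hp, hq]; exact hpos
      · change |p.1.1 i| = 1 / 2
        rw [hp]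
        change |tab k x i| = 1 / 2
        rw [tab_eq, flip_apply, abs_neg_one_zpow_mul]; exact habs.1
      · change q.1.2 j = if j = i then -p.1.2 j else p.1.2 j
        rw [hp, hq]
        simp only [flip_apply]
        split_ifs with hj
        · rw [hj]
          rcases habs.2 with h | h <;> rw [h]
          · rw [zpow_add₀ (by norm_num)]; simp
          · rw [zpow_sub₀ (by norm_num), zpow_one]; ring
        · rw [hkl j hj]
  -- Pass from `k` to `l` one coordinate at a time: at a vertex this uses two gluings through an
  -- intermediate cell.
  set m : Fin 2 → ℤ := Function.update k 0 (l 0) with hm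
  have hmi : ∀ i, |x i - m i| ≤ 1 / 2 := fun i => by
    by_cases hi : i = 0
    · rw [hi, hm, Function.update_self]; exact hl 0
    · rw [hm, Function.update_of_ne hi]; exact hk i
  have hmp : tab m x = tab k x := by rw [← fold_eq_tab hk, ← fold_eq_tab hmi]
  have hr : tab m x ∈ square ∧ tab m x ∉ interior O ∧ ‖flip m v‖ = 1 := by
    have h1 := p.2
    rw [hp] at h1
    rw [hmp, LinearIsometryEquiv.norm_map]
    exact ⟨h1.1, h1.2.1, by simpa using h1.2.2⟩
  refine (step k m 0 hk hmi (fun j hj => by rw [hm, Function.update_of_ne hj]) p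
    ⟨(tab m x, flip m v), hr⟩ hp rfl).trans (step m l 1 hmi hl (fun j hj => ?_) _ q rfl hq)
  have : j = 0 := by omega
  rw [this, hm, Function.update_self]

variable (hO : IsObstacle O) (hs : IsSmall O)
include hO hs

lemma mk_pathState_mem (hw : IsWord O e') (hy : IsInfChain O e' y')
    (h : e' ∈ wordHull e) {t : ℝ} (ht : 0 ≤ t) :
    Quot.mk _ (pathState hO hs hw hy t) ∈ hullSet O e := by
  obtain ⟨n, hn⟩ := exists_mem_Ico hs hw hy ht
  refine mem_image_of_mem _ ?_
  rw [mem_preimage, pathState_eq hO hs hw hy hn]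
  have hc := div_mem_Icc (strictMono_pathTime hs hw hy n.lt_succ_self) ⟨hn.1, hn.2.le⟩
  set p : (ℕ → Fin 2 → ℤ) × (ℕ → Plane) := (fun i => e' (n + i), fun i => y' (n + i)) with hp
  set c := (t - pathTime e' y' n) / (pathTime e' y' (n + 1) - pathTime e' y' n)
  have hk := cellsAhead_spec_self (segPt p c) (dir (hop (p.1 1) (p.2 1) (p.2 2)))
  refine ⟨p, ⟨shift_mem_wordHull h n, hy.shift n⟩, c, hc, _, hk, ?_⟩
  rw [← fold_eq_tab hk]
  rfl

/-- For a parameter below `1`, the state differs from one on the trajectory at most by the choice of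
the cell. At the parameter `1` it carries the velocity before the bounce, which is glued to the
velocity after it. -/
lemma exists_of_mem_hullSet (he : IsWord O e) {q : PhaseSpace O} (hq : q ∈ hullSet O e) :
    ∃ (e' : ℕ → Fin 2 → ℤ) (y' : ℕ → Plane) (hw : IsWord O e') (hy : IsInfChain O e' y'),
      e' ∈ wordHull e ∧ ∃ a, 0 ≤ a ∧ q = Quot.mk _ (pathState hO hs hw hy a) := by
  obtain ⟨r, ⟨⟨e', y'⟩, ⟨hhull, hy⟩, c, hc, k, hk, hr⟩, rfl⟩ := hq
  have hw := isWord_of_mem_wordHull he hhull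
  have ht1 : pathTime e' y' 1 = ‖hop (e' 1) (y' 1) (y' 2)‖ := by rw [pathTime_succ]; simp
  have hpos : 0 < ‖hop (e' 1) (y' 1) (y' 2)‖ :=
    norm_pos_iff.2 (hop_ne_zero hs (hw.1 1).1 (hy.1 1) (hy.1 2))
  refine ⟨e', y', hw, hy, hhull, c * ‖hop (e' 1) (y' 1) (y' 2)‖, mul_nonneg hc.1 hpos.le, ?_⟩
  rcases hc.2.lt_or_eq with h1 | rfl
  · have hmem : c * ‖hop (e' 1) (y' 1) (y' 2)‖ ∈ Ico (pathTime e' y' 0) (pathTime e' y' (0 + 1)) := by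
      rw [zero_add, pathTime_zero, ht1]
      exact ⟨mul_nonneg hc.1 hpos.le, by nlinarith⟩
    have h2 := pathState_eq hO hs hw hy hmem
    rw [zero_add, pathTime_zero, ht1, sub_zero, sub_zero, mul_div_cancel_right₀ _ hpos.ne'] at h2
    refine mk_tab_eq hk (cellsAhead_spec_self (segPt (e', y') c) (dir (hop (e' 1) (y' 1) (y' 2)))) hr
      (h2.trans ?_)
    rw [← fold_eq_tab (cellsAhead_spec_self (segPt (e', y') c) (dir (hop (e' 1) (y' 1) (y' 2))))]
    rfl
  · rw [one_mul]
    have h3 : segPt (e', y') 1 = (tab (e' 1)).symm (y' 2) := by rw [segPt, one_smul, add_hop]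
    have hk1 : k = e' 1 := by
      ext i
      have h4 := abs_le.1 (hk i)
      have h5 := abs_lt.1 (abs_sub_lt_of_mem_copy hs (k := e' 1)
        (x := segPt (e', y') 1) (by rw [h3]; exact tab_symm_mem_copy.2 (hy.1 2)) i)
      have h6 : (k i : ℝ) < e' 1 i + 1 := by linarith
      have h7 : (e' 1 i : ℝ) < k i + 1 := by linarith
      have h6 : k i < e' 1 i + 1 := by exact_mod_cast h6
      have h7 : e' 1 i < k i + 1 := by exact_mod_cast h7
      omega
    have hr1 : r.1 = (y' 2, dir (flip (e' 1) (hop (e' 1) (y' 1) (y' 2)))) := by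
      rw [hr, hk1, h3, AffineIsometryEquiv.apply_symm_apply, dir_flip]
    have hmem : ‖hop (e' 1) (y' 1) (y' 2)‖ ∈ Ico (pathTime e' y' 1) (pathTime e' y' (1 + 1)) := by
      rw [← ht1]; exact ⟨le_rfl, strictMono_pathTime hs hw hy (by norm_num)⟩
    have h2 := pathState_eq hO hs hw hy hmem
    rw [ht1, sub_self, zero_div, zero_smul, add_zero] at h2
    have h4 : ∀ v, foldVel (y' 2) v = v := fun v => by
      rw [foldVel_of_abs_lt (k := 0) (abs_sub_lt_of_mem_copy hs (by rw [copy_zero]; exact hy.1 2))]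
      ext i; simp
    have h5 : fold (y' 2) = y' 2 := by
      rw [fold_of_mem_copy hs (k := 0) (by rw [copy_zero]; exact hy.1 2), tab_zero]
    obtain ⟨m, hm, -, h6, -⟩ := (hy.2 1).exists_normal hO hs (hw.1 1).1 (hw.1 2).1 (hw.2 1)
      (hy.1 1) (hy.1 2) (hy.1 3)
    refine Quot.sound ⟨?_, Or.inl ⟨?_, m, ?_, ?_⟩⟩
    · change r.1.1 = (pathState hO hs hw hy _).1.1
      rw [h2, hr1]; exact h5.symm
    · change r.1.1 ∈ _
      rw [hr1]; exact hy.mem_frontier hO hs hw 1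
    · change IsOuterNormal O r.1.1 m
      rw [hr1]; exact hm
    · change (pathState hO hs hw hy _).1.2 = r.1.2 - (2 * inner ℝ r.1.2 m) • m
      rw [h2, hr1]
      simp only
      rw [h4]; exact h6

/-- A balanced word gives a compact forward invariant set of trajectories with the same rotation
number. -/
lemma exists_forwardInvariant {z : Plane} (hz : z ∈ interior O) {u : ℝ} (he : IsWord O e)
    {l : List (Fin 2 → ℤ)} (hl : ∀ n, e n ∈ l) (hne : ∃ y, IsInfChain O e y)
    (hb : IsBalanced O z u e) :
    ∃ Y : Set (PhaseSpace O), Y.Nonempty ∧ IsCompact Y ∧ IsForwardInvariantSet Y ∧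
      ∀ y ∈ Y, ∀ γ, IsTrajectoryFrom y γ → HasAdmissibleType O γ ∧ HasRotationNumber z γ u := by
  obtain ⟨y, hy⟩ := hne
  -- Uniqueness of trajectories reduces every trajectory from `q` to one given by a path in the
  -- hull.
  have key : ∀ q ∈ hullSet O e, ∃ (e' : ℕ → Fin 2 → ℤ) (y' : ℕ → Plane) (hw : IsWord O e')
      (hy : IsInfChain O e' y'), e' ∈ wordHull e ∧ ∃ a, 0 ≤ a ∧
        IsTrajectoryFrom q (fun t => pathState hO hs hw hy (a + t)) ∧
        ∀ γ, IsTrajectoryFrom q γ → ∀ t, 0 ≤ t → pathState hO hs hw hy (a + t) = γ t := by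
    intro q hq
    obtain ⟨e', y', hw, hy', hhull, a, ha, rfl⟩ := exists_of_mem_hullSet hO hs he hq
    have htr := (isTrajectory_pathState hO hs hw hy').shift ha
    refine ⟨e', y', hw, hy', hhull, a, ha, ⟨htr, by simp only [add_zero]⟩, fun γ hγ t ht => ?_⟩
    exact htr.eq_of_mk_eq hO hs hγ.1 (by simp only [hγ.2, add_zero]) ht
  refine ⟨hullSet O e, ⟨_, mk_pathState_mem hO hs he hy self_mem_wordHull le_rfl⟩,
    isCompact_hullSet hO hs he hl, fun q hq => ?_, fun q hq γ hγ => ?_⟩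
  · obtain ⟨e', y', hw, hy', hhull, a, ha, h1, h2⟩ := key q hq
    refine ⟨⟨_, h1⟩, fun γ hγ t ht => ?_⟩
    rw [← h2 γ hγ t ht]
    exact mk_pathState_mem hO hs hw hy' hhull (add_nonneg ha ht)
  · obtain ⟨e', y', hw, hy', hhull, a, ha, h1, h2⟩ := key q hq
    refine ⟨(hasAdmissibleType_pathState hO hs hw hy' ha).congr (h2 γ hγ), ?_⟩
    refine HasRotationNumber.congr ?_ (h2 γ hγ)
    obtain ⟨C, hC⟩ := hb
    obtain ⟨C', hC0, hC'⟩ := exists_abs_disp_le hz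
    obtain ⟨H, hH⟩ : ∃ H : ℝ, ∀ a ∈ l, ‖center a‖ ≤ H := by
      obtain ⟨H, hH⟩ := (l.toFinset.image fun a => ‖center a‖).bddAbove
      exact ⟨H, fun a ha => hH (by simpa using ⟨a, by simpa using ha, rfl⟩)⟩
    refine hasRotationNumber_pathState hO hs hw hy' hz (R := H + 1) (C := C) (fun n => ?_)
      (fun n => ?_) ha
    · refine (norm_hop_le hs (hy'.1 _) (hy'.1 _)).trans ?_
      linarith [hH _ (mem_of_mem_wordHull hl hhull (n + 1))]
    -- Each finite part of the path has a word occurring in `e`, where the balance bound is uniform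
    -- in position and length.
    · obtain ⟨m, hm⟩ := hhull (n + 1)
      exact hC (m + 1) n _ _ (hy'.isPath hO hs hw n) fun i hi => by
        rw [hm (i + 1) (by omega)]; congr 1; omega

end

end SquareBilliard

namespace SquareBilliard

/-! ### Small obstacles -/

/-- Along two curves whose values always make an acute angle, the angle changes by almost the same
amount. -/
lemma IsLift.abs_sub_sub_le {α : Type*} [TopologicalSpace α] {S : Set α} {f g : α → ℂ}
    {θ η : α → ℝ} (hS : IsPreconnected S) (hf : ContinuousOn f S) (hg : ContinuousOn g S)
    (h : IsLift f θ S) (h' : IsLift g η S)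
    (hre : ∀ x ∈ S, 0 < ((starRingEnd ℂ) (g x) * f x).re) {x y : α} (hx : x ∈ S) (hy : y ∈ S) :
    |(θ y - θ x) - (η y - η x)| ≤ 1 / 2 := by
  have hg0 : ∀ x ∈ S, g x ≠ 0 := fun x hx h0 => by have := hre x hx; simp [h0] at this
  have hf0 : ∀ x ∈ S, f x ≠ 0 := fun x hx h0 => by have := hre x hx; simp [h0] at this
  have hq : ∀ x ∈ S, 0 < (f x / g x).re := fun x hx => by
    have h1 := hre x hx
    have h2 := Complex.normSq_pos.2 (hg0 x hx)
    rw [Complex.div_re, ← add_div]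
    refine div_pos ?_ h2
    simp only [Complex.mul_re, Complex.conj_re, Complex.conj_im] at h1
    linarith
  have h1 : IsLift (fun x => f x / g x) (fun x => (f x / g x).arg / (2 * Real.pi)) S :=
    isLift_arg.comp (u := fun x => f x / g x) (hf.div hg hg0) fun x hx => Or.inl (hq x hx)
  have h2 : IsLift f (fun x => η x + (f x / g x).arg / (2 * Real.pi)) S :=
    (h'.mul h1).congr fun x hx => by rw [mul_div_cancel₀ _ (hg0 x hx)]
  have h3 := h.sub_eq hS h2 hf0 hx hy
  have h4 : ∀ x ∈ S, |(f x / g x).arg / (2 * Real.pi)| ≤ 1 / 4 := fun x hx => by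
    have h5 := Complex.abs_arg_le_pi_div_two_iff.2 (hq x hx).le
    have hpi := Real.pi_pos
    rw [abs_div, abs_of_pos (by positivity : 0 < 2 * Real.pi), div_le_iff₀ (by positivity)]
    linarith
  have h5 := abs_le.1 (h4 x hx)
  have h6 := abs_le.1 (h4 y hy)
  rw [h3, abs_le]
  constructor <;> linarith

/-- The angle changes by at most a half turn while the unfolded path stays in one cell. -/
lemma IsLift.abs_sub_le_of_cell {z x v : Plane} {k : Fin 2 → ℤ}
    (hk : ∀ t ∈ Icc (0 : ℝ) 1, ∀ i, |(x + t • v) i - k i| ≤ 1 / 2) (ha : Avoids z x v) {θ : ℝ → ℝ}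
    (h : IsLift (fun t : ℝ => foldC z (x + t • v)) θ (Icc 0 1)) : |θ 1 - θ 0| ≤ 1 / 2 := by
  have e : ∀ t ∈ Icc (0 : ℝ) 1, fold (x + t • v) - z = tab k x - z + t • flip k v := fun t ht => by
    rw [fold_eq_tab (hk t ht), tab_add_smul]; abel
  have h0 : ∀ t ∈ Icc (0 : ℝ) 1, fold (x + t • v) - z ≠ 0 := fun t ht => sub_ne_zero.2 (ha t ht)
  obtain ⟨η, hη, ho⟩ := exists_isLift_segment (p := tab k x - z) (v := flip k v)
    fun t ht => e t ht ▸ h0 t ht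
  rw [h.sub_eq isPreconnected_Icc (hη.congr fun t ht => by rw [foldC, e t ht])
    (fun t ht => by rw [foldC, Ne, toC_eq_zero]; exact h0 t ht) (left_mem_Icc.2 zero_le_one)
    (right_mem_Icc.2 zero_le_one)]
  exact ho

/-- Folding the line is a triangle wave in phase with `sin (π t)`: with respect to the nearest
integer both acquire the same sign, and it cancels in the product. -/
lemma foldLine_mul_sin_pos {t : ℝ} (h : foldLine t ≠ 0) : 0 < foldLine t * Real.sin (Real.pi * t) := by
  have hd := abs_le.1 (abs_sub_round t)
  set d := t - round t with hdef
  have hpi := Real.pi_pos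
  have h1 : Real.sin (Real.pi * t) = (-1) ^ round t * Real.sin (Real.pi * d) := by
    rw [← Real.sin_add_int_mul_pi, hdef]; congr 1; ring
  have h2 : foldLine t * Real.sin (Real.pi * t) = d * Real.sin (Real.pi * d) := by
    rw [h1, foldLine, ← hdef]
    linear_combination (d * Real.sin (Real.pi * d)) * neg_one_zpow_mul_self (round t)
  have h3 : d ≠ 0 := fun h0 => h (by rw [foldLine, ← hdef, h0, mul_zero])
  rw [h2]
  rcases h3.lt_or_gt with h4 | h4
  · exact mul_pos_of_neg_of_neg h4 (Real.sin_neg_of_neg_of_neg_pi_lt (by nlinarith) (by nlinarith))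
  · exact mul_pos h4 (Real.sin_pos_of_pos_of_lt_pi (by positivity) (by nlinarith))

/-- A curve that stays between two adjacent diagonal lines through the lattice turns once around the
origin, after folding, while its mean coordinate increases by two. -/
lemma IsLift.abs_sub_le_of_diagonal {q : ℝ → Plane} {z : Plane} {s r ρ σ : ℝ} (hsr : s ≤ r)
    (hq : ContinuousOn q (Icc s r)) (hz : ‖z‖ ≤ ρ) (hσ : 2 * ρ < σ)
    (hd : ∀ t ∈ Icc s r, σ ≤ q t 1 - q t 0 ∧ q t 1 - q t 0 ≤ 1 - σ) {θ : ℝ → ℝ}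
    (h : IsLift (fun t => foldC z (q t)) θ (Icc s r)) :
    |θ r - θ s + ((q r 0 + q r 1) / 2 - (q s 0 + q s 1) / 2) / 2| ≤ 3 / 2 := by
  have hρ : 0 ≤ ρ := (norm_nonneg z).trans hz
  -- Otherwise both coordinates would be within `ρ` of integers whose difference lies strictly
  -- between `0` and `1`.
  have hnorm : ∀ t ∈ Icc s r, ρ < ‖fold (q t)‖ := fun t ht => by
    by_contra! hc
    have h1 : ∀ i, |q t i - round (q t i)| ≤ ρ := fun i => by
      rw [← abs_foldLine]; exact (abs_apply_le_norm (fold (q t)) i).trans hc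
    have h2 := abs_le.1 (h1 0)
    have h3 := abs_le.1 (h1 1)
    obtain ⟨h4, h5⟩ := hd t ht
    have h6 : ((0 : ℤ) : ℝ) < (round (q t 1) - round (q t 0) : ℤ) := by push_cast; linarith
    have h7 : ((round (q t 1) - round (q t 0) : ℤ) : ℝ) < (1 : ℤ) := by push_cast; linarith
    have h6 := Int.cast_lt.1 h6
    have h7 := Int.cast_lt.1 h7
    omega
  have hq0 : ContinuousOn (fun t => q t 0) (Icc s r) := by fun_prop
  have hq1 : ContinuousOn (fun t => q t 1) (Icc s r) := by fun_prop
  set A : ℝ → ℝ := fun t => (q t 0 + q t 1) / 2 with hA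
  have hAc : ContinuousOn A (Icc s r) := by fun_prop
  -- Deform the folded curve in three steps into a vector rotating uniformly with the mean
  -- coordinate: drop `z`, replace the triangle waves by sines, and replace the sines by `(-1 + i)
  -- exp (-iπA)`. At each step the values form an acute angle, so each costs at most half a turn.
  set f₁ : ℝ → ℂ := fun t => toC (fold (q t)) with hf₁
  set f₂ : ℝ → ℂ := fun t => toC !₂[Real.sin (Real.pi * q t 0), Real.sin (Real.pi * q t 1)] with hf₂
  set f₃ : ℝ → ℂ := fun t => (-1 + Complex.I) *
    Complex.exp (2 * Real.pi * (-(A t / 2) : ℝ) * Complex.I) with hf₃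
  have hc₀ : ContinuousOn (fun t => foldC z (q t)) (Icc s r) :=
    (continuous_foldC z).comp_continuousOn hq
  have hc₁ : ContinuousOn f₁ (Icc s r) := (continuous_toC.comp continuous_fold).comp_continuousOn hq
  have hc₂ : ContinuousOn f₂ (Icc s r) := by
    refine continuous_toC.comp_continuousOn ?_
    refine (PiLp.continuous_toLp 2 _).comp_continuousOn (continuousOn_pi.2 fun i => ?_)
    fin_cases i <;> simp <;> fun_prop
  have hc₃ : ContinuousOn f₃ (Icc s r) := by fun_prop
  have hre₀ : ∀ t ∈ Icc s r, 0 < ((starRingEnd ℂ) (f₁ t) * foldC z (q t)).re := fun t ht => by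
    rw [foldC, conj_toC_mul_toC_re, inner_sub_right, real_inner_self_eq_norm_sq]
    have h1 := hnorm t ht
    have h2 := real_inner_le_norm (fold (q t)) z
    nlinarith
  have hre₁ : ∀ t ∈ Icc s r, 0 < ((starRingEnd ℂ) (f₂ t) * f₁ t).re := fun t ht => by
    rw [conj_toC_mul_toC_re, inner_plane]
    simp only [fold_apply]
    have hnn : ∀ x, 0 ≤ foldLine x * Real.sin (Real.pi * x) := fun x => by
      by_cases hx : foldLine x = 0
      · rw [hx, zero_mul]
      · exact (foldLine_mul_sin_pos hx).le
    have h0 := hnn (q t 0)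
    have h1 := hnn (q t 1)
    have hne : foldLine (q t 0) ≠ 0 ∨ foldLine (q t 1) ≠ 0 := by
      by_contra! hc
      refine (hρ.trans_lt (hnorm t ht)).ne' (norm_eq_zero.2 ?_)
      ext i; fin_cases i
      exacts [hc.1, hc.2]
    simp
    rcases hne with h2 | h2
    · linarith [foldLine_mul_sin_pos h2]
    · linarith [foldLine_mul_sin_pos h2]
  have hre₂ : ∀ t ∈ Icc s r, 0 < ((starRingEnd ℂ) (f₃ t) * f₂ t).re := fun t ht => by
    have e1 : f₃ t = ⟨Real.sin (Real.pi * A t) - Real.cos (Real.pi * A t),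
        Real.sin (Real.pi * A t) + Real.cos (Real.pi * A t)⟩ := by
      have : (2 * Real.pi * (-(A t / 2) : ℝ) * Complex.I : ℂ) =
          ((-(Real.pi * A t) : ℝ) : ℂ) * Complex.I := by push_cast; ring
      rw [hf₃]
      simp only
      rw [this]
      apply Complex.ext
      · rw [Complex.mul_re, Complex.exp_ofReal_mul_I_re, Complex.exp_ofReal_mul_I_im]
        simp; ring
      · rw [Complex.mul_im, Complex.exp_ofReal_mul_I_re, Complex.exp_ofReal_mul_I_im]
        simp
    set b := (q t 1 - q t 0) / 2 with hb
    have e2 : Real.pi * q t 0 = Real.pi * A t - Real.pi * b := by rw [hA, hb]; ring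
    have e3 : Real.pi * q t 1 = Real.pi * A t + Real.pi * b := by rw [hA, hb]; ring
    have hb0 : 0 < b := by rw [hb]; linarith [(hd t ht).1]
    have hb1 : b < 1 / 2 := by rw [hb]; linarith [(hd t ht).2]
    have hpi := Real.pi_pos
    have hsb : 0 < Real.sin (Real.pi * b) :=
      Real.sin_pos_of_pos_of_lt_pi (by positivity) (by nlinarith)
    have hcb : 0 < Real.cos (Real.pi * b) := Real.cos_pos_of_mem_Ioo ⟨by nlinarith, by nlinarith⟩
    have e4 : ((starRingEnd ℂ) (f₃ t) * f₂ t).re =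
        2 * (Real.sin (Real.pi * A t) ^ 2 * Real.cos (Real.pi * b) +
          Real.cos (Real.pi * A t) ^ 2 * Real.sin (Real.pi * b)) := by
      rw [e1, hf₂]
      simp only [Complex.mul_re, Complex.conj_re, Complex.conj_im, toC_re, toC_im]
      simp [e2, e3, Real.sin_add, Real.sin_sub]
      ring
    rw [e4]
    have h1 := Real.sin_sq_add_cos_sq (Real.pi * A t)
    have h2 := sq_nonneg (Real.sin (Real.pi * A t))
    have h3 := sq_nonneg (Real.cos (Real.pi * A t))
    rcases h2.eq_or_lt with h4 | h4
    · rw [← h4] at h1 ⊢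
      have : 0 < Real.cos (Real.pi * A t) ^ 2 := by linarith
      positivity
    · positivity
  obtain ⟨θ₁, hθ₁⟩ := exists_isLift (convex_Icc s r) hc₁ fun t ht h0 => by
    have := hre₀ t ht; simp [h0] at this
  obtain ⟨θ₂, hθ₂⟩ := exists_isLift (convex_Icc s r) hc₂ fun t ht h0 => by
    have := hre₁ t ht; simp [h0] at this
  have hθ₃ := IsLift.const_mul (S := Icc s r) (θ := fun t => -(A t / 2))
    (f := fun t => Complex.exp (2 * Real.pi * (-(A t / 2) : ℝ) * Complex.I))
    ⟨by fun_prop, fun t _ => by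
      have : (2 * Real.pi * (-(A t / 2) : ℝ) * Complex.I : ℂ) =
          ((2 * Real.pi * (-(A t / 2)) : ℝ) : ℂ) * Complex.I := by push_cast; ring
      simp only
      rw [this, Complex.norm_exp_ofReal_mul_I]; simp⟩ (-1 + Complex.I)
  have hs := left_mem_Icc.2 hsr
  have hr := right_mem_Icc.2 hsr
  have h1 := abs_le.1 (h.abs_sub_sub_le isPreconnected_Icc hc₀ hc₁ hθ₁ hre₀ hs hr)
  have h2 := abs_le.1 (hθ₁.abs_sub_sub_le isPreconnected_Icc hc₁ hc₂ hθ₂ hre₁ hs hr)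
  have h3 := abs_le.1 (hθ₂.abs_sub_sub_le isPreconnected_Icc hc₂ hc₃ hθ₃ hre₂ hs hr)
  change |θ r - θ s + (A r - A s) / 2| ≤ 3 / 2
  rw [abs_le]
  constructor <;> linarith

/-- A segment from the center of a cell to the center of the cell `(N, N + 1)` away from it turns
around the center about `N / 2` times, after folding. -/
lemma disp_le_of_diagonal {N : ℕ} {ρ : ℝ} (hρ : ρ * (32 * (N + 1)) = 1) {z x v : Plane}
    (hz : ‖z‖ ≤ ρ) (hx : ‖x‖ ≤ ρ) (hv : ‖x + v - center ![(N : ℤ), N + 1]‖ ≤ ρ)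
    (ha : Avoids z x v) : disp z x v ≤ -(N / 2) + 3 := by
  obtain ⟨θ, hθ⟩ := exists_isLift (convex_Icc (0 : ℝ) 1) (f := fun t => foldC z (x + t • v))
    ((continuous_foldC z).comp (f := fun t : ℝ => x + t • v) (by fun_prop)).continuousOn
    fun t ht => by rw [foldC, Ne, toC_eq_zero, sub_eq_zero]; exact ha t ht
  have hN : (0 : ℝ) ≤ N := N.cast_nonneg
  have hρ0 : 0 < ρ := by
    by_contra! hc; nlinarith
  have hρ1 : ρ ≤ 1 / 32 := by nlinarith
  have hx0 := abs_le.1 ((abs_apply_le_norm x 0).trans hx)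
  have hx1 := abs_le.1 ((abs_apply_le_norm x 1).trans hx)
  have hv0 := abs_le.1 ((abs_apply_le_norm _ 0).trans hv)
  have hv1 := abs_le.1 ((abs_apply_le_norm _ 1).trans hv)
  simp at hv0 hv1
  have hrest : ∀ {s r : ℝ}, 0 ≤ s → 0 ≤ r → s + r ≤ 1 → Avoids z (x + s • v) (r • v) ∧
      IsLift (fun t : ℝ => foldC z (x + s • v + t • (r • v))) (fun t => θ (s + t * r)) (Icc 0 1) := by
    intro s r hs hr hsr
    have hmap : MapsTo (fun t => s + t * r) (Icc 0 1) (Icc 0 1) := fun t ht =>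
      ⟨by nlinarith [ht.1], by nlinarith [ht.2]⟩
    have hpt : ∀ t : ℝ, x + s • v + t • (r • v) = x + (s + t * r) • v := fun t => by
      rw [add_smul, smul_smul]; abel
    refine ⟨fun t ht => hpt t ▸ ha _ (hmap ht), ?_⟩
    simp_rw [hpt]
    exact hθ.comp (u := fun t => s + t * r) (by fun_prop) hmap
  -- At the parameter `t` the difference of the coordinates is within `2ρ` of `t`, so between `8ρ`
  -- and `1 - 8ρ` it keeps the distance `6ρ` from `0` and `1`. The two end pieces stay in the end
  -- cells and turn by at most half a turn each.
  set t₀ := 8 * ρ with ht₀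
  have h1 := hrest (s := 0) (r := t₀) le_rfl (by positivity) (by linarith)
  have h2 := hrest (s := 1 - t₀) (r := t₀) (by linarith) (by positivity) (by linarith)
  have hvle : ∀ i, |t₀ * v i| ≤ 1 / 4 + 1 / 8 := by
    intro i
    have : |v i| ≤ N + 1 + 2 * ρ := by
      rw [abs_le]
      fin_cases i <;> constructor <;> simp <;> linarith
    rw [abs_mul, abs_of_pos (by positivity : 0 < t₀), ht₀]
    nlinarith
  have hxle : ∀ i, |x i| ≤ 1 / 32 := fun i => ((abs_apply_le_norm x i).trans hx).trans hρ1
  have hyle : ∀ i, |x i + v i - (![(N : ℤ), N + 1] i : ℤ)| ≤ 1 / 32 := fun i =>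
    ((abs_apply_le_norm _ i).trans hv).trans hρ1
  have e1 := IsLift.abs_sub_le_of_cell (k := 0) (fun t ht i => by
    have h3 : (x + (0 : ℝ) • v + t • (t₀ • v)) i - ((0 : Fin 2 → ℤ) i : ℝ) = x i + t * (t₀ * v i) := by
      simp
    rw [h3]
    refine (abs_add_le _ _).trans ?_
    rw [abs_mul, abs_of_nonneg ht.1]
    nlinarith [hxle i, hvle i, ht.1, ht.2, abs_nonneg (t₀ * v i)]) h1.1 h1.2
  have e2 := IsLift.abs_sub_le_of_cell (k := ![(N : ℤ), N + 1]) (fun t ht i => by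
    have h3 : (x + (1 - t₀) • v + t • (t₀ • v)) i - ((![(N : ℤ), N + 1] : Fin 2 → ℤ) i : ℝ) =
        (x i + v i - (![(N : ℤ), N + 1] i : ℤ)) - (1 - t) * (t₀ * v i) := by
      simp only [PiLp.add_apply, PiLp.smul_apply, smul_eq_mul]; ring
    rw [h3]
    refine (abs_sub _ _).trans ?_
    rw [abs_mul, abs_of_nonneg (sub_nonneg.2 ht.2)]
    nlinarith [hyle i, hvle i, ht.1, ht.2, abs_nonneg (t₀ * v i)]) h2.1 h2.2
  have e3 := (hθ.mono (Icc_subset_Icc (by linarith) (by linarith) :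
    Icc t₀ (1 - t₀) ⊆ Icc 0 1)).abs_sub_le_of_diagonal (σ := 6 * ρ) (by linarith) (by fun_prop) hz
    (by linarith) fun t ht => by
      have ht0 := ht.1
      have ht1 := ht.2
      simp only [PiLp.add_apply, PiLp.smul_apply, smul_eq_mul]
      constructor <;> nlinarith
  simp only [PiLp.add_apply, PiLp.smul_apply, smul_eq_mul] at e3
  rw [← hθ.disp_eq ha]
  simp only [zero_mul, zero_add, one_mul, add_zero, sub_add_cancel] at e1 e2
  have e1 := (abs_le.1 e1).2
  have e2 := (abs_le.1 e2).2
  have e3 := (abs_le.1 e3).2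
  have e4 : (N : ℝ) - 1 ≤ (x 0 + (1 - t₀) * v 0 + (x 1 + (1 - t₀) * v 1)) / 2 -
      (x 0 + t₀ * v 0 + (x 1 + t₀ * v 1)) / 2 := by
    have e5 : 2 * (N : ℝ) + 1 - 4 * ρ ≤ v 0 + v 1 := by linarith
    have e6 : (1 - 2 * t₀) * (2 * (N : ℝ) + 1 - 4 * ρ) ≤ (1 - 2 * t₀) * (v 0 + v 1) :=
      mul_le_mul_of_nonneg_left e5 (by linarith)
    nlinarith
  linarith

section
variable {O : Set Plane} {N : ℕ} {ρ : ℝ}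

/-- For a cell `j` in between, `j 0 (N + 1) - j 1 N` is an integer of absolute value less than `1`,
hence zero, and `j` is the multiple of `(N, N + 1)` by `j 1 - j 0`. This factor is too close to `[0,
1]` to be anything but `0` or `1`. -/
lemma isStep_diagonal (hρ : ρ * (32 * (N + 1)) = 1) (hO : ∀ x ∈ O, ‖x‖ < ρ) :
    IsStep O ![(N : ℤ), N + 1] := by
  have hN : (0 : ℝ) ≤ N := N.cast_nonneg
  have hρ0 : 0 < ρ := by
    by_contra! hc; nlinarith
  refine ⟨fun h0 => ?_, fun j hj => ?_⟩
  · have := congrFun h0 1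
    simp at this
    omega
  · obtain ⟨t, ht, h1⟩ := hj.near hO
    have hd0 := abs_lt.1 ((abs_apply_le_norm _ 0).trans_lt h1)
    have hd1 := abs_lt.1 ((abs_apply_le_norm _ 1).trans_lt h1)
    simp at hd0 hd1
    have hc1 : ((j 0 * (N + 1) - j 1 * N : ℤ) : ℝ) < (1 : ℤ) := by push_cast; nlinarith
    have hc2 : ((-1 : ℤ) : ℝ) < (j 0 * (N + 1) - j 1 * N : ℤ) := by push_cast; nlinarith
    have hc1 := Int.cast_lt.1 hc1
    have hc2 := Int.cast_lt.1 hc2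
    have hm1 : ((-1 : ℤ) : ℝ) < (j 1 - j 0 : ℤ) := by push_cast; nlinarith [ht.1]
    have hm2 : ((j 1 - j 0 : ℤ) : ℝ) < (2 : ℤ) := by push_cast; nlinarith [ht.2]
    have hm1 := Int.cast_lt.1 hm1
    have hm2 := Int.cast_lt.1 hm2
    have h3 : j 0 = (j 1 - j 0) * N := by linarith
    obtain h4 | h4 : j 1 - j 0 = 0 ∨ j 1 - j 0 = 1 := by omega
    · refine hj.1 (funext fun i => ?_)
      rw [h4, zero_mul] at h3
      fin_cases i
      · exact h3
      · change j 1 = 0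
        omega
    · refine hj.2.1 (funext fun i => ?_)
      rw [h4, one_mul] at h3
      fin_cases i
      · exact h3
      · change j 1 = N + 1
        omega

/-- For even `N` the step reflects only the second coordinate of the frame, so the previous cell is
seen at `(-N, N + 1)`, and its product with `(N, N + 1)` is `2N + 1`. -/
lemma isTurn_diagonal (hs : IsSmall O) (hN : Even N) :
    IsTurn O ![(N : ℤ), N + 1] ![(N : ℤ), N + 1] := by
  have h0 : (![(N : ℤ), N + 1] : Fin 2 → ℤ) ≠ 0 := fun h0 => by
    have := congrFun h0 1
    simp at this
    omega
  have hN' : Even (N : ℤ) := by exact_mod_cast hN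
  refine isTurn_of_inner hs h0 h0 ?_
  rw [relCell, center_intFlip, inner_plane]
  simp [hN'.neg_one_zpow, hN'.add_one.neg_one_zpow]
  nlinarith [(N.cast_nonneg : (0 : ℝ) ≤ N)]

/-- A small obstacle has an admissible periodic orbit that is almost parallel to a diagonal. -/
lemma exists_periodicRotationNumber_le (hO : IsObstacle O) (hs : IsSmall O)
    (hρ : ρ * (32 * (N + 1)) = 1) (hOρ : ∀ x ∈ O, ‖x‖ < ρ) (hN : Even N) (hN6 : 6 ≤ N)
    {z : Plane} (hz : z ∈ interior O) :
    ∃ r ∈ periodicRotationNumbers O z, r * (√2 * (N + 1) + 1) ≤ -(N / 2) + 3 := by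
  set a : Fin 2 → ℤ := ![(N : ℤ), N + 1] with ha
  set e : ℕ → Fin 2 → ℤ := fun _ => a with he
  have hstep : IsStep O a := isStep_diagonal hρ hOρ
  have hw : IsWord O e := ⟨fun _ => hstep, fun _ => isTurn_diagonal hs hN⟩
  -- The word is constant, but periodic chains are available only for periods of at least two.
  have hper : Function.Periodic e 2 := fun _ => rfl
  obtain ⟨y, hyp, hy⟩ := exists_periodic_chain hO hs (fun n => (hw.1 n).1) le_rfl hper
  have hy : IsInfChain O e y := ⟨fun n => (hy n).1 n le_rfl, fun n => (hy (n + 2)).2 n (by omega)⟩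
  refine ⟨_, mem_periodicRotationNumbers hO hs hw hy hz two_pos hper hyp, ?_⟩
  have hcenter : ‖center a‖ ≤ √2 * (N + 1) := by
    rw [← abs_of_nonneg (by positivity : 0 ≤ √2 * ((N : ℝ) + 1)), ← abs_norm, ← sq_le_sq, mul_pow,
      Real.sq_sqrt (by norm_num), norm_sq_plane]
    simp [ha]
    nlinarith [(N.cast_nonneg : (0 : ℝ) ≤ N)]
  have hL : pathLength e y 2 ≤ 2 * (√2 * (N + 1) + 1) := by
    refine (Finset.sum_le_card_nsmul _ _ (√2 * (N + 1) + 1) fun n _ =>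
      (norm_hop_le hs (hy.1 n) (hy.1 (n + 1))).trans (by linarith)).trans ?_
    rw [Finset.card_range, two_smul, two_mul]
  have hL0 : 0 < pathLength e y 2 := Finset.sum_pos (fun n _ => norm_pos_iff.2
    (hop_ne_zero hs hstep.1 (hy.1 n) (hy.1 (n + 1)))) ⟨0, by simp⟩
  have hD : pathDisp z e y 2 ≤ 2 * (-(N / 2) + 3) := by
    refine (Finset.sum_le_card_nsmul _ _ (-(N / 2 : ℝ) + 3) fun n _ => ?_).trans ?_
    · refine disp_le_of_diagonal hρ (hOρ _ (interior_subset hz)).le (hOρ _ (hy.1 n)).le ?_ ?_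
      · rw [add_hop, norm_sub_center]
        change ‖tab a ((tab a).symm (y (n + 1)))‖ ≤ ρ
        rw [AffineIsometryEquiv.apply_symm_apply]
        exact (hOρ _ (hy.1 (n + 1))).le
      -- The vertex `n` is replaced by the vertex `n + 2`, which has an incoming hop.
      · have h1 := hy.avoids hO hs hw hz (n + 1)
        rw [show y (n + 1 + 1) = y n from hyp n, show y (n + 1 + 2) = y (n + 1) from hyp (n + 1)] at h1
        exact h1
    · rw [Finset.card_range, two_smul, two_mul]
  -- For `N ≥ 6` the displacement bound is nonpositive, so the upper bound for the length may
  -- replace the length itself.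
  rw [div_mul_eq_mul_div, div_le_iff₀ hL0]
  have h6 : (6 : ℝ) ≤ N := by exact_mod_cast hN6
  have h7 : 0 ≤ √2 * ((N : ℝ) + 1) + 1 := by positivity
  nlinarith

/-- If the obstacle is small enough then all rotation numbers up to almost `√2 / 4` occur. -/
lemma exists_Icc_subset_admissibleRotationSet {ε : ℝ} (hε : 0 < ε) :
    ∃ δ : ℝ, 0 < δ ∧ ∀ O : Set Plane, IsObstacle O →
      (∃ r : ℝ, 2 * r < δ ∧ O ⊆ Metric.closedBall 0 r) → ∀ z ∈ interior O,
        Icc (-(√2 / 4) + ε) (√2 / 4 - ε) ⊆ admissibleRotationSet O z := by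
  -- This makes `N` even, at least `6`, and such that `ε N ≥ 4`.
  obtain ⟨m, hm⟩ := exists_nat_gt (4 / ε)
  set N := 2 * (m + 3) with hN
  set ρ : ℝ := 1 / (32 * (N + 1)) with hρ
  have hρ1 : ρ * (32 * (N + 1)) = 1 := by rw [hρ]; field_simp
  have hρ2 : ρ ≤ 1 / 32 := by
    rw [hρ]; gcongr; linarith [(N.cast_nonneg : (0 : ℝ) ≤ N)]
  refine ⟨2 * ρ, by positivity, fun O hO ⟨r, hr, hOr⟩ z hz => ?_⟩
  have h2 : (1 : ℝ) ≤ √2 := Real.one_le_sqrt.2 (by norm_num)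
  have hs : IsSmall O := ⟨r, by linarith, hOr⟩
  have hOρ : ∀ x ∈ O, ‖x‖ < ρ := fun x hx =>
    (mem_closedBall_zero_iff.1 (hOr hx)).trans_lt (by linarith)
  obtain ⟨u, hu, hule⟩ := exists_periodicRotationNumber_le hO hs hρ1 hOρ ⟨m + 3, by omega⟩
    (by omega) hz
  obtain ⟨a, ha0, ha⟩ := exists_admissibleRotationSet_eq_Icc hO hs hz
  have hua := periodicRotationNumbers_subset hO hs hu
  rw [ha] at hua ⊢
  have hmN : 4 ≤ ε * N := by
    rw [div_lt_iff₀ hε] at hm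
    rw [hN]; push_cast; nlinarith
  -- If `a` were smaller, then `-u ≤ a` would give `N / 2 - 3 < (N + 1) / 2 + √2 / 4 - ε N`, which
  -- is at most `N / 2 - 3` because `√2 / 4 ≤ 1 / 2` and `ε N ≥ 4`.
  have key : √2 / 4 - ε ≤ a := by
    by_contra! hc
    have h3 : √2 * √2 = 2 := Real.mul_self_sqrt (by norm_num)
    have h4 : √2 ≤ 2 := by nlinarith
    have h5 : (0 : ℝ) ≤ N := N.cast_nonneg
    have h6 : -u * (√2 * (N + 1) + 1) < (√2 / 4 - ε) * (√2 * (N + 1) + 1) :=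
      mul_lt_mul_of_pos_right (by linarith [hua.1]) (by positivity)
    have h7 : (√2 / 4 - ε) * (√2 * (N + 1) + 1) =
        (√2 * √2) / 4 * (N + 1) + √2 / 4 - ε * (√2 * (N + 1) + 1) := by ring
    have h8 : ε * N ≤ ε * (√2 * (N + 1) + 1) := by
      gcongr
      nlinarith
    rw [h7, h3] at h6
    linarith
  exact Icc_subset_Icc (by linarith) key

end

end SquareBilliard

theorem mainTheorem12 :
    (∀ O : Set Plane, IsObstacle O → IsSmall O → ∀ z ∈ interior O,
      (Convex ℝ (admissibleRotationSet O z) ∧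
        ∃ a : ℝ, 0 ≤ a ∧ admissibleRotationSet O z = Icc (-a) a) ∧
      (periodicRotationNumbers O z ⊆ admissibleRotationSet O z ∧
        admissibleRotationSet O z ⊆ closure (periodicRotationNumbers O z)) ∧
      (∀ u ∈ interior (admissibleRotationSet O z),
        ∃ Y : Set (PhaseSpace O), Y.Nonempty ∧ IsCompact Y ∧ IsForwardInvariantSet Y ∧
          ∀ y ∈ Y, ∀ γ, IsTrajectoryFrom y γ →
            HasAdmissibleType O γ ∧ HasRotationNumber z γ u)) ∧
    (∀ ε : ℝ, 0 < ε → ∃ δ : ℝ, 0 < δ ∧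
      ∀ O : Set Plane, IsObstacle O →
        (∃ r : ℝ, 2 * r < δ ∧ O ⊆ Metric.closedBall 0 r) →
        ∀ z ∈ interior O,
          Icc (-(√2 / 4) + ε) (√2 / 4 - ε) ⊆ admissibleRotationSet O z) := by
  refine ⟨fun O hO hs z hz => ⟨⟨convex_admissibleRotationSet hO hs hz,
    exists_admissibleRotationSet_eq_Icc hO hs hz⟩, ⟨periodicRotationNumbers_subset hO hs, ?_⟩,
    fun u hu => ?_⟩, fun ε hε => exists_Icc_subset_admissibleRotationSet hε⟩
  · rw [admissibleRotationSet_eq hO hs hz]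
    exact closure_mono (blockRotationNumbers_subset hO hs hz)
  · obtain ⟨e, he, ⟨l, hl⟩, hne, hb⟩ := exists_isBalanced hO hs hz hu
    exact exists_forwardInvariant hO hs hz he hl hne hb
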